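/- **Genus-$g$ star relation.** Let $g \ge 0$ be an integer. Let $\Sigma_{g,3}$ be the compact oriented surface of genus $g$ with three boundary components, realised as the $2:1$ branched cover of an annulus $$\Sigma_{g,3} = \Big\{(z,w)\in\mathbb{C}^2 : \tfrac14 \le |z| \le 2g+3,\ w^2 = z\prod_{k=1}^{2g+1}(z-k)\Big\},\qquad (z,w)\mapsto z,$$ which is ramified over the $2g+1$ points $1,2,\dots,2g+1$, connected over the inner boundary circle $|z|=\frac14$, and split over the outer boundary circle $|z|=2g+3$; it is oriented as a complex curve. Let $\mathrm{Mod}(\Sigma_{g,3})$ be its mapping class group: the group, under composition, of orientation-preserving homeomorphisms that fix the boundary pointwise, modulo isotopies that fix the boundary pointwise. Consider the following simple closed curves on $\Sigma_{g,3}$: - $a_1,a_2$ are the two lifts of the circle $|z|=\frac32$, which encloses the inner boundary circle and the first branch point; - $c_k$, for $1\le k\le 2g$, is the full preimage of the segment $[k,k+1]$; - $d_1$ is parallel to the boundary component over $|z|=\frac14$, and $d_2$, $d_3$ are parallel to the two boundary components over $|z|=2g+3$. (Thus $c_1,\dots,c_{2g}$ is a chain; $a_1,a_2$ are disjoint and,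 if $g\ge1$, each meets $c_1$ exactly once and no other $c_k$; and $a_1,a_2,d_1$ bound a pair of pants.) Write $T_x$ for the left-handed Dehn twist about $x$. Then in $\mathrm{Mod}(\Sigma_{g,3})$ $$\big(T_{a_1}T_{a_2}T_{c_1}\cdots T_{c_{2g}}\big)^{2g+1} = T_{d_1}^{\,g}\,T_{d_2}\,T_{d_3}.$$ For $g=1$ this is the classical star relation $(T_{a_1}T_{a_2}T_{c_1}T_{c_2})^3=T_{d_1}T_{d_2}T_{d_3}$. -/

import Mathlib

namespace StarRelation

/-! ## Mapping class groups of a space relative to a subset -/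

section MappingClassGroup

/-- The group of self-homeomorphisms of `X` that fix the subset `B` pointwise. -/
def homeoRel (X : Type*) [TopologicalSpace X] (B : Set X) : Subgroup (X ≃ₜ X) where
  carrier := {h | ∀ x ∈ B, h x = x}
  one_mem' := fun _ _ => rfl
  mul_mem' := by
    intro a b ha hb x hx
    show a (b x) = x
    rw [hb x hx, ha x hx]
  inv_mem' := by
    intro a ha x hx
    show a.symm x = x
    rw [Homeomorph.symm_apply_eq]
    exact (ha x hx).symm

/-- The homeomorphisms fixing `B` pointwise that are isotopic to the identity, through
homeomorphisms fixing `B` pointwise. -/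
def isotopicToId (X : Type*) [TopologicalSpace X] (B : Set X) : Subgroup (homeoRel X B) where
  carrier := {h | ∃ H : unitInterval → homeoRel X B,
    Continuous (fun p : unitInterval × X => (H p.1 : X ≃ₜ X) p.2) ∧ H 0 = 1 ∧ H 1 = h}
  one_mem' := ⟨fun _ => 1, continuous_snd, rfl, rfl⟩
  mul_mem' := by
    rintro _ _ ⟨H, hH, h0, rfl⟩ ⟨K, hK, k0, rfl⟩
    refine ⟨fun t => H t * K t, ?_, ?_, rfl⟩
    · exact hH.comp (continuous_fst.prodMk hK)
    · simp [h0, k0]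
  inv_mem' := by
    rintro _ ⟨H, hH, h0, rfl⟩
    refine ⟨fun t => H (unitInterval.symm t) * (H 1)⁻¹, ?_, ?_, ?_⟩
    · have h1 : Continuous fun p : unitInterval × X => ((H 1 : X ≃ₜ X)).symm p.2 :=
        (H 1 : X ≃ₜ X).symm.continuous.comp continuous_snd
      exact hH.comp ((unitInterval.continuous_symm.comp continuous_fst).prodMk h1)
    · simp
    · simp [h0]

instance isotopicToId_normal (X : Type*) [TopologicalSpace X] (B : Set X) :
    (isotopicToId X B).Normal where
  conj_mem := by
    rintro _ ⟨H, hH, h0, rfl⟩ k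
    refine ⟨fun t => k * H t * k⁻¹, ?_, ?_, rfl⟩
    · have h1 : Continuous fun p : unitInterval × X => ((k : X ≃ₜ X)).symm p.2 :=
        (k : X ≃ₜ X).symm.continuous.comp continuous_snd
      exact (k : X ≃ₜ X).continuous.comp (hH.comp (continuous_fst.prodMk h1))
    · simp [h0]

/-- The mapping class group: homeomorphisms of `X` fixing `B` pointwise, up to isotopies fixing
`B` pointwise. For a compact connected oriented surface `X` with nonempty boundary `B` this is
the usual `Mod(X)`: a homeomorphism that fixes the boundary pointwise preserves the
orientation. The product is composition, `(f * g) x = f (g x)`. -/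
abbrev MappingClassGroup (X : Type*) [TopologicalSpace X] (B : Set X) : Type _ :=
  homeoRel X B ⧸ isotopicToId X B

end MappingClassGroup

/-! ## The twist map of a round annulus, and its transport along an embedding -/

section Twist

/-- The closed round annulus `r ≤ |ζ| ≤ s` in the plane. -/
def annulus (r s : ℝ) : Set ℂ := {ζ | r ≤ ‖ζ‖ ∧ ‖ζ‖ ≤ s}

/-- The open round annulus `r < |ζ| < s` in the plane. -/
def openAnnulus (r s : ℝ) : Set ℂ := {ζ | r < ‖ζ‖ ∧ ‖ζ‖ < s}

/-- The coordinate `t ∈ [0, 1]` of a point of the annulus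
`{r ^ (1 - t) * s ^ t * exp (i θ) | 0 ≤ t ≤ 1, θ ∈ ℝ}`. -/
noncomputable def height (r s : ℝ) (ζ : ℂ) : ℝ := Real.log (‖ζ‖ / r) / Real.log (s / r)

/-- The `m`-th power of the left twist `(θ, t) ↦ (θ + 2 π t, t)` of the annulus. -/
noncomputable def annulusTwist (r s : ℝ) (m : ℤ) (ζ : ℂ) : ℂ :=
  ζ * Complex.exp ((2 * Real.pi * (m * height r s ζ) : ℝ) * Complex.I)

theorem norm_annulusTwist (r s : ℝ) (m : ℤ) (ζ : ℂ) : ‖annulusTwist r s m ζ‖ = ‖ζ‖ := by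
  rw [annulusTwist, norm_mul, Complex.norm_exp_ofReal_mul_I, mul_one]

theorem annulusTwist_annulusTwist (r s : ℝ) (m n : ℤ) (ζ : ℂ) :
    annulusTwist r s m (annulusTwist r s n ζ) = annulusTwist r s (m + n) ζ := by
  have h : height r s (annulusTwist r s n ζ) = height r s ζ := by
    rw [height, norm_annulusTwist, height]
  rw [annulusTwist, h, annulusTwist, annulusTwist, mul_assoc, ← Complex.exp_add]
  congr 2
  push_cast
  ring

theorem annulusTwist_zero (r s : ℝ) (ζ : ℂ) : annulusTwist r s 0 ζ = ζ := by
  simp [annulusTwist]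

theorem annulusTwist_of_not_mem {r s : ℝ} (hr : 0 < r) (hrs : r < s) (m : ℤ) {ζ : ℂ}
    (hζ : ζ ∈ annulus r s) (hζ' : ζ ∉ openAnnulus r s) : annulusTwist r s m ζ = ζ := by
  have hcase : ‖ζ‖ = r ∨ ‖ζ‖ = s := by
    obtain ⟨h1, h2⟩ := hζ
    by_contra hne
    push Not at hne
    exact hζ' ⟨lt_of_le_of_ne h1 (Ne.symm hne.1), lt_of_le_of_ne h2 hne.2⟩
  have hlog : Real.log (s / r) ≠ 0 :=
    (Real.log_pos ((one_lt_div hr).2 hrs)).ne'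
  rcases hcase with h | h
  · simp [annulusTwist, height, h, div_self hr.ne']
  · rw [annulusTwist, height, h, div_self hlog]
    have : Complex.exp ((2 * Real.pi * (m * 1) : ℝ) * Complex.I) = 1 := by
      rw [Complex.exp_eq_one_iff]
      exact ⟨m, by push_cast; ring⟩
    rw [this, mul_one]

theorem continuousOn_annulusTwist {r s : ℝ} (hr : 0 < r) (m : ℤ) :
    ContinuousOn (annulusTwist r s m) (annulus r s) := by
  have h : ContinuousOn (fun ζ : ℂ => height r s ζ) (annulus r s) := by
    unfold height
    refine ContinuousOn.div_const (ContinuousOn.log (by fun_prop) ?_) _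
    intro ζ hζ
    exact (div_pos (lt_of_lt_of_le hr hζ.1) hr).ne'
  unfold annulusTwist
  fun_prop

theorem isCompact_annulus (r s : ℝ) : IsCompact (annulus r s) := by
  refine Metric.isCompact_of_isClosed_isBounded ?_ ?_
  · exact (isClosed_le continuous_const continuous_norm).inter
      (isClosed_le continuous_norm continuous_const)
  · refine (Metric.isBounded_closedBall (x := (0 : ℂ)) (r := s)).subset ?_
    intro ζ hζ
    simpa using hζ.2

/-- The twist as a self-map of the closed annulus. -/
noncomputable def twistSelf (r s : ℝ) (m : ℤ) (ζ : annulus r s) : annulus r s :=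
  ⟨annulusTwist r s m ζ, by
    have h := ζ.2
    exact ⟨(norm_annulusTwist r s m ζ).symm ▸ h.1, (norm_annulusTwist r s m ζ).symm ▸ h.2⟩⟩

/-- The twist supported on an embedded annulus `φ`: the twist of the annulus, transported by `φ`,
on the image of `φ`, and the identity elsewhere. -/
noncomputable def twistFun {X : Type*} {r s : ℝ} (φ : annulus r s → X) (m : ℤ) : X → X :=
  Function.extend φ (φ ∘ twistSelf r s m) id

theorem twistFun_twistFun {X : Type*} {r s : ℝ} {φ : annulus r s → X}
    (hφ : Function.Injective φ) {m n : ℤ} (hmn : m + n = 0) (x : X) :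
    twistFun φ m (twistFun φ n x) = x := by
  by_cases hx : ∃ ζ, φ ζ = x
  · obtain ⟨ζ, rfl⟩ := hx
    have h : twistSelf r s m (twistSelf r s n ζ) = ζ := by
      apply Subtype.ext
      show annulusTwist r s m (annulusTwist r s n ζ) = ζ
      rw [annulusTwist_annulusTwist, hmn, annulusTwist_zero]
    simp only [twistFun, hφ.extend_apply, Function.comp_apply, h]
  · simp only [twistFun, Function.extend_apply' _ _ _ hx, id]

theorem twistFun_eq_self {X : Type*} {r s : ℝ} (hr : 0 < r) (hrs : r < s) {φ : annulus r s → X}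
    (hφ : Function.Injective φ) (m : ℤ) {x : X}
    (hx : ∀ ζ : annulus r s, (ζ : ℂ) ∈ openAnnulus r s → φ ζ ≠ x) : twistFun φ m x = x := by
  by_cases h : ∃ ζ, φ ζ = x
  · obtain ⟨ζ, rfl⟩ := h
    have h1 : twistSelf r s m ζ = ζ := by
      apply Subtype.ext
      exact annulusTwist_of_not_mem hr hrs m ζ.2 (fun hζ => hx ζ hζ rfl)
    simp only [twistFun, hφ.extend_apply, Function.comp_apply, h1]
  · simp only [twistFun, Function.extend_apply' _ _ _ h, id]

theorem continuous_twistFun {X : Type*} [TopologicalSpace X] [T2Space X] {r s : ℝ} (hr : 0 < r)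
    (hrs : r < s) {φ : annulus r s → X} (hc : Continuous φ) (hφ : Function.Injective φ)
    (ho : IsOpen {x | ∃ ζ : annulus r s, (ζ : ℂ) ∈ openAnnulus r s ∧ φ ζ = x}) (m : ℤ) :
    Continuous (twistFun φ m) := by
  have : CompactSpace (annulus r s) := isCompact_iff_compactSpace.1 (isCompact_annulus r s)
  have he := hc.isClosedEmbedding hφ
  have hτ : Continuous (twistSelf r s m) :=
    (continuousOn_iff_continuous_domRestrict.1 (continuousOn_annulusTwist hr m)).subtype_mk _
  have h1 : ContinuousOn (twistFun φ m) (Set.range φ) := by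
    rw [continuousOn_iff_continuous_domRestrict]
    have h2 : (Set.range φ).domRestrict (twistFun φ m) =
        (φ ∘ twistSelf r s m) ∘ he.isEmbedding.toHomeomorph.symm := by
      funext x
      obtain ⟨ζ, rfl⟩ := he.isEmbedding.toHomeomorph.surjective x
      rw [Function.comp_apply, Homeomorph.symm_apply_apply]
      show Function.extend φ (φ ∘ twistSelf r s m) id (φ ζ) = _
      rw [hφ.extend_apply]
    rw [h2]
    exact (hc.comp hτ).comp he.isEmbedding.toHomeomorph.symm.continuous
  have h3 : ContinuousOn (twistFun φ m)
      {x | ∃ ζ : annulus r s, (ζ : ℂ) ∈ openAnnulus r s ∧ φ ζ = x}ᶜ := by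
    refine continuousOn_id.congr ?_
    intro x hx
    exact twistFun_eq_self hr hrs hφ m (fun ζ hζ h => hx ⟨ζ, hζ, h⟩)
  have h4 := h1.union_of_isClosed h3 he.isClosed_range ho.isClosed_compl
  rw [← continuousOn_univ]
  refine h4.mono ?_
  intro x _
  by_cases hx : x ∈ Set.range φ
  · exact Or.inl hx
  · refine Or.inr ?_
    rintro ⟨ζ, _, h⟩
    exact hx ⟨ζ, h⟩

end Twist

/-! ## The surface of genus `g` with three boundary components -/

/-- The polynomial `z (z - 1) (z - 2) ⋯ (z - (2 g + 1))`. -/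
noncomputable def branchPoly (g : ℕ) (z : ℂ) : ℂ :=
  z * ∏ k ∈ Finset.Icc 1 (2 * g + 1), (z - (k : ℂ))

/-- The surface `Σ_{g,3}`, realised as the `2 : 1` cover `(z, w) ↦ z` of the round annulus
`1 / 4 ≤ |z| ≤ 2 g + 3`, given by `w ^ 2 = z (z - 1) ⋯ (z - (2 g + 1))`. It is ramified exactly
over the `2 g + 1` points `1, 2, …, 2 g + 1` of the interior of the annulus, the cover is
connected over the inner boundary circle (the polynomial has one root inside it) and splits over
the outer one (the polynomial has even degree). So this is a compact connected surface with
three boundary circles and Euler characteristic `-(2 g + 1) = 2 - 2 g - 3`, that is, of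
genus `g`. It is oriented as a complex curve. -/
def surfaceSet (g : ℕ) : Set (ℂ × ℂ) :=
  {x | 1 / 4 ≤ ‖x.1‖ ∧ ‖x.1‖ ≤ 2 * (g : ℝ) + 3 ∧ x.2 ^ 2 = branchPoly g x.1}

/-- `Σ_{g,3}` as a topological space. -/
abbrev Surface (g : ℕ) : Type := surfaceSet g

/-- The boundary of `Σ_{g,3}`: the points over the two boundary circles of the annulus. -/
def surfaceBoundary (g : ℕ) : Set (Surface g) :=
  {x | ‖x.1.1‖ = 1 / 4 ∨ ‖x.1.1‖ = 2 * (g : ℝ) + 3}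

/-- The mapping class group `Mod(Σ_{g,3})`. -/
abbrev Mod (g : ℕ) : Type := MappingClassGroup (Surface g) (surfaceBoundary g)

/-- A simple closed curve on `Σ_{g,3}` with an annular neighbourhood: a holomorphic, hence
orientation-preserving, embedding of a round annulus in the surface; the curve is the image of the
core circle `|ζ| = √(inner * outer)`. -/
structure AnnularCurve (g : ℕ) where
  inner : ℝ
  outer : ℝ
  inner_pos : 0 < inner
  inner_lt_outer : inner < outer
  toFun : ℂ → ℂ × ℂ
  holomorphic : DifferentiableOn ℂ toFun (annulus inner outer)
  injOn : Set.InjOn toFun (annulus inner outer)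
  mapsTo : Set.MapsTo toFun (annulus inner outer) (surfaceSet g)
  isOpen_image : IsOpen {x : Surface g | ∃ ζ ∈ openAnnulus inner outer, toFun ζ = x}
  disjoint_boundary : ∀ x ∈ surfaceBoundary g, ∀ ζ ∈ openAnnulus inner outer, toFun ζ ≠ x

namespace AnnularCurve

variable {g : ℕ} (A : AnnularCurve g)

/-- The embedding of the annulus as a map into the surface. -/
def embedding (ζ : annulus A.inner A.outer) : Surface g := ⟨A.toFun ζ, A.mapsTo ζ.2⟩

/-- The simple closed curve itself. -/
def core : Set (Surface g) := {x | ∃ ζ : ℂ, ‖ζ‖ = √(A.inner * A.outer) ∧ A.toFun ζ = x}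

theorem embedding_injective : Function.Injective A.embedding := by
  intro x y h
  exact Subtype.ext (A.injOn x.2 y.2 (congrArg Subtype.val h))

theorem continuous_embedding : Continuous A.embedding :=
  (continuousOn_iff_continuous_domRestrict.1 A.holomorphic.continuousOn).subtype_mk _

theorem isOpen_embedding_image :
    IsOpen {x | ∃ ζ : annulus A.inner A.outer,
      (ζ : ℂ) ∈ openAnnulus A.inner A.outer ∧ A.embedding ζ = x} := by
  convert A.isOpen_image using 1
  ext x
  constructor
  · rintro ⟨ζ, hζ, rfl⟩
    exact ⟨ζ, hζ, rfl⟩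
  · rintro ⟨ζ, hζ, h⟩
    exact ⟨⟨ζ, hζ.1.le, hζ.2.le⟩, hζ, Subtype.ext h⟩

/-- The left twist along the annulus as a homeomorphism of the surface. -/
noncomputable def twistHomeo : Surface g ≃ₜ Surface g where
  toFun := twistFun A.embedding 1
  invFun := twistFun A.embedding (-1)
  left_inv := twistFun_twistFun A.embedding_injective (by norm_num)
  right_inv := twistFun_twistFun A.embedding_injective (by norm_num)
  continuous_toFun := continuous_twistFun A.inner_pos A.inner_lt_outer A.continuous_embedding
    A.embedding_injective A.isOpen_embedding_image 1
  continuous_invFun := continuous_twistFun A.inner_pos A.inner_lt_outer A.continuous_embedding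
    A.embedding_injective A.isOpen_embedding_image (-1)

theorem twistHomeo_mem : A.twistHomeo ∈ homeoRel (Surface g) (surfaceBoundary g) := by
  intro x hx
  refine twistFun_eq_self A.inner_pos A.inner_lt_outer A.embedding_injective 1 ?_
  intro ζ hζ h
  exact A.disjoint_boundary x hx ζ hζ (congrArg Subtype.val h)

/-- The left-handed Dehn twist about the curve, as an element of `Mod(Σ_{g,3})`. -/
noncomputable def dehnTwist : Mod g :=
  QuotientGroup.mk (⟨A.twistHomeo, A.twistHomeo_mem⟩ : homeoRel (Surface g) (surfaceBoundary g))

end AnnularCurve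

/-! ## The curves -/

section Curves

theorem sqrt_sq (z : ℂ) : Complex.sqrt z ^ 2 = z := by
  have h := Complex.cpow_nat_inv_pow z (n := 2) two_ne_zero
  simpa [Complex.sqrt] using h

theorem differentiableOn_sqrt {f : ℂ → ℂ} {S : Set ℂ} (hf : DifferentiableOn ℂ f S)
    (h : ∀ z ∈ S, 0 < (f z).re) : DifferentiableOn ℂ (fun z => Complex.sqrt (f z)) S := by
  unfold Complex.sqrt
  exact hf.cpow_const (fun z hz => Or.inl (h z hz))

/-- A curve on which the projection to `z` is injective, given by a holomorphic branch `f` of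
`√(z (z - 1) ⋯ (z - (2 g + 1)))` on an annulus around the origin. -/
def graphCurve (g : ℕ) (r s : ℝ) (hr : 1 / 4 ≤ r) (hrs : r < s) (hs : s ≤ 2 * (g : ℝ) + 3)
    (f : ℂ → ℂ) (hf : DifferentiableOn ℂ f (annulus r s))
    (hsq : ∀ z ∈ annulus r s, f z ^ 2 = branchPoly g z)
    (hne : ∀ z ∈ annulus r s, f z ≠ 0) : AnnularCurve g where
  inner := r
  outer := s
  inner_pos := by linarith
  inner_lt_outer := hrs
  toFun := fun z => (z, f z)
  holomorphic := differentiableOn_id.prodMk hf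
  injOn := fun _ _ _ _ h => congrArg Prod.fst h
  mapsTo := fun z hz => ⟨hr.trans hz.1, hz.2.trans hs, hsq z hz⟩
  isOpen_image := by
    have hV : IsOpen (openAnnulus r s) :=
      (isOpen_lt continuous_const continuous_norm).inter
        (isOpen_lt continuous_norm continuous_const)
    have hsub : openAnnulus r s ⊆ annulus r s := fun z hz => ⟨hz.1.le, hz.2.le⟩
    have hfc : ContinuousOn f (openAnnulus r s) := hf.continuousOn.mono hsub
    have hU : IsOpen ({x : ℂ × ℂ | x.1 ∈ openAnnulus r s} ∩
        (fun x : ℂ × ℂ => x.2 + f x.1) ⁻¹' {0}ᶜ) := by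
      refine ContinuousOn.isOpen_inter_preimage ?_ (hV.preimage continuous_fst)
        isClosed_singleton.isOpen_compl
      exact continuous_snd.continuousOn.add
        (hfc.comp continuous_fst.continuousOn (fun x hx => hx))
    convert hU.preimage continuous_subtype_val using 1
    ext x
    constructor
    · rintro ⟨z, hz, h⟩
      have h1 : x.1.1 = z := by rw [← h]
      have h2 : x.1.2 = f z := by rw [← h]
      refine ⟨by simpa [h1] using hz, ?_⟩
      simp only [Set.mem_preimage, Set.mem_compl_iff, Set.mem_singleton_iff, h1, h2]
      intro h3
      exact hne z (hsub hz) (by linear_combination h3 / 2)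
    · rintro ⟨h1, h2⟩
      refine ⟨x.1.1, h1, ?_⟩
      have h3 : (x.1.2 - f x.1.1) * (x.1.2 + f x.1.1) = 0 := by
        have h4 := hsq _ (hsub h1)
        have h5 := x.2.2.2
        linear_combination h5 - h4
      rcases mul_eq_zero.1 h3 with h | h
      · exact Prod.ext rfl (sub_eq_zero.1 h).symm
      · exact absurd h h2
  disjoint_boundary := by
    rintro x hx z hz h
    have h1 : x.1.1 = z := by rw [← h]
    rcases hx with hx | hx <;> rw [h1] at hx
    · linarith [hz.1]
    · linarith [hz.2]

theorem re_natCast_sub_pos {z : ℂ} {k : ℕ} (h : ‖z‖ < k) : 0 < ((k : ℂ) - z).re := by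
  have h1 := Complex.re_le_norm z
  simp only [Complex.sub_re, Complex.natCast_re]
  linarith

theorem re_one_sub_div_pos {z : ℂ} {k : ℕ} (h : (k : ℝ) < ‖z‖) :
    0 < (1 - (k : ℂ) / z).re := by
  have h0 : 0 < ‖z‖ := lt_of_le_of_lt (Nat.cast_nonneg k) h
  have h1 := Complex.re_le_norm ((k : ℂ) / z)
  have h2 : ‖(k : ℂ) / z‖ < 1 := by
    rw [norm_div, Complex.norm_natCast, div_lt_one h0]
    exact h
  simp only [Complex.sub_re, Complex.one_re]
  linarith

theorem sqrt_ne_zero {z : ℂ} (h : 0 < z.re) : Complex.sqrt z ≠ 0 := by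
  intro h0
  have h1 := sqrt_sq z
  rw [h0] at h1
  rw [← h1] at h
  simp at h

/-- The branch of `√(z (z - 1) ⋯ (z - (2 g + 1)))` on `1 < |z| < 2` given by
`z √(1 - 1 / z) √(2 - z) √(3 - z) ⋯ √(2 g + 1 - z)`. -/
noncomputable def branchA (g : ℕ) (z : ℂ) : ℂ :=
  z * Complex.sqrt (1 - 1 / z) * ∏ k ∈ Finset.Icc 2 (2 * g + 1), Complex.sqrt ((k : ℂ) - z)

/-- The branch of `√(z (z - 1) ⋯ (z - (2 g + 1)))` on `|z| > 2 g + 1` given by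
`z ^ (g + 1) √(1 - 1 / z) √(1 - 2 / z) ⋯ √(1 - (2 g + 1) / z)`. -/
noncomputable def branchD (g : ℕ) (z : ℂ) : ℂ :=
  z ^ (g + 1) * ∏ k ∈ Finset.Icc 1 (2 * g + 1), Complex.sqrt (1 - (k : ℂ) / z)

theorem re_pos_branchA {g : ℕ} {z : ℂ} (hz : z ∈ annulus (5 / 4) (9 / 5)) :
    0 < (1 - 1 / z).re ∧ ∀ k ∈ Finset.Icc 2 (2 * g + 1), 0 < ((k : ℂ) - z).re := by
  constructor
  · have := re_one_sub_div_pos (z := z) (k := 1) (by have := hz.1; push_cast; linarith)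
    simpa using this
  · intro k hk
    have hk2 : (2 : ℝ) ≤ k := by exact_mod_cast (Finset.mem_Icc.1 hk).1
    exact re_natCast_sub_pos (by have := hz.2; linarith)

theorem ne_zero_of_mem_annulus {r s : ℝ} (hr : 0 < r) {z : ℂ} (hz : z ∈ annulus r s) : z ≠ 0 :=
  norm_pos_iff.1 (lt_of_lt_of_le hr hz.1)

theorem branchA_differentiableOn (g : ℕ) :
    DifferentiableOn ℂ (branchA g) (annulus (5 / 4) (9 / 5)) := by
  have h0 : ∀ z ∈ annulus (5 / 4) (9 / 5), z ≠ 0 :=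
    fun z hz => ne_zero_of_mem_annulus (by norm_num) hz
  unfold branchA
  refine (differentiableOn_id.mul (differentiableOn_sqrt ?_ ?_)).mul
    (DifferentiableOn.fun_finsetProd ?_)
  · exact (differentiableOn_const _).sub ((differentiableOn_const _).div differentiableOn_id h0)
  · exact fun z hz => (re_pos_branchA (g := g) hz).1
  · intro k hk
    exact differentiableOn_sqrt ((differentiableOn_const _).sub differentiableOn_id)
      (fun z hz => (re_pos_branchA (g := g) hz).2 k hk)

theorem branchA_sq (g : ℕ) (z : ℂ) (hz : z ∈ annulus (5 / 4) (9 / 5)) :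
    branchA g z ^ 2 = branchPoly g z := by
  have h0 : z ≠ 0 := ne_zero_of_mem_annulus (by norm_num) hz
  have h1 : ∏ k ∈ Finset.Icc 2 (2 * g + 1), ((k : ℂ) - z) =
      ∏ k ∈ Finset.Icc 2 (2 * g + 1), (z - (k : ℂ)) := by
    have : ∀ k ∈ Finset.Icc 2 (2 * g + 1), ((k : ℂ) - z) = (-1) * (z - (k : ℂ)) := by
      intro k _
      ring
    rw [Finset.prod_congr rfl this, Finset.prod_mul_distrib, Finset.prod_const, Nat.card_Icc]
    have h2 : 2 * g + 1 + 1 - 2 = 2 * g := by omega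
    rw [h2, pow_mul]
    simp
  have h3 : Finset.Icc 1 (2 * g + 1) = insert 1 (Finset.Icc 2 (2 * g + 1)) := by
    ext k
    simp only [Finset.mem_insert, Finset.mem_Icc]
    omega
  rw [branchA, branchPoly, mul_pow, mul_pow, sqrt_sq, ← Finset.prod_pow]
  simp only [sqrt_sq]
  rw [h1, h3, Finset.prod_insert (by simp)]
  push_cast
  field_simp

theorem branchA_ne_zero (g : ℕ) (z : ℂ) (hz : z ∈ annulus (5 / 4) (9 / 5)) :
    branchA g z ≠ 0 := by
  have h0 : z ≠ 0 := ne_zero_of_mem_annulus (by norm_num) hz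
  exact mul_ne_zero (mul_ne_zero h0 (sqrt_ne_zero (re_pos_branchA (g := g) hz).1))
    (Finset.prod_ne_zero_iff.2 fun k hk => sqrt_ne_zero ((re_pos_branchA hz).2 k hk))

theorem re_pos_branchD {g : ℕ} {z : ℂ} (hz : z ∈ annulus (2 * (g : ℝ) + 2) (2 * (g : ℝ) + 3)) :
    ∀ k ∈ Finset.Icc 1 (2 * g + 1), 0 < (1 - (k : ℂ) / z).re := by
  intro k hk
  have hk2 : (k : ℝ) ≤ 2 * g + 1 := by exact_mod_cast (Finset.mem_Icc.1 hk).2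
  exact re_one_sub_div_pos (by have := hz.1; linarith)

theorem branchD_differentiableOn (g : ℕ) :
    DifferentiableOn ℂ (branchD g) (annulus (2 * (g : ℝ) + 2) (2 * (g : ℝ) + 3)) := by
  have h0 : ∀ z ∈ annulus (2 * (g : ℝ) + 2) (2 * (g : ℝ) + 3), z ≠ 0 :=
    fun z hz => ne_zero_of_mem_annulus (by positivity) hz
  unfold branchD
  refine (differentiableOn_id.pow _).mul (DifferentiableOn.fun_finsetProd ?_)
  intro k hk
  exact differentiableOn_sqrt
    ((differentiableOn_const _).sub ((differentiableOn_const _).div differentiableOn_id h0))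
    (fun z hz => re_pos_branchD hz k hk)

theorem branchD_sq (g : ℕ) (z : ℂ) (hz : z ∈ annulus (2 * (g : ℝ) + 2) (2 * (g : ℝ) + 3)) :
    branchD g z ^ 2 = branchPoly g z := by
  have h0 : z ≠ 0 := ne_zero_of_mem_annulus (by positivity) hz
  have h1 : ∏ k ∈ Finset.Icc 1 (2 * g + 1), (z - (k : ℂ)) =
      z ^ (2 * g + 1) * ∏ k ∈ Finset.Icc 1 (2 * g + 1), (1 - (k : ℂ) / z) := by
    have h2 : ∀ k ∈ Finset.Icc 1 (2 * g + 1), z - (k : ℂ) = z * (1 - (k : ℂ) / z) := by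
      intro k _
      field_simp
    rw [Finset.prod_congr rfl h2, Finset.prod_mul_distrib, Finset.prod_const, Nat.card_Icc]
    simp
  rw [branchD, branchPoly, mul_pow, ← Finset.prod_pow, h1]
  simp only [sqrt_sq]
  ring

theorem branchD_ne_zero (g : ℕ) (z : ℂ) (hz : z ∈ annulus (2 * (g : ℝ) + 2) (2 * (g : ℝ) + 3)) :
    branchD g z ≠ 0 := by
  have h0 : z ≠ 0 := ne_zero_of_mem_annulus (by positivity) hz
  exact mul_ne_zero (pow_ne_zero _ h0)
    (Finset.prod_ne_zero_iff.2 fun k hk => sqrt_ne_zero (re_pos_branchD hz k hk))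

/-- The curve `a₁`: one of the two lifts of the circle `|z| = 3 / 2`, which encloses the inner
boundary circle and the first branch point. -/
noncomputable def curveA₁ (g : ℕ) : AnnularCurve g :=
  graphCurve g (5 / 4) (9 / 5) (by norm_num) (by norm_num)
    (by have : (0 : ℝ) ≤ g := Nat.cast_nonneg g
        linarith)
    (branchA g) (branchA_differentiableOn g) (branchA_sq g) (branchA_ne_zero g)

/-- The curve `a₂`: the other lift of the circle `|z| = 3 / 2`. -/
noncomputable def curveA₂ (g : ℕ) : AnnularCurve g :=
  graphCurve g (5 / 4) (9 / 5) (by norm_num) (by norm_num)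
    (by have : (0 : ℝ) ≤ g := Nat.cast_nonneg g
        linarith)
    (fun z => -branchA g z) (branchA_differentiableOn g).neg
    (fun z hz => by rw [neg_sq, branchA_sq g z hz])
    (fun z hz => neg_ne_zero.2 (branchA_ne_zero g z hz))

/-- The curve `d₂`: parallel to one of the two boundary components over the outer boundary circle
`|z| = 2 g + 3`. -/
noncomputable def curveD₂ (g : ℕ) : AnnularCurve g :=
  graphCurve g (2 * (g : ℝ) + 2) (2 * (g : ℝ) + 3)
    (by have : (0 : ℝ) ≤ g := Nat.cast_nonneg g
        linarith) (by linarith) le_rfl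
    (branchD g) (branchD_differentiableOn g) (branchD_sq g) (branchD_ne_zero g)

/-- The curve `d₃`: parallel to the other boundary component over the outer boundary circle. -/
noncomputable def curveD₃ (g : ℕ) : AnnularCurve g :=
  graphCurve g (2 * (g : ℝ) + 2) (2 * (g : ℝ) + 3)
    (by have : (0 : ℝ) ≤ g := Nat.cast_nonneg g
        linarith) (by linarith) le_rfl
    (fun z => -branchD g z) (branchD_differentiableOn g).neg
    (fun z hz => by rw [neg_sq, branchD_sq g z hz])
    (fun z hz => neg_ne_zero.2 (branchD_ne_zero g z hz))

/-- A curve with an annular neighbourhood `ζ ↦ (p ζ, q ζ)` that is the full preimage of a set `V` of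
values of `z`: the two points over `p ζ` correspond to `ζ` and `ι ζ`. -/
def foldedCurve (g : ℕ) (r s : ℝ) (hr : 0 < r) (hrs : r < s) (p q : ℂ → ℂ) (ι : ℂ → ℂ)
    (V : Set ℂ) (hV : IsOpen V)
    (hp : DifferentiableOn ℂ p (annulus r s)) (hq : DifferentiableOn ℂ q (annulus r s))
    (hinj : ∀ x ∈ annulus r s, ∀ y ∈ annulus r s, p x = p y → q x = q y → x = y)
    (hι : ∀ x ∈ openAnnulus r s, ι x ∈ openAnnulus r s ∧ p (ι x) = p x ∧ q (ι x) = -q x)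
    (hsq : ∀ x ∈ annulus r s, q x ^ 2 = branchPoly g (p x))
    (hle : ∀ x ∈ annulus r s, 1 / 4 ≤ ‖p x‖ ∧ ‖p x‖ ≤ 2 * (g : ℝ) + 3)
    (hlt : ∀ x ∈ openAnnulus r s, 1 / 4 < ‖p x‖ ∧ ‖p x‖ < 2 * (g : ℝ) + 3)
    (himg : ∀ z, z ∈ V ↔ ∃ x ∈ openAnnulus r s, p x = z) : AnnularCurve g where
  inner := r
  outer := s
  inner_pos := hr
  inner_lt_outer := hrs
  toFun := fun x => (p x, q x)
  holomorphic := hp.prodMk hq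
  injOn := fun x hx y hy h =>
    hinj x hx y hy (congrArg Prod.fst h) (congrArg Prod.snd h)
  mapsTo := fun x hx => ⟨(hle x hx).1, (hle x hx).2, hsq x hx⟩
  isOpen_image := by
    convert (hV.preimage (continuous_fst.comp continuous_subtype_val) :
      IsOpen {x : Surface g | x.1.1 ∈ V}) using 1
    ext x
    constructor
    · rintro ⟨y, hy, h⟩
      have h1 : x.1.1 = p y := by rw [← h]
      exact (himg _).2 ⟨y, hy, h1.symm⟩
    · intro h1
      obtain ⟨y, hy, h2⟩ := (himg x.1.1).1 h1
      have hy' : y ∈ annulus r s := ⟨hy.1.le, hy.2.le⟩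
      have h3 : (q y - x.1.2) * (-q y - x.1.2) = 0 := by
        have h4 := hsq y hy'
        have h5 := x.2.2.2
        rw [h2] at h4
        linear_combination h5 - h4
      rcases mul_eq_zero.1 h3 with h | h
      · exact ⟨y, hy, Prod.ext h2 (sub_eq_zero.1 h)⟩
      · obtain ⟨i1, i2, i3⟩ := hι y hy
        exact ⟨ι y, i1, Prod.ext (i2.trans h2) (i3.trans (sub_eq_zero.1 h))⟩
  disjoint_boundary := by
    rintro x hx y hy h
    have h1 : x.1.1 = p y := by rw [← h]
    have h2 := hlt y hy
    rcases hx with hx | hx <;> rw [h1] at hx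
    · linarith [h2.1]
    · linarith [h2.2]

/-- The branch of `√(z (z - 1) ⋯ (z - (2 g + 1)))` over the disc `|z| < 1`, in the
coordinate `ζ = √z`: `i ζ √(1 - ζ ^ 2) √(2 - ζ ^ 2) ⋯ √(2 g + 1 - ζ ^ 2)`. -/
noncomputable def branchD₁ (g : ℕ) (ζ : ℂ) : ℂ :=
  Complex.I * ζ * ∏ k ∈ Finset.Icc 1 (2 * g + 1), Complex.sqrt ((k : ℂ) - ζ ^ 2)

theorem re_pos_branchD₁ {g : ℕ} {ζ : ℂ} (hζ : ζ ∈ annulus (1 / 2) (3 / 4)) :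
    ∀ k ∈ Finset.Icc 1 (2 * g + 1), 0 < ((k : ℂ) - ζ ^ 2).re := by
  intro k hk
  have hk1 : (1 : ℝ) ≤ k := by exact_mod_cast (Finset.mem_Icc.1 hk).1
  refine re_natCast_sub_pos ?_
  rw [norm_pow]
  nlinarith [hζ.1, hζ.2]

/-- The curve `d₁`: the full preimage of the circle `|z| = 3 / 8`, parallel to the boundary
component over the inner boundary circle `|z| = 1 / 4`. -/
noncomputable def curveD₁ (g : ℕ) : AnnularCurve g :=
  foldedCurve g (1 / 2) (3 / 4) (by norm_num) (by norm_num) (fun ζ => ζ ^ 2) (branchD₁ g)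
    (fun ζ => -ζ) (openAnnulus (1 / 4) (9 / 16))
    ((isOpen_lt continuous_const continuous_norm).inter
        (isOpen_lt continuous_norm continuous_const))
    (differentiableOn_id.pow 2)
    (by
      unfold branchD₁
      refine ((differentiableOn_const _).mul differentiableOn_id).mul
        (DifferentiableOn.fun_finsetProd ?_)
      intro k hk
      exact differentiableOn_sqrt ((differentiableOn_const _).sub (differentiableOn_id.pow 2))
        (fun z hz => re_pos_branchD₁ hz k hk))
    (by
      intro x hx y hy h1 h2
      have h1' : x ^ 2 = y ^ 2 := h1
      have hne : Complex.I * ∏ k ∈ Finset.Icc 1 (2 * g + 1), Complex.sqrt ((k : ℂ) - x ^ 2) ≠ 0 :=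
        mul_ne_zero Complex.I_ne_zero
          (Finset.prod_ne_zero_iff.2 fun k hk => sqrt_ne_zero (re_pos_branchD₁ hx k hk))
      unfold branchD₁ at h2
      rw [← h1'] at h2
      refine mul_left_cancel₀ hne ?_
      linear_combination h2)
    (by
      intro x hx
      refine ⟨by simpa only [openAnnulus, Set.mem_ofPred_eq, norm_neg] using hx, by simp, ?_⟩
      simp [branchD₁])
    (by
      intro x hx
      have h : ∏ k ∈ Finset.Icc 1 (2 * g + 1), ((k : ℂ) - x ^ 2) =
          -∏ k ∈ Finset.Icc 1 (2 * g + 1), (x ^ 2 - (k : ℂ)) := by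
        have h1 : ∀ k ∈ Finset.Icc 1 (2 * g + 1), ((k : ℂ) - x ^ 2) = (-1) * (x ^ 2 - (k : ℂ)) := by
          intro k _
          ring
        rw [Finset.prod_congr rfl h1, Finset.prod_mul_distrib, Finset.prod_const, Nat.card_Icc,
          Nat.add_sub_cancel, pow_succ, pow_mul]
        simp
      rw [branchD₁, branchPoly, mul_pow, mul_pow, ← Finset.prod_pow]
      simp only [sqrt_sq]
      rw [h, Complex.I_sq]
      ring)
    (by
      intro x hx
      have hg : (0 : ℝ) ≤ g := Nat.cast_nonneg g
      simp only [norm_pow]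
      constructor <;> nlinarith [hx.1, hx.2])
    (by
      intro x hx
      have hg : (0 : ℝ) ≤ g := Nat.cast_nonneg g
      simp only [norm_pow]
      constructor <;> nlinarith [hx.1, hx.2])
    (by
      intro z
      constructor
      · intro hz
        refine ⟨Complex.sqrt z, ?_, sqrt_sq z⟩
        have h1 : ‖Complex.sqrt z‖ ^ 2 = ‖z‖ := by rw [← norm_pow, sqrt_sq]
        have h2 := norm_nonneg (Complex.sqrt z)
        constructor <;> nlinarith [hz.1, hz.2]
      · rintro ⟨x, hx, rfl⟩
        show 1 / 4 < ‖x ^ 2‖ ∧ ‖x ^ 2‖ < 9 / 16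
        rw [norm_pow]
        constructor <;> nlinarith [hx.1, hx.2])

/-- The branch of the square root of `z (z - 1) ⋯ (z - (2 g + 1)) / ((z - k) (z - (k + 1)))` on a
neighbourhood of the segment `[k, k + 1]` given by
`i ^ (2 g - k) √z √(z - 1) ⋯ √(z - (k - 1)) √(k + 2 - z) ⋯ √(2 g + 1 - z)`. -/
noncomputable def branchC (g k : ℕ) (z : ℂ) : ℂ :=
  Complex.I ^ (2 * g - k) * Complex.sqrt z *
    (∏ j ∈ Finset.Ico 1 k, Complex.sqrt (z - (j : ℂ))) *
    ∏ j ∈ Finset.Icc (k + 2) (2 * g + 1), Complex.sqrt ((j : ℂ) - z)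

/-- The map `ζ ↦ k + 1 / 2 + (ζ + ζ⁻¹) / 4`, which folds the unit circle `2 : 1` onto the segment
`[k, k + 1]` and the annulus `1 / 2 < |ζ| < 2` onto the inside of an ellipse with foci `k`, `k + 1`. -/
noncomputable def foldC (k : ℕ) (ζ : ℂ) : ℂ := (k : ℂ) + 1 / 2 + (ζ + ζ⁻¹) / 4

theorem foldC_norm {k : ℕ} {ζ : ℂ} (hζ : ζ ∈ annulus (1 / 2) 2) :
    ‖(ζ + ζ⁻¹) / 4‖ ≤ 5 / 8 := by
  have h0 : 0 < ‖ζ‖ := lt_of_lt_of_le (by norm_num) hζ.1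
  have h1 : ‖ζ + ζ⁻¹‖ ≤ ‖ζ‖ + ‖ζ‖⁻¹ := (norm_add_le _ _).trans (by rw [norm_inv])
  have h2 : ‖ζ‖ + ‖ζ‖⁻¹ ≤ 5 / 2 := by
    have h3 : ‖ζ‖ * ‖ζ‖⁻¹ = 1 := mul_inv_cancel₀ h0.ne'
    have h4 : 0 < ‖ζ‖⁻¹ := inv_pos.2 h0
    have h5 : ‖ζ‖ * (‖ζ‖ + ‖ζ‖⁻¹) ≤ ‖ζ‖ * (5 / 2) := by nlinarith [hζ.1, hζ.2]
    exact le_of_mul_le_mul_left h5 h0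
  rw [norm_div]
  norm_num
  linarith

theorem foldC_re {k : ℕ} {ζ : ℂ} (hζ : ζ ∈ annulus (1 / 2) 2) :
    (k : ℝ) - 1 / 8 ≤ (foldC k ζ).re ∧ (foldC k ζ).re ≤ (k : ℝ) + 9 / 8 := by
  have h1 := abs_le.1 ((Complex.abs_re_le_norm _).trans (foldC_norm (k := k) hζ))
  have h2 : (foldC k ζ).re = (k : ℝ) + 1 / 2 + ((ζ + ζ⁻¹) / 4).re := by
    simp [foldC]
  rw [h2]
  constructor <;> linarith [h1.1, h1.2]

theorem re_pos_branchC {g k : ℕ} (hk : 1 ≤ k) {ζ : ℂ} (hζ : ζ ∈ annulus (1 / 2) 2) :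
    0 < (foldC k ζ).re ∧ (∀ j ∈ Finset.Ico 1 k, 0 < (foldC k ζ - (j : ℂ)).re) ∧
      ∀ j ∈ Finset.Icc (k + 2) (2 * g + 1), 0 < ((j : ℂ) - foldC k ζ).re := by
  have h := foldC_re (k := k) hζ
  have hk' : (1 : ℝ) ≤ k := by exact_mod_cast hk
  refine ⟨by linarith [h.1], ?_, ?_⟩
  · intro j hj
    have hj' : (j : ℝ) + 1 ≤ k := by exact_mod_cast (Finset.mem_Ico.1 hj).2
    simp only [Complex.sub_re, Complex.natCast_re]
    linarith [h.1]
  · intro j hj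
    have hj' : (k : ℝ) + 2 ≤ j := by exact_mod_cast (Finset.mem_Icc.1 hj).1
    simp only [Complex.sub_re, Complex.natCast_re]
    linarith [h.2]

theorem branchC_ne_zero {g k : ℕ} (hk : 1 ≤ k) {ζ : ℂ} (hζ : ζ ∈ annulus (1 / 2) 2) :
    branchC g k (foldC k ζ) ≠ 0 := by
  obtain ⟨h1, h2, h3⟩ := re_pos_branchC (g := g) hk hζ
  exact mul_ne_zero (mul_ne_zero (mul_ne_zero (pow_ne_zero _ Complex.I_ne_zero)
    (sqrt_ne_zero h1)) (Finset.prod_ne_zero_iff.2 fun j hj => sqrt_ne_zero (h2 j hj)))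
    (Finset.prod_ne_zero_iff.2 fun j hj => sqrt_ne_zero (h3 j hj))

theorem branchC_sq {g k : ℕ} (hk : 1 ≤ k) (hkg : k ≤ 2 * g) (z : ℂ) :
    (z - (k : ℂ)) * (z - ((k : ℂ) + 1)) * branchC g k z ^ 2 = branchPoly g z := by
  have h1 : ∏ j ∈ Finset.Icc (k + 2) (2 * g + 1), ((j : ℂ) - z) =
      (-1) ^ (2 * g - k) * ∏ j ∈ Finset.Icc (k + 2) (2 * g + 1), (z - (j : ℂ)) := by
    have h2 : ∀ j ∈ Finset.Icc (k + 2) (2 * g + 1), ((j : ℂ) - z) = (-1) * (z - (j : ℂ)) := by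
      intro j _
      ring
    have h3 : 2 * g + 1 + 1 - (k + 2) = 2 * g - k := by omega
    rw [Finset.prod_congr rfl h2, Finset.prod_mul_distrib, Finset.prod_const, Nat.card_Icc, h3]
  have h4 : Finset.Icc 1 (2 * g + 1) =
      insert k (insert (k + 1) (Finset.Ico 1 k ∪ Finset.Icc (k + 2) (2 * g + 1))) := by
    ext j
    simp only [Finset.mem_insert, Finset.mem_Icc, Finset.mem_union, Finset.mem_Ico]
    omega
  have h5 : Disjoint (Finset.Ico 1 k) (Finset.Icc (k + 2) (2 * g + 1)) := by
    rw [Finset.disjoint_left]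
    intro j hj hj'
    simp only [Finset.mem_Icc, Finset.mem_Ico] at hj hj'
    omega
  have h6 : (Complex.I ^ (2 * g - k)) ^ 2 * (-1) ^ (2 * g - k) = 1 := by
    rw [← pow_mul, mul_comm, mul_comm _ 2, pow_mul, Complex.I_sq, ← mul_pow]
    norm_num
  have h7 : branchPoly g z = z * ((z - (k : ℂ)) * ((z - ((k : ℂ) + 1)) *
      ((∏ j ∈ Finset.Ico 1 k, (z - (j : ℂ))) *
        ∏ j ∈ Finset.Icc (k + 2) (2 * g + 1), (z - (j : ℂ))))) := by
    rw [branchPoly, h4, Finset.prod_insert, Finset.prod_insert, Finset.prod_union h5]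
    · push_cast
      ring
    · simp
    · simp
  rw [h7, branchC, mul_pow, mul_pow, mul_pow, ← Finset.prod_pow, ← Finset.prod_pow]
  simp only [sqrt_sq]
  rw [h1]
  linear_combination z * (z - (k : ℂ)) * (z - ((k : ℂ) + 1)) *
      (∏ j ∈ Finset.Ico 1 k, (z - (j : ℂ))) *
      (∏ j ∈ Finset.Icc (k + 2) (2 * g + 1), (z - (j : ℂ))) * h6

theorem foldC_sub_mul (k : ℕ) {ζ : ℂ} (hζ : ζ ≠ 0) :
    (foldC k ζ - (k : ℂ)) * (foldC k ζ - ((k : ℂ) + 1)) = ((ζ - ζ⁻¹) / 4) ^ 2 := by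
  unfold foldC
  field_simp
  ring

theorem foldC_ellipse (k : ℕ) {ζ : ℂ} (hζ : ζ ≠ 0) :
    ‖foldC k ζ - (k : ℂ)‖ + ‖foldC k ζ - ((k : ℂ) + 1)‖ = (‖ζ‖ + ‖ζ‖⁻¹) / 2 := by
  have h0 : 0 < ‖ζ‖ := norm_pos_iff.2 hζ
  have h1 : foldC k ζ - (k : ℂ) = (ζ + 1) ^ 2 / (4 * ζ) := by
    unfold foldC
    field_simp
    ring
  have h2 : foldC k ζ - ((k : ℂ) + 1) = (ζ - 1) ^ 2 / (4 * ζ) := by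
    unfold foldC
    field_simp
    ring
  have h3 : ‖ζ + 1‖ ^ 2 + ‖ζ - 1‖ ^ 2 = 2 * (‖ζ‖ ^ 2 + 1) := by
    have := parallelogram_law_with_norm ℝ ζ 1
    rw [norm_one] at this
    linear_combination this
  have h4 : ‖(4 : ℂ)‖ = 4 := by norm_num
  rw [h1, h2, norm_div, norm_div, norm_pow, norm_pow, norm_mul, h4, ← add_div, h3]
  field_simp
  ring

theorem add_inv_lt_iff {x : ℝ} (hx : 0 < x) : (x + x⁻¹) / 2 < 5 / 4 ↔ 1 / 2 < x ∧ x < 2 := by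
  have h1 : (x + x⁻¹) / 2 < 5 / 4 ↔ (x - 1 / 2) * (x - 2) < 0 := by
    have h2 : (x - 1 / 2) * (x - 2) = 2 * x * ((x + x⁻¹) / 2 - 5 / 4) := by
      field_simp
      ring
    rw [h2]
    constructor
    · intro h
      exact mul_neg_of_pos_of_neg (by linarith) (by linarith)
    · intro h
      by_contra h3
      have : 0 ≤ 2 * x * ((x + x⁻¹) / 2 - 5 / 4) := mul_nonneg (by linarith) (by linarith)
      linarith
  rw [h1]
  constructor
  · intro h
    constructor <;> nlinarith
  · rintro ⟨h2, h3⟩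
    nlinarith

theorem exists_foldC_eq (k : ℕ) (z : ℂ) : ∃ ζ : ℂ, ζ ≠ 0 ∧ foldC k ζ = z := by
  obtain ⟨d, hd⟩ : ∃ d : ℂ, d ^ 2 = (z - (k : ℂ)) * (z - ((k : ℂ) + 1)) := ⟨_, sqrt_sq _⟩
  have h0 : (2 * (z - (k : ℂ) - 1 / 2) + 2 * d) * (2 * (z - (k : ℂ) - 1 / 2) - 2 * d) = 1 := by
    linear_combination -4 * hd
  have h1 : 2 * (z - (k : ℂ) - 1 / 2) + 2 * d ≠ 0 := left_ne_zero_of_mul_eq_one h0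
  refine ⟨_, h1, ?_⟩
  rw [foldC, inv_eq_of_mul_eq_one_right h0]
  ring

theorem foldC_differentiableOn (k : ℕ) :
    DifferentiableOn ℂ (foldC k) (annulus (1 / 2) 2) := by
  unfold foldC
  exact (differentiableOn_const _).add ((differentiableOn_id.add (differentiableOn_inv.mono
    fun z hz => ne_zero_of_mem_annulus (by norm_num) hz)).div_const _)

theorem foldC_bounds {g k : ℕ} (hk : 1 ≤ k) (hkg : k ≤ 2 * g) {ζ : ℂ}
    (hζ : ζ ∈ annulus (1 / 2) 2) :
    1 / 4 < ‖foldC k ζ‖ ∧ ‖foldC k ζ‖ < 2 * (g : ℝ) + 3 := by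
  have hk' : (1 : ℝ) ≤ k := by exact_mod_cast hk
  have hkg' : (k : ℝ) ≤ 2 * g := by exact_mod_cast hkg
  constructor
  · have h1 := (foldC_re (k := k) hζ).1
    have h2 := Complex.re_le_norm (foldC k ζ)
    linarith
  · have h1 := foldC_norm (k := k) hζ
    have h2 : ‖foldC k ζ‖ ≤ ‖(k : ℂ)‖ + ‖(1 / 2 : ℂ)‖ + ‖(ζ + ζ⁻¹) / 4‖ := norm_add₃_le
    rw [Complex.norm_natCast] at h2
    have h3 : ‖(1 / 2 : ℂ)‖ = 1 / 2 := by norm_num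
    linarith

/-- The curve `c_k` for `1 ≤ k ≤ 2 g`: the full preimage of the segment `[k, k + 1]` joining two
consecutive branch points. -/
noncomputable def curveC (g k : ℕ) (hk : 1 ≤ k) (hkg : k ≤ 2 * g) : AnnularCurve g :=
  foldedCurve g (1 / 2) 2 (by norm_num) (by norm_num) (foldC k)
    (fun ζ => (ζ - ζ⁻¹) / 4 * branchC g k (foldC k ζ)) (fun ζ => ζ⁻¹)
    {z | ‖z - (k : ℂ)‖ + ‖z - ((k : ℂ) + 1)‖ < 5 / 4}
    (isOpen_lt (by fun_prop) continuous_const)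
    (foldC_differentiableOn k)
    (by
      have hp := foldC_differentiableOn k
      refine ((differentiableOn_id.sub (differentiableOn_inv.mono
        fun z hz => ne_zero_of_mem_annulus (by norm_num) hz)).div_const _).mul ?_
      unfold branchC
      refine (((differentiableOn_const _).mul (differentiableOn_sqrt hp ?_)).mul
        (DifferentiableOn.fun_finsetProd ?_)).mul (DifferentiableOn.fun_finsetProd ?_)
      · exact fun z hz => (re_pos_branchC (g := g) hk hz).1
      · intro j hj
        exact differentiableOn_sqrt (hp.sub (differentiableOn_const _))
          (fun z hz => (re_pos_branchC (g := g) hk hz).2.1 j hj)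
      · intro j hj
        exact differentiableOn_sqrt ((differentiableOn_const _).sub hp)
          (fun z hz => (re_pos_branchC (g := g) hk hz).2.2 j hj))
    (by
      intro x hx y hy h1 h2
      have h3 : (x - x⁻¹) / 4 = (y - y⁻¹) / 4 := by
        refine mul_right_cancel₀ (branchC_ne_zero (g := g) hk hx) ?_
        rw [h2, h1]
      unfold foldC at h1
      linear_combination 2 * h1 + 2 * h3)
    (by
      intro x hx
      have h0 : 0 < ‖x‖ := lt_trans (by norm_num) hx.1
      have h1 : foldC k x⁻¹ = foldC k x := by
        rw [foldC, foldC, inv_inv, add_comm x⁻¹]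
      refine ⟨⟨?_, ?_⟩, h1, ?_⟩
      · rw [norm_inv, one_div]
        exact (inv_lt_inv₀ (by norm_num) h0).2 hx.2
      · rw [norm_inv, inv_lt_comm₀ h0 (by norm_num), ← one_div]
        exact hx.1
      · simp only [h1, inv_inv]
        ring)
    (by
      intro x hx
      have h0 : x ≠ 0 := ne_zero_of_mem_annulus (by norm_num) hx
      rw [mul_pow, ← foldC_sub_mul k h0, branchC_sq hk hkg])
    (fun x hx => ⟨(foldC_bounds hk hkg hx).1.le, (foldC_bounds hk hkg hx).2.le⟩)
    (fun x hx => foldC_bounds hk hkg ⟨hx.1.le, hx.2.le⟩)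
    (by
      intro z
      constructor
      · intro hz
        obtain ⟨ζ, h0, rfl⟩ := exists_foldC_eq k z
        refine ⟨ζ, ?_, rfl⟩
        have hz' : ‖foldC k ζ - (k : ℂ)‖ + ‖foldC k ζ - ((k : ℂ) + 1)‖ < 5 / 4 := hz
        rw [foldC_ellipse k h0] at hz'
        exact (add_inv_lt_iff (norm_pos_iff.2 h0)).1 hz'
      · rintro ⟨ζ, hζ, rfl⟩
        have h0 : 0 < ‖ζ‖ := lt_trans (by norm_num) hζ.1
        show ‖foldC k ζ - (k : ℂ)‖ + ‖foldC k ζ - ((k : ℂ) + 1)‖ < 5 / 4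
        rw [foldC_ellipse k (norm_pos_iff.1 h0)]
        exact (add_inv_lt_iff h0).2 hζ)

end Curves

end StarRelation

namespace StarRelation

/-! ## Isotopies relative to a subset -/

section Isotopy

variable {X : Type*} [TopologicalSpace X]

/-! The deck involution `(z, w) ↦ (z, -w)` exchanges `a₁` with `a₂` and `d₂` with `d₃`, and
preserves each `c_k` and `d₁`. Hence the factors of the relation cover homeomorphisms of the plane
supported in the annulus: `T_{a₁} T_{a₂}` covers the twist `A` about `|z| = 3/2`, `T_{c_k}` covers
the half twist `H_k` exchanging `k` and `k + 1`, `T_{d₁}` covers the square of the twist `D` near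
the inner circle, and `T_{d₂} T_{d₃}` covers the twist `E` near the outer circle
(`isCoverOf_graphCurve`, `isCoverOf_curveC`, `isCoverOf_curveD₁`). An isotopy downstairs fixing the
branch points and the complement of the open annulus lifts (`exists_lift_isotopy`), and a lift that
fixes the boundary is unique (`deck_eq_one`). So it suffices to prove, with `m = 2g` and up to such
isotopies, that `(A H₁ ⋯ H_m)^(m+1) = D^m E` (`plane_relation`).

Since `D` commutes with all the other factors, this says that `(A D⁻¹ H₁ ⋯ H_m)^(m+1) = E D⁻¹`
(`pow_mul_inv_mem_isoSub`). Now `A D⁻¹ H₁ ⋯ H_m` is the end of an isotopy of the annulus that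
forgets the branch points, and only their motion matters: each of `1, …, m` moves one place outwards
through the upper half plane, while `m + 1` returns through the lower half plane to `1` and then
turns once clockwise about the origin. This is a motion in which all points turn clockwise past each
other cyclically, and it is freely homotopic to the rotation of a regular `(m+1)`-gon by
`-2π/(m+1)`. The homotopy `motion` interpolates linearly between the logarithms of the points;
`motion_ne` shows that no two points collide.

A free homotopy of motions gives a conjugacy of the end homeomorphisms (`exists_conj_of_motion`),
because motions of finitely many points extend to ambient isotopies (`exists_ambient`). The
`(m+1)`-st power of the polygon rotation is a full turn, which is `E D⁻¹`. The conjugating map is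
supported where the full turn is the identity, so it disappears from the power. -/

/-- The homeomorphisms isotopic to the identity relative to `B`, inside the group of all
homeomorphisms. -/
def isoSub (B : Set X) : Subgroup (X ≃ₜ X) := (isotopicToId X B).map (homeoRel X B).subtype

theorem mem_isoSub {B : Set X} {h : X ≃ₜ X} : h ∈ isoSub B ↔
    ∃ H : unitInterval → X ≃ₜ X, Continuous (fun p : unitInterval × X => H p.1 p.2) ∧
      (∀ t, ∀ b ∈ B, H t b = b) ∧ H 0 = 1 ∧ H 1 = h := by
  constructor
  · rintro ⟨k, ⟨H, hH, h0, h1⟩, rfl⟩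
    exact ⟨fun t => H t, hH, fun t => (H t).2, by simp [h0], by simp [h1]⟩
  · rintro ⟨H, hH, hB, h0, rfl⟩
    exact ⟨⟨H 1, hB 1⟩, ⟨fun t => ⟨H t, hB t⟩, hH, Subtype.ext h0, rfl⟩, rfl⟩

/-- Dividing a path by its starting point gives an isotopy from the identity. The path need only be
constant on `B`, so its members may permute the points of `B`, as products of half twists do. -/
theorem inv_mul_mem_isoSub {B : Set X} (H : unitInterval → X ≃ₜ X)
    (hH : Continuous fun p : unitInterval × X => H p.1 p.2)
    (hB : ∀ t, ∀ b ∈ B, H t b = H 0 b) : (H 0)⁻¹ * H 1 ∈ isoSub B := by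
  refine mem_isoSub.2 ⟨fun t => (H 0)⁻¹ * H t, (H 0).symm.continuous.comp hH, ?_, by simp, rfl⟩
  intro t b hb
  show (H 0).symm (H t b) = b
  rw [hB t b hb, Homeomorph.symm_apply_apply]

theorem conj_mem_isoSub {B : Set X} {f k : X ≃ₜ X} (hf : ∀ b ∈ B, f b ∈ B)
    (hk : k ∈ isoSub B) : f⁻¹ * k * f ∈ isoSub B := by
  obtain ⟨H, hH, hB, h0, rfl⟩ := mem_isoSub.1 hk
  refine mem_isoSub.2 ⟨fun t => f⁻¹ * H t * f, ?_, ?_, by simp [h0], rfl⟩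
  · exact f.symm.continuous.comp
      (hH.comp (continuous_fst.prodMk (f.continuous.comp continuous_snd)))
  · intro t b hb
    show f.symm (H t (f b)) = b
    rw [hB t _ (hf b hb), Homeomorph.symm_apply_apply]

/-- Conjugation by a map preserving `B` preserves `isoSub B`, so congruence passes to powers
although `f` and `k` need not fix `B` pointwise. -/
theorem inv_pow_mul_pow_mem_isoSub {B : Set X} {f k : X ≃ₜ X} (hf : ∀ b ∈ B, f b ∈ B)
    (hk : f⁻¹ * k ∈ isoSub B) (m : ℕ) : (f ^ m)⁻¹ * k ^ m ∈ isoSub B := by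
  induction m with
  | zero => simp
  | succ m ih =>
    -- The identity used is `f^-(m+1) k^(m+1) = (f⁻¹ (f^-m k^m) f) (f⁻¹ k)`.
    have h := mul_mem (conj_mem_isoSub hf ih) hk
    convert h using 1
    rw [pow_succ, pow_succ]
    group

/-- Homeomorphisms with disjoint supports commute. -/
theorem commute_of_disjoint {f k : X ≃ₜ X} (h : ∀ x, f x = x ∨ k x = x) : Commute f k := by
  have h1 : Equiv.Perm.Disjoint (f.toEquiv : Equiv.Perm X) k.toEquiv := h
  have h2 := h1.commute
  ext x
  exact congrArg (fun e : Equiv.Perm X => e x) h2.eq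

end Isotopy

/-- The bijection `(t, x) ↦ (t, H t x)` is proper, since it is the identity outside a compact set of
`x`, and a proper continuous bijection has a continuous inverse. -/
theorem continuous_symm_family {T : Type*} [TopologicalSpace T] [T2Space T] [CompactSpace T]
    (H : T → ℂ ≃ₜ ℂ) (hH : Continuous fun p : T × ℂ => H p.1 p.2) (R : ℝ)
    (hR : ∀ t x, R ≤ ‖x‖ → H t x = x) : Continuous fun p : T × ℂ => (H p.1).symm p.2 := by
  let e : T × ℂ ≃ T × ℂ :=
    { toFun := fun p => (p.1, H p.1 p.2)
      invFun := fun p => (p.1, (H p.1).symm p.2)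
      left_inv := fun p => by simp
      right_inv := fun p => by simp }
  have he : Continuous e := continuous_fst.prodMk hH
  have hp : IsProperMap e := by
    refine isProperMap_iff_isCompact_preimage.2 ⟨he, fun {K} hK => ?_⟩
    have h1 : IsCompact ((Set.univ : Set T) ×ˢ (Prod.snd '' K ∪ Metric.closedBall (0 : ℂ) R)) :=
      isCompact_univ.prod ((hK.image continuous_snd).union (isCompact_closedBall _ _))
    refine h1.of_isClosed_subset (hK.isClosed.preimage he) ?_
    rintro ⟨t, x⟩ hx
    refine ⟨Set.mem_univ _, ?_⟩
    rcases le_total R ‖x‖ with h | h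
    · left
      exact ⟨_, hx, hR t x h⟩
    · right
      simpa using h
  let E : T × ℂ ≃ₜ T × ℂ := e.toHomeomorphOfIsInducing
    (Topology.IsClosedEmbedding.of_continuous_injective_isClosedMap he e.injective
      hp.isClosedMap).isInducing
  exact continuous_snd.comp E.symm.continuous

/-! ## Ambient isotopies extending motions of finitely many points -/

section Ambient

/-- The map moving each `a j` by `b j - a j`, cut off at distance `ρ` from the points. -/
noncomputable def bump {n : ℕ} (ρ : ℝ) (a b : Fin n → ℂ) (x : ℂ) : ℂ :=
  x + ∑ j, (max 0 (1 - ‖x - a j‖ / ρ) : ℝ) • (b j - a j)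

theorem bump_self {n : ℕ} (ρ : ℝ) (a : Fin n → ℂ) (x : ℂ) : bump ρ a a x = x := by
  simp [bump]

theorem bump_point {n : ℕ} {ρ : ℝ} (hρ : 0 < ρ) {a : Fin n → ℂ} (b : Fin n → ℂ)
    (ha : ∀ i j, i ≠ j → ρ ≤ ‖a i - a j‖) (i : Fin n) : bump ρ a b (a i) = b i := by
  rw [bump, Finset.sum_eq_single i]
  · simp
  · intro j _ hj
    have h1 : 1 ≤ ‖a i - a j‖ / ρ := (one_le_div hρ).2 (ha i j hj.symm)
    rw [max_eq_left (by linarith), zero_smul]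
  · simp

theorem bump_of_far {n : ℕ} {ρ : ℝ} (hρ : 0 < ρ) {a : Fin n → ℂ} (b : Fin n → ℂ) {x : ℂ}
    (hx : ∀ j, ρ ≤ ‖x - a j‖) : bump ρ a b x = x := by
  rw [bump, Finset.sum_eq_zero, add_zero]
  intro j _
  have h1 : 1 ≤ ‖x - a j‖ / ρ := (one_le_div hρ).2 (hx j)
  rw [max_eq_left (by linarith), zero_smul]

/-- Each tent function is `1/ρ`-Lipschitz and multiplies a vector of length at most `ρ / (2(n+1))`.
The `n` terms together are a `1/2`-Lipschitz perturbation of the identity, which is invertible. -/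
theorem exists_homeo_bump {n : ℕ} {ρ : ℝ} (hρ : 0 < ρ) {a b : Fin n → ℂ}
    (hab : ∀ j, ‖b j - a j‖ ≤ ρ / (2 * (n + 1))) : ∃ h : ℂ ≃ₜ ℂ, ∀ x, h x = bump ρ a b x := by
  have key : ApproximatesLinearOn (bump ρ a b)
      ((ContinuousLinearEquiv.refl ℝ ℂ : ℂ ≃L[ℝ] ℂ) : ℂ →L[ℝ] ℂ) Set.univ (1 / 2) := by
    intro x _ y _
    have h1 : bump ρ a b x - bump ρ a b y -
        ((ContinuousLinearEquiv.refl ℝ ℂ : ℂ ≃L[ℝ] ℂ) : ℂ →L[ℝ] ℂ) (x - y) =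
        ∑ j, (max 0 (1 - ‖x - a j‖ / ρ) - max 0 (1 - ‖y - a j‖ / ρ) : ℝ) • (b j - a j) := by
      simp only [bump, sub_smul, Finset.sum_sub_distrib]
      simp
      ring
    rw [h1]
    have h2 : ∀ j, ‖(max 0 (1 - ‖x - a j‖ / ρ) - max 0 (1 - ‖y - a j‖ / ρ) : ℝ) • (b j - a j)‖
        ≤ ‖x - y‖ / (2 * (n + 1)) := by
      intro j
      have h3 : |max 0 (1 - ‖x - a j‖ / ρ) - max 0 (1 - ‖y - a j‖ / ρ)| ≤ ‖x - y‖ / ρ := by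
        refine (abs_max_sub_max_le_max _ _ _ _).trans ?_
        rw [sub_self, abs_zero, max_eq_right (abs_nonneg _)]
        have h4 : (1 - ‖x - a j‖ / ρ) - (1 - ‖y - a j‖ / ρ) = (‖y - a j‖ - ‖x - a j‖) / ρ := by
          ring
        rw [h4, abs_div, abs_of_pos hρ]
        gcongr
        refine (abs_norm_sub_norm_le _ _).trans ?_
        rw [sub_sub_sub_cancel_right, norm_sub_rev]
      rw [norm_smul, Real.norm_eq_abs]
      calc _ ≤ ‖x - y‖ / ρ * (ρ / (2 * (n + 1))) :=
            mul_le_mul h3 (hab j) (norm_nonneg _) (by positivity)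
        _ = ‖x - y‖ / (2 * (n + 1)) := by field_simp
    refine (norm_sum_le_of_le _ fun j _ => h2 j).trans ?_
    simp only [Finset.sum_const, Finset.card_univ, Fintype.card_fin, nsmul_eq_mul]
    have h5 : (n : ℝ) / (2 * (n + 1)) ≤ 1 / 2 := by
      rw [div_le_div_iff₀ (by positivity) (by norm_num)]
      linarith
    have h6 : ((1 / 2 : NNReal) : ℝ) = 1 / 2 := by norm_num
    rw [h6]
    calc (n : ℝ) * (‖x - y‖ / (2 * (n + 1))) = n / (2 * (n + 1)) * ‖x - y‖ := by ring
      _ ≤ 1 / 2 * ‖x - y‖ := by gcongr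
  refine ⟨key.toHomeomorph (bump ρ a b) (Or.inr ?_), fun x => rfl⟩
  have h7 : ‖((ContinuousLinearEquiv.refl ℝ ℂ : ℂ ≃L[ℝ] ℂ).symm : ℂ →L[ℝ] ℂ)‖₊ = 1 := by
    have : ((ContinuousLinearEquiv.refl ℝ ℂ : ℂ ≃L[ℝ] ℂ).symm : ℂ →L[ℝ] ℂ) =
        ContinuousLinearMap.id ℝ ℂ := rfl
    rw [this]
    ext
    exact ContinuousLinearMap.norm_id
  rw [h7]
  rw [← NNReal.coe_lt_coe]
  norm_num

/-- Compactness of the parameter space makes the separation uniform, so one bump radius serves at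
all times. -/
theorem exists_separation {Q : Type*} [TopologicalSpace Q] [CompactSpace Q] {n : ℕ} {U : Set ℂ}
    (hU : IsOpen U) {p : Q → Fin n → ℂ} (hp : Continuous p)
    (hinj : ∀ q, Function.Injective (p q)) (hmem : ∀ q j, p q j ∈ U) :
    ∃ ρ > 0, (∀ q i j, i ≠ j → ρ ≤ ‖p q i - p q j‖) ∧
      ∀ q j, ∀ x ∉ U, ρ ≤ ‖x - p q j‖ := by
  have hpj : ∀ j, Continuous fun q => p q j := fun j => (continuous_apply j).comp hp
  have h1 : ∃ ρ, 0 < ρ ∧ ∀ q ∈ (Set.univ : Set (Q × {ij : Fin n × Fin n // ij.1 ≠ ij.2})),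
      ρ ≤ ‖p q.1 q.2.1.1 - p q.1 q.2.1.2‖ := by
    refine isCompact_univ.exists_forall_le' (f := fun q : Q × {ij : Fin n × Fin n // ij.1 ≠ ij.2} =>
      ‖p q.1 q.2.1.1 - p q.1 q.2.1.2‖) ?_ ?_
    · refine Continuous.continuousOn ?_
      exact continuous_prod_of_discrete_right.2 fun ij =>
        ((hpj ij.1.1).sub (hpj ij.1.2)).norm
    · rintro ⟨q, ij⟩ _
      exact norm_pos_iff.2 (sub_ne_zero.2 fun h => ij.2 (hinj q h))
  obtain ⟨ρ₁, h1pos, h1⟩ := h1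
  have hK : IsCompact (Set.range fun q : Q × Fin n => p q.1 q.2) := by
    exact isCompact_range (continuous_prod_of_discrete_right.2 fun j => hpj j)
  obtain ⟨ρ₂, h2pos, h2⟩ := hK.exists_thickening_subset_open hU (by
    rintro _ ⟨q, rfl⟩
    exact hmem _ _)
  refine ⟨min ρ₁ ρ₂, lt_min h1pos h2pos, ?_, ?_⟩
  · intro q i j hij
    exact (min_le_left _ _).trans (h1 (q, ⟨(i, j), hij⟩) (Set.mem_univ _))
  · intro q j x hx
    refine (min_le_right _ _).trans ?_
    by_contra h
    push Not at h
    refine hx (h2 (Metric.mem_thickening_iff.2 ⟨_, ⟨(q, j), rfl⟩, ?_⟩))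
    rwa [dist_eq_norm]

/-- A continuous family of motions of `n` distinct points extends to a family of ambient
isotopies. -/
theorem exists_ambient {n : ℕ} {U : Set ℂ} (hU : IsOpen U)
    {p : unitInterval × unitInterval → Fin n → ℂ} (hp : Continuous p)
    (hinj : ∀ q, Function.Injective (p q)) (hmem : ∀ q j, p q j ∈ U) :
    ∃ Φ : unitInterval × unitInterval → ℂ ≃ₜ ℂ,
      Continuous (fun q : (unitInterval × unitInterval) × ℂ => Φ q.1 q.2) ∧
      (∀ y, Φ (0, y) = 1) ∧ (∀ s y j, Φ (s, y) (p (0, y) j) = p (s, y) j) ∧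
      ∀ q, ∀ x ∉ U, Φ q x = x := by
  obtain ⟨ρ, hρ, hsep, hfar⟩ := exists_separation hU hp hinj hmem
  have hδ : 0 < ρ / (2 * (n + 1)) := by positivity
  obtain ⟨δ, hδpos, hunif⟩ := Metric.uniformContinuous_iff.1
    (CompactSpace.uniformContinuous_of_continuous hp) _ hδ
  obtain ⟨N, hN⟩ := exists_nat_one_div_lt hδpos
  have hN0 : (0 : ℝ) < N + 1 := by positivity
  -- The clock `c k` stops at time `k / (N+1)`. Passing from `c k` to `c (k+1)` moves each point by
  -- at most the amount that `exists_homeo_bump` allows, and `c (N+1)` never stops.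
  let c : ℕ → unitInterval → unitInterval := fun k s =>
    ⟨min s (k / (N + 1)), le_min s.2.1 (by positivity), (min_le_left _ _).trans s.2.2⟩
  have hc : ∀ k, Continuous (c k) := fun k => by
    refine Continuous.subtype_mk ?_ _
    fun_prop
  have hc0 : ∀ k, c k 0 = 0 := fun k => Subtype.ext (by
    show min (0 : ℝ) _ = 0
    exact min_eq_left (by positivity))
  have hstep : ∀ k s y j, ‖p (c (k + 1) s, y) j - p (c k s, y) j‖ ≤ ρ / (2 * (n + 1)) := by
    intro k s y j
    have h1 : dist (c (k + 1) s, y) (c k s, y) < δ := by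
      rw [Prod.dist_eq, dist_self, max_eq_left dist_nonneg, Subtype.dist_eq, Real.dist_eq]
      refine lt_of_le_of_lt ?_ hN
      refine (abs_min_sub_min_le_max _ _ _ _).trans ?_
      rw [sub_self, abs_zero, max_eq_right (abs_nonneg _), ← sub_div]
      push_cast
      rw [add_sub_cancel_left, abs_of_pos (by positivity)]
    have h2 := (dist_le_pi_dist _ _ j).trans (hunif h1).le
    rwa [dist_eq_norm] at h2
  have main : ∀ k : ℕ, ∃ Φ : unitInterval × unitInterval → ℂ ≃ₜ ℂ,
      Continuous (fun q : (unitInterval × unitInterval) × ℂ => Φ q.1 q.2) ∧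
      (∀ y, Φ (0, y) = 1) ∧ (∀ s y j, Φ (s, y) (p (0, y) j) = p (c k s, y) j) ∧
      ∀ q, ∀ x ∉ U, Φ q x = x := by
    intro k
    induction k with
    | zero =>
      refine ⟨fun _ => 1, continuous_snd, fun _ => rfl, ?_, fun _ _ _ => rfl⟩
      intro s y j
      have : c 0 s = 0 := Subtype.ext (by
        show min (s : ℝ) _ = 0
        simp [s.2.1])
      rw [this]
      rfl
    | succ k ih =>
      obtain ⟨Φ, h1, h2, h3, h4⟩ := ih
      have hσ : ∀ q : unitInterval × unitInterval, ∃ h : ℂ ≃ₜ ℂ,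
          ∀ x, h x = bump ρ (p (c k q.1, q.2)) (p (c (k + 1) q.1, q.2)) x :=
        fun q => exists_homeo_bump hρ fun j => hstep k q.1 q.2 j
      choose σ hσ using hσ
      refine ⟨fun q => σ q * Φ q, ?_, ?_, ?_, ?_⟩
      · have h5 : Continuous fun q : (unitInterval × unitInterval) × ℂ => σ q.1 q.2 := by
          simp only [hσ, bump]
          have hk := hc k
          have hk' := hc (k + 1)
          fun_prop
        exact h5.comp (continuous_fst.prodMk h1)
      · intro y
        ext x
        show σ (0, y) (Φ (0, y) x) = x
        rw [h2, hσ]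
        simp only [hc0, bump_self]
        rfl
      · intro s y j
        show σ (s, y) (Φ (s, y) _) = _
        rw [h3, hσ]
        exact bump_point hρ _ (hsep _) j
      · intro q x hx
        show σ q (Φ q x) = x
        rw [h4 q x hx, hσ]
        exact bump_of_far hρ _ fun j => hfar _ j x hx
  obtain ⟨Φ, h1, h2, h3, h4⟩ := main (N + 1)
  refine ⟨Φ, h1, h2, ?_, h4⟩
  intro s y j
  have : c (N + 1) s = s := Subtype.ext (by
    show min (s : ℝ) _ = s
    push_cast
    rw [div_self hN0.ne']
    exact min_eq_left s.2.2)
  rw [h3, this]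

end Ambient

/-! ## Lifting isotopies of the plane to the surface -/

section Lift

/-- The complement of the open annulus under `Σ_{g,3}`, together with the branch points. -/
def branchSet (g : ℕ) : Set ℂ :=
  {z | ‖z‖ ≤ 1 / 4 ∨ 2 * (g : ℝ) + 3 ≤ ‖z‖ ∨ ∃ j ∈ Finset.Icc 1 (2 * g + 1), z = (j : ℂ)}

theorem mem_branchSet_of_branchPoly {g : ℕ} {z : ℂ} (h : branchPoly g z = 0) :
    z ∈ branchSet g := by
  rcases mul_eq_zero.1 h with h | h
  · left
    rw [h, norm_zero]
    norm_num
  · obtain ⟨j, hj, hz⟩ := Finset.prod_eq_zero_iff.1 h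
    exact Or.inr (Or.inr ⟨j, hj, sub_eq_zero.1 hz⟩)

theorem mem_branchSet_of_boundary {g : ℕ} {x : Surface g} (hx : x ∈ surfaceBoundary g) :
    x.1.1 ∈ branchSet g := by
  rcases hx with h | h
  · exact Or.inl h.le
  · exact Or.inr (Or.inl h.ge)

theorem norm_apply_of_fixed {g : ℕ} {f : ℂ ≃ₜ ℂ} (hf : ∀ b ∈ branchSet g, f b = b) {z : ℂ}
    (h1 : 1 / 4 ≤ ‖z‖) (h2 : ‖z‖ ≤ 2 * (g : ℝ) + 3) :
    1 / 4 ≤ ‖f z‖ ∧ ‖f z‖ ≤ 2 * (g : ℝ) + 3 := by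
  constructor
  · by_contra h
    push Not at h
    have h3 := f.injective (hf (f z) (Or.inl h.le))
    rw [h3] at h
    linarith
  · by_contra h
    push Not at h
    have h3 := f.injective (hf (f z) (Or.inr (Or.inl h.le)))
    rw [h3] at h
    linarith

theorem continuous_branchPoly (g : ℕ) : Continuous (branchPoly g) := by
  unfold branchPoly
  fun_prop

instance compactSpace_surface (g : ℕ) : CompactSpace (Surface g) := by
  refine isCompact_iff_compactSpace.1 (Metric.isCompact_of_isClosed_isBounded ?_ ?_)
  · have h := continuous_branchPoly g
    have h1 : IsClosed {x : ℂ × ℂ | 1 / 4 ≤ ‖x.1‖} := isClosed_le (by fun_prop) (by fun_prop)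
    have h2 : IsClosed {x : ℂ × ℂ | ‖x.1‖ ≤ 2 * (g : ℝ) + 3} :=
      isClosed_le (by fun_prop) (by fun_prop)
    have h3 : IsClosed {x : ℂ × ℂ | x.2 ^ 2 = branchPoly g x.1} :=
      isClosed_eq (by fun_prop) (by fun_prop)
    exact h1.inter (h2.inter h3)
  · obtain ⟨C, hC⟩ := (isCompact_closedBall (0 : ℂ) (2 * (g : ℝ) + 3)).exists_bound_of_continuousOn
      (continuous_branchPoly g).continuousOn
    refine isBounded_iff_forall_norm_le.2 ⟨max (2 * (g : ℝ) + 3) (C + 1), ?_⟩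
    rintro ⟨z, w⟩ ⟨-, h2, h3⟩
    have h4 := hC z (by simpa using h2)
    rw [← h3, norm_pow] at h4
    refine max_le_max h2 ?_
    show ‖w‖ ≤ C + 1
    nlinarith [sq_nonneg (‖w‖ - 1), norm_nonneg w]

/-- A branch of `√(z (z - 1) ⋯ (z - (2 g + 1)))` off the positive real axis. -/
noncomputable def slitBranch (g : ℕ) (z : ℂ) : ℂ :=
  Complex.sqrt (-z) * ∏ k ∈ Finset.Icc 1 (2 * g + 1), Complex.sqrt ((k : ℂ) - z)

theorem slitBranch_sq (g : ℕ) (z : ℂ) : slitBranch g z ^ 2 = branchPoly g z := by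
  have h1 : ∏ k ∈ Finset.Icc 1 (2 * g + 1), ((k : ℂ) - z) =
      -∏ k ∈ Finset.Icc 1 (2 * g + 1), (z - (k : ℂ)) := by
    have h2 : ∀ k ∈ Finset.Icc 1 (2 * g + 1), ((k : ℂ) - z) = (-1) * (z - (k : ℂ)) := by
      intro k _
      ring
    rw [Finset.prod_congr rfl h2, Finset.prod_mul_distrib, Finset.prod_const, Nat.card_Icc,
      Nat.add_sub_cancel, pow_succ, pow_mul]
    simp
  rw [slitBranch, mul_pow, ← Finset.prod_pow]
  simp only [sqrt_sq]
  rw [h1, branchPoly]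
  ring

theorem continuousAt_sqrt {z : ℂ} (hz : z ∈ Complex.slitPlane) :
    ContinuousAt Complex.sqrt z := by
  have : Complex.sqrt = fun z => z ^ (2⁻¹ : ℂ) := rfl
  rw [this]
  exact continuousAt_id.cpow continuousAt_const hz

theorem continuousAt_slitBranch (g : ℕ) {z : ℂ} (hz : -z ∈ Complex.slitPlane) :
    ContinuousAt (slitBranch g) z := by
  unfold slitBranch
  refine ContinuousAt.mul ?_ ?_
  · exact ContinuousAt.comp (f := fun z : ℂ => -z) (continuousAt_sqrt hz) continuousAt_neg
  · refine tendsto_finsetProd _ fun k _ => ?_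
    refine ContinuousAt.comp (f := fun z : ℂ => (k : ℂ) - z) (continuousAt_sqrt ?_) (by fun_prop)
    rw [Complex.mem_slitPlane_iff] at hz ⊢
    simp only [Complex.neg_re, Complex.neg_im, Complex.sub_re, Complex.sub_im, Complex.natCast_re,
      Complex.natCast_im] at hz ⊢
    have hk : (0 : ℝ) ≤ k := Nat.cast_nonneg k
    rcases hz with h | h
    · left
      linarith
    · right
      intro h'
      exact h (by linarith)

theorem branchPoly_ne_zero_of_slit (g : ℕ) {z : ℂ} (hz : -z ∈ Complex.slitPlane) :
    branchPoly g z ≠ 0 := by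
  rw [Complex.mem_slitPlane_iff] at hz
  refine mul_ne_zero ?_ (Finset.prod_ne_zero_iff.2 fun k _ h => ?_)
  · rintro rfl
    simp at hz
  · have hk : (0 : ℝ) ≤ k := Nat.cast_nonneg k
    rw [sub_eq_zero.1 h] at hz
    simp only [Complex.neg_re, Complex.neg_im, Complex.natCast_re, Complex.natCast_im] at hz
    rcases hz with h | h
    · linarith
    · simp at h

/-- Off the positive real axis, `slitBranch` lifts the radial segment from the point to the outer
boundary. Along it the sheet of `d` cannot jump, and at the boundary end `d` is the identity. -/
theorem deck_eq_of_slit {g : ℕ} {d : Surface g ≃ₜ Surface g}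
    (hd : ∀ x ∈ surfaceBoundary g, d x = x) (hcov : ∀ x, (d x).1.1 = x.1.1) {x : Surface g}
    (hx : -x.1.1 ∈ Complex.slitPlane) : d x = x := by
  obtain ⟨⟨z, w⟩, hz1, hz2, hzw⟩ := x
  simp only at hz1 hz2 hzw hx
  have hnz : 0 < ‖z‖ := by linarith
  have hne := branchPoly_ne_zero_of_slit g hx
  have hs0 : slitBranch g z ≠ 0 := fun h => hne (by rw [← slitBranch_sq, h]; simp)
  obtain ⟨ε, hε, hw⟩ : ∃ ε : ℂ, ε ^ 2 = 1 ∧ w = ε * slitBranch g z := by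
    refine ⟨w / slitBranch g z, ?_, by field_simp⟩
    rw [div_pow, slitBranch_sq, hzw, div_self hne]
  have hε0 : ε ≠ 0 := by
    rintro rfl
    simp at hε
  let R : ℝ := (2 * (g : ℝ) + 3) / ‖z‖
  have hR : 1 ≤ R := (one_le_div hnz).2 hz2
  have hRz : R * ‖z‖ = 2 * (g : ℝ) + 3 := div_mul_cancel₀ _ hnz.ne'
  let r : unitInterval → ℝ := fun u => 1 + u * (R - 1)
  have hr : ∀ u, 1 ≤ r u ∧ r u ≤ R := by
    intro u
    have h1 := u.2.1
    have h2 := u.2.2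
    constructor <;> simp only [r] <;> nlinarith
  have hrc : Continuous r := by
    simp only [r]
    fun_prop
  have hnorm : ∀ u, ‖((r u : ℝ) : ℂ) * z‖ = r u * ‖z‖ := by
    intro u
    rw [norm_mul, Complex.norm_real, Real.norm_eq_abs, abs_of_nonneg (by linarith [(hr u).1])]
  have hslit : ∀ u, -(((r u : ℝ) : ℂ) * z) ∈ Complex.slitPlane := by
    intro u
    have h1 : 0 < r u := by linarith [(hr u).1]
    rw [Complex.mem_slitPlane_iff] at hx ⊢
    simp only [Complex.neg_re, Complex.neg_im, Complex.re_ofReal_mul, Complex.im_ofReal_mul] at hx ⊢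
    rcases hx with h | h
    · left
      nlinarith
    · right
      intro h'
      apply h
      have : r u * z.im = 0 := by linarith
      rcases mul_eq_zero.1 this with h2 | h2
      · linarith
      · linarith
  let X : unitInterval → Surface g := fun u => ⟨(((r u : ℝ) : ℂ) * z,
    ε * slitBranch g (((r u : ℝ) : ℂ) * z)), by
      rw [surfaceSet, Set.mem_ofPred_eq, hnorm]
      refine ⟨by nlinarith [(hr u).1], by rw [← hRz]; nlinarith [(hr u).2], ?_⟩
      rw [mul_pow, hε, one_mul, slitBranch_sq]⟩
  have hg : Continuous fun u => ε * slitBranch g (((r u : ℝ) : ℂ) * z) := by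
    refine continuous_const.mul (continuous_iff_continuousAt.2 fun u => ?_)
    exact ContinuousAt.comp (f := fun u : unitInterval => ((r u : ℝ) : ℂ) * z)
      (continuousAt_slitBranch g (hslit u)) (by fun_prop)
  have hX : Continuous X := Continuous.subtype_mk (by fun_prop) _
  have key := isPreconnected_univ.eq_of_sq_eq (S := (Set.univ : Set unitInterval))
    (f := fun u => (d (X u)).1.2) (g := fun u => ε * slitBranch g (((r u : ℝ) : ℂ) * z))
    (by
      have := d.continuous.comp hX
      fun_prop) hg.continuousOn
    (by
      intro u _
      show (d (X u)).1.2 ^ 2 = (ε * slitBranch g (((r u : ℝ) : ℂ) * z)) ^ 2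
      rw [(d (X u)).2.2.2, hcov]
      exact (X u).2.2.2.symm)
    (by
      intro u _ h
      refine branchPoly_ne_zero_of_slit g (hslit u) ?_
      rw [← slitBranch_sq]
      rcases mul_eq_zero.1 h with h | h
      · exact absurd h hε0
      · rw [h]
        simp)
    (Set.mem_univ 1)
    (by
      have : X 1 ∈ surfaceBoundary g := by
        right
        show ‖((r 1 : ℝ) : ℂ) * z‖ = _
        rw [hnorm, ← hRz]
        simp [r]
      show (d (X 1)).1.2 = _
      rw [hd _ this])
  have hX0 : X 0 = ⟨(z, w), hz1, hz2, hzw⟩ := by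
    apply Subtype.ext
    simp [X, r, hw]
  have h0 := key (Set.mem_univ 0)
  rw [← hX0]
  exact Subtype.ext (Prod.ext (hcov _) h0)

/-- The points off the slit are dense in the surface, and `d` fixes them. A point over the positive
real axis, branch points included, is reached as a limit of points rotated slightly into the upper
half plane. -/
theorem deck_eq_one {g : ℕ} {d : Surface g ≃ₜ Surface g}
    (hd : ∀ x ∈ surfaceBoundary g, d x = x) (hcov : ∀ x, (d x).1.1 = x.1.1) : d = 1 := by
  ext1 x
  show d x = x
  by_cases hx : -x.1.1 ∈ Complex.slitPlane
  · exact deck_eq_of_slit hd hcov hx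
  obtain ⟨⟨z, w⟩, hz1, hz2, hzw⟩ := x
  simp only at hz1 hz2 hzw hx
  rw [Complex.mem_slitPlane_iff] at hx
  simp only [Complex.neg_re, Complex.neg_im, not_or, not_lt, not_not, neg_eq_zero,
    Left.neg_nonpos_iff] at hx
  have hzr : z = (z.re : ℂ) := Complex.ext rfl (by simp [hx.2])
  have hzp : 0 < z.re := by
    refine lt_of_le_of_ne hx.1 fun h => ?_
    rw [hzr, ← h] at hz1
    norm_num at hz1
  let ζ : ℝ → ℂ := fun θ => z * Complex.exp (θ * Complex.I)
  have hζn : ∀ θ, ‖ζ θ‖ = ‖z‖ := fun θ => by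
    simp only [ζ]
    rw [norm_mul, Complex.norm_exp_ofReal_mul_I, mul_one]
  have hζc : Continuous ζ := by
    simp only [ζ]
    fun_prop
  -- The root closer to `w` is chosen. From `(v - w)(v + w) = v² - w²` its distance to `w` is then
  -- at most the square root of `|v² - w²|`, which also covers the case `w = 0`.
  have hroot : ∀ θ, ∃ v, v ^ 2 = branchPoly g (ζ θ) ∧
      ‖v - w‖ ^ 2 ≤ ‖branchPoly g (ζ θ) - branchPoly g z‖ := by
    intro θ
    obtain ⟨v, hv⟩ : ∃ v, v ^ 2 = branchPoly g (ζ θ) := ⟨_, sqrt_sq _⟩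
    have h1 : branchPoly g (ζ θ) - branchPoly g z = (v - w) * (v + w) := by
      rw [← hv, ← hzw]
      ring
    rcases le_total ‖v - w‖ ‖v + w‖ with h | h
    · refine ⟨v, hv, ?_⟩
      rw [h1, norm_mul, sq]
      gcongr
    · refine ⟨-v, by rw [neg_sq, hv], ?_⟩
      have h2 : ‖-v - w‖ = ‖v + w‖ := by
        rw [← norm_neg]
        congr 1
        ring
      rw [h1, norm_mul, sq, h2]
      gcongr
  choose v hv1 hv2 using hroot
  let X : ℝ → Surface g := fun θ => ⟨(ζ θ, v θ), by
    rw [surfaceSet, Set.mem_ofPred_eq, hζn]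
    exact ⟨hz1, hz2, hv1 θ⟩⟩
  have hv : Filter.Tendsto v (nhds 0) (nhds w) := by
    rw [tendsto_iff_norm_sub_tendsto_zero]
    have h3 : Filter.Tendsto (fun θ => √‖branchPoly g (ζ θ) - branchPoly g z‖) (nhds 0)
        (nhds 0) := by
      have h4 : Continuous fun θ => √‖branchPoly g (ζ θ) - branchPoly g z‖ := by
        have := (continuous_branchPoly g).comp hζc
        simp only [Function.comp_def] at this
        fun_prop
      have h5 := h4.tendsto 0
      simpa [ζ] using h5
    refine squeeze_zero (fun _ => norm_nonneg _) (fun θ => ?_) h3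
    exact Real.le_sqrt_of_sq_le (hv2 θ)
  have hX : Filter.Tendsto X (nhds 0) (nhds ⟨(z, w), hz1, hz2, hzw⟩) := by
    refine tendsto_subtype_rng.2 (Filter.Tendsto.prodMk_nhds ?_ hv)
    have := hζc.tendsto 0
    simpa [ζ] using this
  refine (isClosed_eq d.continuous continuous_id).mem_of_tendsto
    (hX.mono_left (nhdsWithin_le_nhds (s := Set.Ioi 0))) ?_
  filter_upwards [Ioo_mem_nhdsGT Real.pi_pos] with θ hθ
  refine deck_eq_of_slit hd hcov (Complex.mem_slitPlane_iff.2 (Or.inr ?_))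
  show (-(z * Complex.exp (θ * Complex.I))).im ≠ 0
  rw [hzr, Complex.neg_im, Complex.im_ofReal_mul, Complex.exp_ofReal_mul_I_im]
  exact neg_ne_zero.2 (mul_pos hzp (Real.sin_pos_of_pos_of_lt_pi hθ.1 hθ.2)).ne'

/-- An isotopy fixing the zeros of `branchPoly` has a continuous square root of the ratio
`branchPoly (H t z) / branchPoly z`. -/
theorem exists_sqrt_ratio {g : ℕ} {H : unitInterval → ℂ ≃ₜ ℂ}
    (hH : Continuous fun p : unitInterval × ℂ => H p.1 p.2)
    (hB : ∀ t, ∀ b ∈ branchSet g, H t b = b) (h0 : H 0 = 1) :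
    ∃ S : unitInterval × ℂ → ℂ, ContinuousOn S {p | branchPoly g p.2 ≠ 0} ∧
      (∀ t z, branchPoly g z ≠ 0 → S (t, z) ^ 2 = branchPoly g (H t z) / branchPoly g z) ∧
      (∀ t z, branchPoly g z ≠ 0 → S (t, z) ≠ 0) ∧ (∀ z, S (0, z) = 1) ∧
      ∀ t, ∀ z ∈ branchSet g, S (t, z) = 1 := by
  let Z : Set ℂ := {z | branchPoly g z ≠ 0}
  have hb := continuous_branchPoly g
  have hne : ∀ t, ∀ z : Z, branchPoly g (H t z) ≠ 0 := by
    intro t z h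
    have h1 := hB t _ (mem_branchSet_of_branchPoly h)
    rw [(H t).injective h1] at h
    exact z.2 h
  have hQc : Continuous fun p : unitInterval × Z => branchPoly g (H p.1 p.2) / branchPoly g p.2 := by
    refine Continuous.div ?_ (by fun_prop) fun p => p.2.2
    exact hb.comp (hH.comp (continuous_fst.prodMk (continuous_subtype_val.comp continuous_snd)))
  let Q : C(unitInterval × Z, {z : ℂ // z ≠ 0}) :=
    ⟨fun p => ⟨_, div_ne_zero (hne p.1 p.2) p.2.2⟩, hQc.subtype_mk _⟩
  have cov := Complex.isCoveringMap_exp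
  have hQ0 : ∀ a : Z, Q (0, a) = ⟨_, ((0 : C(Z, ℂ)) a).exp_ne_zero⟩ := by
    intro a
    apply Subtype.ext
    show branchPoly g (H 0 a) / branchPoly g a = Complex.exp 0
    rw [h0, Complex.exp_zero]
    exact div_self a.2
  -- `L` is the continuous logarithm of the ratio that starts from `0` at time `0`; the required
  -- root is `exp (L / 2)`.
  let L := cov.liftHomotopy Q 0 hQ0
  have hL : ∀ t, ∀ z : Z, Complex.exp (L (t, z)) = branchPoly g (H t z) / branchPoly g z := by
    intro t z
    exact congrArg Subtype.val (congrFun (cov.liftHomotopy_lifts Q 0 hQ0) (t, z))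
  have hL0 : ∀ z : Z, L (0, z) = 0 := fun z => cov.liftHomotopy_zero Q 0 hQ0 z
  -- At a fixed point the ratio is constantly `1`, so uniqueness of path lifting keeps the logarithm
  -- at `0`. This makes the lifted isotopy fix the boundary.
  have hLB : ∀ t, ∀ z : Z, (z : ℂ) ∈ branchSet g → L (t, z) = 0 := by
    intro t z hz
    have := cov.eq_of_comp_eq (g₁ := fun t : unitInterval => L (t, z)) (g₂ := fun _ => 0)
      (by fun_prop) continuous_const (by
        funext t
        apply Subtype.ext
        show Complex.exp (L (t, z)) = Complex.exp 0
        rw [hL, hB t _ hz, div_self z.2, Complex.exp_zero]) 0 (hL0 z)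
    exact congrFun this t
  classical
  refine ⟨fun p => if h : branchPoly g p.2 ≠ 0 then Complex.exp (L (p.1, ⟨p.2, h⟩) / 2) else 1,
    ?_, ?_, ?_, ?_, ?_⟩
  · rw [continuousOn_iff_continuous_domRestrict]
    have h1 : Continuous fun p : {p : unitInterval × ℂ | branchPoly g p.2 ≠ 0} =>
        Complex.exp (L (p.1.1, ⟨p.1.2, p.2⟩) / 2) := by
      have h2 : Continuous fun p : {p : unitInterval × ℂ | branchPoly g p.2 ≠ 0} =>
          ((p.1.1, ⟨p.1.2, p.2⟩) : unitInterval × Z) :=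
        (continuous_fst.comp continuous_subtype_val).prodMk
          ((continuous_snd.comp continuous_subtype_val).subtype_mk _)
      exact Complex.continuous_exp.comp ((L.continuous.comp h2).div_const 2)
    refine h1.congr ?_
    rintro ⟨⟨t, z⟩, hp⟩
    have hp' : branchPoly g z ≠ 0 := hp
    simp only [Set.domRestrict_apply]
    rw [dif_pos hp']
  · intro t z hz
    simp only [dif_pos hz]
    rw [← Complex.exp_nat_mul, ← hL t ⟨z, hz⟩]
    congr 1
    push_cast
    ring
  · intro t z hz
    simp only [dif_pos hz]
    exact Complex.exp_ne_zero _
  · intro z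
    by_cases hz : branchPoly g z ≠ 0
    · simp only [dif_pos hz, hL0]
      simp
    · simp only [dif_neg hz]
  · intro t z hB
    by_cases hz : branchPoly g z ≠ 0
    · simp only [dif_pos hz]
      rw [hLB t ⟨z, hz⟩ hB]
      simp
    · simp only [dif_neg hz]

/-- The lift is `(z, w) ↦ (H t z, w S(t, z))`, where `S` is the root of the ratio from
`exists_sqrt_ratio`. -/
theorem exists_lift_isotopy {g : ℕ} {H : unitInterval → ℂ ≃ₜ ℂ}
    (hH : Continuous fun p : unitInterval × ℂ => H p.1 p.2)
    (hB : ∀ t, ∀ b ∈ branchSet g, H t b = b) (h0 : H 0 = 1) :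
    ∃ E : unitInterval → Surface g ≃ₜ Surface g,
      Continuous (fun p : unitInterval × Surface g => E p.1 p.2) ∧
      (∀ t, ∀ x ∈ surfaceBoundary g, E t x = x) ∧ E 0 = 1 ∧
      ∀ t x, (E t x).1.1 = H t x.1.1 := by
  obtain ⟨S, hSc, hS2, hSne, hS0, hSB⟩ := exists_sqrt_ratio hH hB h0
  have hb := continuous_branchPoly g
  have hfix : ∀ t z, branchPoly g z = 0 → H t z = z :=
    fun t z h => hB t z (mem_branchSet_of_branchPoly h)
  have hsq : ∀ t, ∀ x : Surface g, (x.1.2 * S (t, x.1.1)) ^ 2 = branchPoly g (H t x.1.1) := by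
    intro t x
    rw [mul_pow, x.2.2.2]
    by_cases hz : branchPoly g x.1.1 = 0
    · rw [hfix t _ hz, hz, zero_mul]
    · rw [hS2 t _ hz, mul_div_cancel₀ _ hz]
  let G : unitInterval → Surface g → Surface g := fun t x =>
    ⟨(H t x.1.1, x.1.2 * S (t, x.1.1)),
      ⟨(norm_apply_of_fixed (hB t) x.2.1 x.2.2.1).1, (norm_apply_of_fixed (hB t) x.2.1 x.2.2.1).2,
        hsq t x⟩⟩
  have hw0 : ∀ x : Surface g, branchPoly g x.1.1 = 0 → x.1.2 = 0 := by
    intro x h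
    have := x.2.2.2
    rw [h] at this
    exact pow_eq_zero_iff two_ne_zero |>.1 this
  have hproj : Continuous fun p : unitInterval × Surface g => (p.1, p.2.1.1) := by fun_prop
  have hWc : Continuous fun p : unitInterval × Surface g => p.2.1.2 * S (p.1, p.2.1.1) := by
    refine continuous_iff_continuousAt.2 fun p => ?_
    by_cases hz : branchPoly g p.2.1.1 = 0
    -- `S` need not be continuous over a branch point, but `|w S|` is the square root of
    -- `|branchPoly (H t z)|`, which tends to `0` there.
    · have h1 : p.2.1.2 * S (p.1, p.2.1.1) = 0 := by rw [hw0 _ hz, zero_mul]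
      rw [ContinuousAt, h1, tendsto_zero_iff_norm_tendsto_zero]
      have h2 : Continuous fun p : unitInterval × Surface g =>
          √‖branchPoly g (H p.1 p.2.1.1)‖ := (hb.comp (hH.comp hproj)).norm.sqrt
      have h3 := h2.tendsto p
      rw [hfix _ _ hz, hz, norm_zero, Real.sqrt_zero] at h3
      refine h3.congr fun q => ?_
      rw [← hsq, norm_pow, Real.sqrt_sq (norm_nonneg _)]
    · have ho : IsOpen {p : unitInterval × ℂ | branchPoly g p.2 ≠ 0} :=
        isOpen_ne_fun (by fun_prop) continuous_const
      have h1 : ContinuousAt S (p.1, p.2.1.1) := hSc.continuousAt (ho.mem_nhds hz)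
      exact ContinuousAt.mul (by fun_prop)
        (ContinuousAt.comp (f := fun p : unitInterval × Surface g => (p.1, p.2.1.1)) h1
          hproj.continuousAt)
  have hGc : Continuous fun p : unitInterval × Surface g => G p.1 p.2 :=
    ((hH.comp hproj).prodMk hWc).subtype_mk _
  have hGi : ∀ t, Function.Injective (G t) := by
    intro t x y hxy
    have h1 : H t x.1.1 = H t y.1.1 := congrArg (fun x : Surface g => x.1.1) hxy
    have h2 : x.1.2 * S (t, x.1.1) = y.1.2 * S (t, y.1.1) :=
      congrArg (fun x : Surface g => x.1.2) hxy
    have h3 := (H t).injective h1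
    refine Subtype.ext (Prod.ext h3 ?_)
    by_cases hz : branchPoly g x.1.1 = 0
    · rw [hw0 x hz, hw0 y (h3 ▸ hz)]
    · rw [← h3] at h2
      exact mul_right_cancel₀ (hSne t _ hz) h2
  have hGs : ∀ t, Function.Surjective (G t) := by
    intro t y
    have hz0 : H t ((H t).symm y.1.1) = y.1.1 := Homeomorph.apply_symm_apply _ _
    have hBi : ∀ b ∈ branchSet g, (H t).symm b = b := by
      intro b hb
      rw [Homeomorph.symm_apply_eq, hB t b hb]
    have hnorm := norm_apply_of_fixed hBi y.2.1 y.2.2.1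
    by_cases hz : branchPoly g y.1.1 = 0
    · refine ⟨y, Subtype.ext (Prod.ext (hfix t _ hz) ?_)⟩
      show y.1.2 * _ = y.1.2
      rw [hw0 y hz, zero_mul]
    · have hz' : branchPoly g ((H t).symm y.1.1) ≠ 0 := by
        intro h
        have h1 := hfix t _ h
        rw [hz0] at h1
        exact hz (h1 ▸ h)
      have hS := hSne t _ hz'
      refine ⟨⟨((H t).symm y.1.1, y.1.2 / S (t, (H t).symm y.1.1)), hnorm.1, hnorm.2, ?_⟩,
        Subtype.ext (Prod.ext hz0 (div_mul_cancel₀ _ hS))⟩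
      show (y.1.2 / S (t, (H t).symm y.1.1)) ^ 2 = _
      rw [div_pow, hS2 t _ hz', y.2.2.2, hz0]
      field_simp
  have hGt : ∀ t, Continuous (G t) := fun t => hGc.comp (continuous_const.prodMk continuous_id)
  refine ⟨fun t => Continuous.homeoOfEquivCompactToT2 (f := Equiv.ofBijective (G t)
    ⟨hGi t, hGs t⟩) (hGt t), hGc, ?_, ?_, fun _ _ => rfl⟩
  · intro t x hx
    have hxB := mem_branchSet_of_boundary hx
    refine Subtype.ext (Prod.ext (hB t _ hxB) ?_)
    show x.1.2 * S (t, x.1.1) = x.1.2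
    rw [hSB t _ hxB, mul_one]
  · ext1 x
    refine Subtype.ext (Prod.ext ?_ ?_)
    · show H 0 x.1.1 = x.1.1
      rw [h0]
      rfl
    · show x.1.2 * S (0, x.1.1) = x.1.2
      rw [hS0, mul_one]

/-- A homeomorphism of the surface covering a homeomorphism of the plane that is isotopic to the
identity relative to the branch points is isotopic to the identity. -/
theorem isotopicToId_of_cover {g : ℕ} (k : homeoRel (Surface g) (surfaceBoundary g)) {f : ℂ ≃ₜ ℂ}
    (hf : f ∈ isoSub (branchSet g)) (hcov : ∀ x, ((k : Surface g ≃ₜ Surface g) x).1.1 = f x.1.1) :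
    k ∈ isotopicToId (Surface g) (surfaceBoundary g) := by
  obtain ⟨H, hH, hB, h0, rfl⟩ := mem_isoSub.1 hf
  obtain ⟨E, hE, hEB, hE0, hEH⟩ := exists_lift_isotopy hH hB h0
  have hk : (k : Surface g ≃ₜ Surface g) = E 1 := by
    -- Both maps cover `H 1` and fix the boundary, so their quotient is a deck transformation fixing
    -- the boundary.
    have h1 : (E 1)⁻¹ * (k : Surface g ≃ₜ Surface g) = 1 := by
      refine deck_eq_one ?_ ?_
      · intro x hx
        show (E 1).symm ((k : Surface g ≃ₜ Surface g) x) = x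
        rw [k.2 x hx, Homeomorph.symm_apply_eq, hEB 1 x hx]
      · intro x
        apply (H 1).injective
        rw [← hEH, ← hcov]
        show (E 1 ((E 1).symm _)).1.1 = _
        rw [Homeomorph.apply_symm_apply]
        rfl
    exact (inv_mul_eq_one.1 h1).symm
  refine ⟨fun t => ⟨E t, hEB t⟩, hE, Subtype.ext hE0, Subtype.ext hk.symm⟩

end Lift

/-! ## Rotations of the plane by an angle depending on the radius -/

section Rotation

/-- The homeomorphism `z ↦ z exp (i u(|z|))`. -/
noncomputable def rotBy (u : C(ℝ, ℝ)) : ℂ ≃ₜ ℂ where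
  toFun z := z * Complex.exp ((u ‖z‖ : ℝ) * Complex.I)
  invFun z := z * Complex.exp ((-u ‖z‖ : ℝ) * Complex.I)
  left_inv z := by
    simp only
    rw [norm_mul, Complex.norm_exp_ofReal_mul_I, mul_one, mul_assoc, ← Complex.exp_add]
    simp
  right_inv z := by
    simp only
    rw [norm_mul, Complex.norm_exp_ofReal_mul_I, mul_one, mul_assoc, ← Complex.exp_add]
    simp
  continuous_toFun := by fun_prop
  continuous_invFun := by fun_prop

theorem rotBy_apply (u : C(ℝ, ℝ)) (z : ℂ) :
    rotBy u z = z * Complex.exp ((u ‖z‖ : ℝ) * Complex.I) := rfl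

theorem norm_rotBy (u : C(ℝ, ℝ)) (z : ℂ) : ‖rotBy u z‖ = ‖z‖ := by
  rw [rotBy_apply, norm_mul, Complex.norm_exp_ofReal_mul_I, mul_one]

theorem rotBy_add (u v : C(ℝ, ℝ)) : rotBy (u + v) = rotBy u * rotBy v := by
  ext1 z
  show rotBy (u + v) z = rotBy u (rotBy v z)
  rw [rotBy_apply u, norm_rotBy, rotBy_apply, rotBy_apply, mul_assoc, ← Complex.exp_add]
  congr 2
  push_cast [ContinuousMap.add_apply]
  ring

theorem rotBy_zero : rotBy 0 = 1 := by
  ext1 z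
  show rotBy 0 z = z
  rw [rotBy_apply]
  simp

theorem rotBy_neg (u : C(ℝ, ℝ)) : rotBy (-u) = (rotBy u)⁻¹ := by
  rw [eq_inv_iff_mul_eq_one, ← rotBy_add, neg_add_cancel, rotBy_zero]

theorem rotBy_nsmul (m : ℕ) (u : C(ℝ, ℝ)) : rotBy (m • u) = rotBy u ^ m := by
  induction m with
  | zero => rw [zero_smul, rotBy_zero, pow_zero]
  | succ m ih => rw [succ_nsmul, rotBy_add, ih, pow_succ]

theorem rotBy_eq_self {u : C(ℝ, ℝ)} {z : ℂ} (m : ℤ) (h : u ‖z‖ = 2 * Real.pi * m) :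
    rotBy u z = z := by
  rw [rotBy_apply, h]
  have : Complex.exp ((2 * Real.pi * m : ℝ) * Complex.I) = 1 := by
    rw [Complex.exp_eq_one_iff]
    exact ⟨m, by push_cast; ring⟩
  rw [this, mul_one]

theorem continuous_rotBy_smul {T : Type*} [TopologicalSpace T] {c : T → ℝ} (hc : Continuous c)
    (u : C(ℝ, ℝ)) : Continuous fun p : T × ℂ => rotBy (c p.1 • u) p.2 := by
  simp only [rotBy_apply, ContinuousMap.smul_apply]
  fun_prop

/-- The height `log (x / r) / log (s / r)`, extended by `0` to `x ≤ r` and by `1` to `x ≥ s`. -/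
noncomputable def clampHeight (r s : ℝ) (hr : 0 < r) : C(ℝ, ℝ) where
  toFun x := Real.log (max r (min s x) / r) / Real.log (s / r)
  continuous_toFun := by
    refine Continuous.div_const (Continuous.log (by fun_prop) fun x => ?_) _
    exact (div_pos (lt_of_lt_of_le hr (le_max_left _ _)) hr).ne'

theorem clampHeight_apply {r s : ℝ} (hr : 0 < r) (x : ℝ) :
    clampHeight r s hr x = Real.log (max r (min s x) / r) / Real.log (s / r) := rfl

theorem clampHeight_of_le {r s : ℝ} (hr : 0 < r) {x : ℝ} (hx : x ≤ r) :
    clampHeight r s hr x = 0 := by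
  rw [clampHeight_apply, max_eq_left ((min_le_right _ _).trans hx), div_self hr.ne', Real.log_one,
    zero_div]

theorem clampHeight_of_ge {r s : ℝ} (hr : 0 < r) (hrs : r < s) {x : ℝ} (hx : s ≤ x) :
    clampHeight r s hr x = 1 := by
  rw [clampHeight_apply, min_eq_left hx, max_eq_right hrs.le,
    div_self (Real.log_pos ((one_lt_div hr).2 hrs)).ne']

/-- The Dehn twist of the plane along the annulus `r ≤ |z| ≤ s`. -/
noncomputable def planeTwist (r s : ℝ) (hr : 0 < r) : ℂ ≃ₜ ℂ :=
  rotBy ((2 * Real.pi) • clampHeight r s hr)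

theorem planeTwist_of_mem {r s : ℝ} (hr : 0 < r) {z : ℂ} (hz : z ∈ annulus r s) :
    planeTwist r s hr z = annulusTwist r s 1 z := by
  rw [planeTwist, rotBy_apply, annulusTwist, ContinuousMap.smul_apply, clampHeight_apply,
    min_eq_right hz.2, max_eq_right hz.1, height]
  simp

theorem planeTwist_of_not_mem {r s : ℝ} (hr : 0 < r) (hrs : r < s) {z : ℂ}
    (hz : z ∉ openAnnulus r s) : planeTwist r s hr z = z := by
  have : ‖z‖ ≤ r ∨ s ≤ ‖z‖ := by
    by_contra h
    push Not at h
    exact hz h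
  rcases this with h | h
  · exact rotBy_eq_self 0 (by simp [clampHeight_of_le hr h])
  · exact rotBy_eq_self 1 (by simp [clampHeight_of_ge hr hrs h])

/-- The annulus `1/2 ≤ |ζ| ≤ 2` is symmetric under inversion, which reflects the logarithmic height.
Therefore the twist commutes with inversion, the two angles differing by a full turn, and descends
through `foldC`. -/
theorem clampHeight_inv {x : ℝ} (hx : 0 < x) :
    clampHeight (1 / 2) 2 (by norm_num) x⁻¹ = 1 - clampHeight (1 / 2) 2 (by norm_num) x := by
  have h1 : max (1 / 2) (min 2 x⁻¹) = (max (1 / 2) (min 2 x))⁻¹ := by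
    rcases le_total x (1 / 2) with h | h
    · rw [min_eq_right (h.trans (by norm_num)), max_eq_left h, min_eq_left, max_eq_right] <;>
        norm_num
      rw [le_inv_comm₀ (by norm_num) hx]
      linarith
    · rcases le_total x 2 with h' | h'
      · rw [min_eq_right h', max_eq_right h, min_eq_right, max_eq_right]
        · rw [one_div]
          exact (inv_le_inv₀ (by norm_num) hx).2 h'
        · rw [inv_le_comm₀ hx (by norm_num)]
          linarith
      · rw [min_eq_left h', min_eq_right, max_eq_left, max_eq_right] <;> norm_num
        · rw [inv_le_comm₀ hx (by norm_num)]
          linarith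
        · rw [inv_le_comm₀ hx (by norm_num)]
          linarith
  have hpos : 0 < max (1 / 2) (min 2 x) := lt_of_lt_of_le (by norm_num) (le_max_left _ _)
  have hlog : Real.log 2 ≠ 0 := (Real.log_pos (by norm_num)).ne'
  have h4 : Real.log (2 / (1 / 2)) = 2 * Real.log 2 := by
    rw [← Real.log_rpow (by norm_num)]
    norm_num
  have h5 : ∀ y, 0 < y → Real.log (y / (1 / 2)) = Real.log y + Real.log 2 := by
    intro y hy
    rw [div_div_eq_mul_div, div_one, Real.log_mul hy.ne' (by norm_num)]
  rw [clampHeight_apply, clampHeight_apply, h1, h4, h5 _ (inv_pos.2 hpos), h5 _ hpos,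
    Real.log_inv]
  field_simp
  ring

theorem clampHeight_one : clampHeight (1 / 2) 2 (by norm_num) 1 = 1 / 2 := by
  have := clampHeight_inv one_pos
  rw [inv_one] at this
  linarith

theorem clampHeight_mono {r s : ℝ} (hr : 0 < r) (hrs : r < s) : Monotone (clampHeight r s hr) := by
  intro x y hxy
  have hlog : 0 < Real.log (s / r) := Real.log_pos ((one_lt_div hr).2 hrs)
  have h1 : 0 < max r (min s x) := lt_of_lt_of_le hr (le_max_left _ _)
  rw [clampHeight_apply, clampHeight_apply]
  gcongr

theorem clampHeight_le_one {r s : ℝ} (hr : 0 < r) (hrs : r < s) (x : ℝ) :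
    clampHeight r s hr x ≤ 1 := by
  rw [← clampHeight_of_ge hr hrs (le_max_right x s)]
  exact clampHeight_mono hr hrs (le_max_left _ _)

end Rotation

/-! ## Half twists -/

section HalfTwist

/-- The twist of the plane used to define half twists. -/
noncomputable def coreTwist : ℂ ≃ₜ ℂ := planeTwist (1 / 2) 2 (by norm_num)

theorem coreTwist_inv (ζ : ℂ) : coreTwist ζ⁻¹ = (coreTwist ζ)⁻¹ := by
  rcases eq_or_ne ζ 0 with rfl | h
  · simp [coreTwist, planeTwist, rotBy_apply]
  · rw [coreTwist, planeTwist, rotBy_apply, rotBy_apply, ContinuousMap.smul_apply,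
      ContinuousMap.smul_apply, norm_inv, clampHeight_inv (norm_pos_iff.2 h), mul_inv,
      ← Complex.exp_neg]
    congr 1
    rw [Complex.exp_eq_exp_iff_exists_int]
    refine ⟨1, ?_⟩
    simp only [smul_eq_mul]
    push_cast
    ring

theorem foldC_eq_iff {k : ℕ} {ζ ξ : ℂ} (hζ : ζ ≠ 0) (hξ : ξ ≠ 0) :
    foldC k ζ = foldC k ξ ↔ ζ = ξ ∨ ζ = ξ⁻¹ := by
  constructor
  · intro h
    have h1 : ζ + ζ⁻¹ = ξ + ξ⁻¹ := by
      unfold foldC at h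
      linear_combination 4 * h
    have h2 : (ζ - ξ) * (ζ - ξ⁻¹) = 0 := by
      have h3 : ζ * ζ⁻¹ = 1 := mul_inv_cancel₀ hζ
      have h4 : ξ * ξ⁻¹ = 1 := mul_inv_cancel₀ hξ
      linear_combination ζ * h1 + h4 - h3
    rcases mul_eq_zero.1 h2 with h | h
    · exact Or.inl (sub_eq_zero.1 h)
    · exact Or.inr (sub_eq_zero.1 h)
  · rintro (rfl | rfl)
    · rfl
    · unfold foldC
      rw [inv_inv, add_comm ξ]

/-- The open mapping theorem for the nonconstant holomorphic map `foldC k` on the connected set `ℂ \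
{0}`. It makes `foldC k` a quotient map, so that maps induced on its image are continuous. -/
theorem isOpen_foldC_image (k : ℕ) {U : Set ℂ} (hU : IsOpen U) (h0 : U ⊆ {0}ᶜ) :
    IsOpen (foldC k '' U) := by
  have hd : DifferentiableOn ℂ (foldC k) {0}ᶜ := by
    unfold foldC
    exact (differentiableOn_const _).add ((differentiableOn_id.add
      (differentiableOn_inv.mono fun z hz => hz)).div_const _)
  have hpre : IsPreconnected ({0}ᶜ : Set ℂ) :=
    (isConnected_compl_singleton_of_one_lt_rank (by simp [Complex.rank_real_complex]) 0).2
  rcases (hd.analyticOnNhd isOpen_compl_singleton).is_constant_or_isOpen hpre with ⟨w, hw⟩ | h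
  · exfalso
    have h1 := hw 1 (by simp)
    have h2 := hw (-1) (by simp)
    rw [← h2] at h1
    unfold foldC at h1
    norm_num at h1
    exact one_ne_zero (α := ℂ) (by linear_combination h1)
  · exact h U h0 hU

/-- The map of the plane covered by `T` under `foldC k`. -/
noncomputable def foldMap (k : ℕ) (T : ℂ → ℂ) (z : ℂ) : ℂ :=
  foldC k (T (exists_foldC_eq k z).choose)

/-- The fibres of `foldC k` are the pairs `{ζ, ζ⁻¹}`, so the chosen preimage in `foldMap` is
immaterial. -/
theorem foldMap_foldC {k : ℕ} {T : ℂ → ℂ} (hinv : ∀ ζ, T ζ⁻¹ = (T ζ)⁻¹) {ζ : ℂ} (hζ : ζ ≠ 0) :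
    foldMap k T (foldC k ζ) = foldC k (T ζ) := by
  obtain ⟨h1, h2⟩ := (exists_foldC_eq k (foldC k ζ)).choose_spec
  unfold foldMap
  generalize (exists_foldC_eq k (foldC k ζ)).choose = ξ at h1 h2
  rcases (foldC_eq_iff h1 hζ).1 h2 with rfl | rfl
  · rfl
  · rw [hinv]
    unfold foldC
    rw [inv_inv, add_comm (T ζ)]

theorem continuous_foldMap {k : ℕ} {T : ℂ → ℂ} (hT : Continuous T) (h0 : ∀ ζ, ζ ≠ 0 → T ζ ≠ 0)
    (hinv : ∀ ζ, T ζ⁻¹ = (T ζ)⁻¹) : Continuous (foldMap k T) := by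
  refine continuous_def.2 fun V hV => ?_
  have hc : ContinuousOn (fun ζ => foldC k (T ζ)) {0}ᶜ := by
    unfold foldC
    have h1 : ContinuousOn (fun ζ => (T ζ)⁻¹) {0}ᶜ := hT.continuousOn.inv₀ fun ζ hζ => h0 ζ hζ
    fun_prop
  have h2 := isOpen_foldC_image k (hc.isOpen_inter_preimage isOpen_compl_singleton hV)
    Set.inter_subset_left
  convert h2 using 1
  ext z
  constructor
  · intro hz
    obtain ⟨ζ, hζ, rfl⟩ := exists_foldC_eq k z
    rw [Set.mem_preimage, foldMap_foldC hinv hζ] at hz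
    exact ⟨ζ, ⟨hζ, hz⟩, rfl⟩
  · rintro ⟨ζ, ⟨hζ, hz⟩, rfl⟩
    rw [Set.mem_preimage, foldMap_foldC hinv hζ]
    exact hz

theorem coreTwist_ne_zero {ζ : ℂ} (h : ζ ≠ 0) : coreTwist ζ ≠ 0 := by
  rw [← norm_pos_iff, coreTwist, planeTwist, norm_rotBy]
  exact norm_pos_iff.2 h

theorem coreTwist_symm_ne_zero {ζ : ℂ} (h : ζ ≠ 0) : coreTwist.symm ζ ≠ 0 := by
  intro h1
  rw [Homeomorph.symm_apply_eq] at h1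
  refine h (h1.trans ?_)
  simp [coreTwist, planeTwist, rotBy_apply]

theorem coreTwist_symm_inv (ζ : ℂ) : coreTwist.symm ζ⁻¹ = (coreTwist.symm ζ)⁻¹ := by
  rw [Homeomorph.symm_apply_eq, coreTwist_inv, Homeomorph.apply_symm_apply]

/-- The half twist of the plane exchanging `k` and `k + 1`. -/
noncomputable def halfTwist (k : ℕ) : ℂ ≃ₜ ℂ where
  toFun := foldMap k coreTwist
  invFun := foldMap k coreTwist.symm
  left_inv z := by
    obtain ⟨ζ, hζ, rfl⟩ := exists_foldC_eq k z
    rw [foldMap_foldC coreTwist_inv hζ,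
      foldMap_foldC coreTwist_symm_inv (coreTwist_ne_zero hζ), Homeomorph.symm_apply_apply]
  right_inv z := by
    obtain ⟨ζ, hζ, rfl⟩ := exists_foldC_eq k z
    rw [foldMap_foldC coreTwist_symm_inv hζ,
      foldMap_foldC coreTwist_inv (coreTwist_symm_ne_zero hζ), Homeomorph.apply_symm_apply]
  continuous_toFun := continuous_foldMap coreTwist.continuous (fun _ => coreTwist_ne_zero)
    coreTwist_inv
  continuous_invFun := continuous_foldMap coreTwist.symm.continuous
    (fun _ => coreTwist_symm_ne_zero) coreTwist_symm_inv

theorem halfTwist_foldC {k : ℕ} {ζ : ℂ} (hζ : ζ ≠ 0) :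
    halfTwist k (foldC k ζ) = foldC k (coreTwist ζ) := foldMap_foldC coreTwist_inv hζ

/-- The centre `k + 1 / 2` of a half twist. -/
noncomputable def center (k : ℕ) : ℂ := (k : ℂ) + 1 / 2

/-- The support is the ellipse that `foldC k` makes of the annulus; its semi-major axis is `(2 +
1/2) / 4 = 5/8`. -/
theorem halfTwist_of_far {k : ℕ} {z : ℂ} (hz : 5 / 8 < ‖z - center k‖) : halfTwist k z = z := by
  obtain ⟨ζ, hζ, rfl⟩ := exists_foldC_eq k z
  rw [halfTwist_foldC hζ, coreTwist, planeTwist_of_not_mem _ (by norm_num)]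
  intro h
  have h1 := foldC_norm (k := k) (ζ := ζ) ⟨h.1.le, h.2.le⟩
  rw [foldC, center, add_sub_cancel_left] at hz
  linarith

/-- A homeomorphism supported in the disc of radius `5 / 8` about `c`, scaled towards `c`. -/
noncomputable def alexander (H : ℂ ≃ₜ ℂ) (c : ℂ) (t : unitInterval) : ℂ ≃ₜ ℂ :=
  if h : (t : ℝ) = 0 then 1 else
    let e : ℂ ≃ₜ ℂ := (Homeomorph.subRight c).trans
      ((Homeomorph.smulOfNeZero ((t : ℝ)⁻¹) (inv_ne_zero h)).trans (Homeomorph.addRight c))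
    e⁻¹ * H * e

theorem alexander_apply (H : ℂ ≃ₜ ℂ) (c : ℂ) {t : unitInterval} (ht : (t : ℝ) ≠ 0) (z : ℂ) :
    alexander H c t z = c + (t : ℝ) * (H (((t : ℝ) : ℂ)⁻¹ * (z - c) + c) - c) := by
  rw [alexander, dif_neg ht]
  show ((t : ℝ)⁻¹)⁻¹ • (H ((t : ℝ)⁻¹ • (z - c) + c) - c) + c = _
  simp [add_comm]

theorem alexander_zero (H : ℂ ≃ₜ ℂ) (c : ℂ) : alexander H c 0 = 1 := by simp [alexander]

theorem alexander_one (H : ℂ ≃ₜ ℂ) (c : ℂ) : alexander H c 1 = H := by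
  ext1 z
  rw [alexander_apply _ _ (by simp)]
  simp

theorem alexander_of_far {H : ℂ ≃ₜ ℂ} {c : ℂ} (hH : ∀ z, 5 / 8 < ‖z - c‖ → H z = z)
    (t : unitInterval) {z : ℂ} (hz : 5 / 8 < ‖z - c‖) : alexander H c t z = z := by
  by_cases ht : (t : ℝ) = 0
  · rw [alexander, dif_pos ht]
    rfl
  · have htp : 0 < (t : ℝ) := lt_of_le_of_ne t.2.1 (Ne.symm ht)
    rw [alexander_apply _ _ ht, hH]
    · have : ((t : ℝ) : ℂ) ≠ 0 := by exact_mod_cast ht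
      field_simp
      ring
    · rw [add_sub_cancel_right, norm_mul, norm_inv, Complex.norm_real, Real.norm_eq_abs,
        abs_of_pos htp]
      have h1 : 1 ≤ (t : ℝ)⁻¹ := (one_le_inv₀ htp).2 t.2.2
      nlinarith

theorem norm_sub_le_of_near {H : ℂ ≃ₜ ℂ} {c : ℂ} (hH : ∀ z, 5 / 8 < ‖z - c‖ → H z = z) {z : ℂ}
    (hz : ‖z - c‖ ≤ 5 / 8) : ‖H z - c‖ ≤ 5 / 8 := by
  by_contra h
  push Not at h
  have h1 := H.injective (hH _ h)
  rw [h1] at h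
  linarith

/-- This is the Alexander trick. Only time `0` needs an argument: `H` displaces points by at most
the diameter `5/4`, so its copy scaled by `t` displaces them by at most `5t/4`. -/
theorem continuous_alexander {H : ℂ ≃ₜ ℂ} {c : ℂ} (hH : ∀ z, 5 / 8 < ‖z - c‖ → H z = z) :
    Continuous fun p : unitInterval × ℂ => alexander H c p.1 p.2 := by
  have hbd : ∀ z, ‖H z - z‖ ≤ 5 / 4 := by
    intro z
    rcases lt_or_ge (5 / 8) ‖z - c‖ with h | h
    · rw [hH z h, sub_self, norm_zero]
      norm_num
    · have h1 := norm_sub_le_of_near hH h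
      have h2 : H z - z = (H z - c) - (z - c) := by ring
      rw [h2]
      refine (norm_sub_le _ _).trans ?_
      linarith
  have hclose : ∀ p : unitInterval × ℂ, ‖alexander H c p.1 p.2 - p.2‖ ≤ 5 / 4 * p.1 := by
    rintro ⟨t, z⟩
    by_cases ht : (t : ℝ) = 0
    · have : t = 0 := Subtype.ext ht
      subst this
      rw [alexander_zero]
      simp
    · have htp : 0 < (t : ℝ) := lt_of_le_of_ne t.2.1 (Ne.symm ht)
      have htc : ((t : ℝ) : ℂ) ≠ 0 := by exact_mod_cast ht
      simp only
      rw [alexander_apply _ _ ht]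
      have h1 : c + (t : ℝ) * (H (((t : ℝ) : ℂ)⁻¹ * (z - c) + c) - c) - z =
          (t : ℝ) * (H (((t : ℝ) : ℂ)⁻¹ * (z - c) + c) - (((t : ℝ) : ℂ)⁻¹ * (z - c) + c)) := by
        field_simp
        ring
      rw [h1, norm_mul, Complex.norm_real, Real.norm_eq_abs, abs_of_pos htp, mul_comm]
      exact mul_le_mul_of_nonneg_right (hbd _) htp.le
  refine continuous_iff_continuousAt.2 ?_
  rintro ⟨t, z⟩
  by_cases ht : (t : ℝ) = 0
  · have : t = 0 := Subtype.ext ht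
    subst this
    rw [ContinuousAt, alexander_zero]
    have h1 : Filter.Tendsto (fun p : unitInterval × ℂ => alexander H c p.1 p.2 - p.2)
        (nhds (0, z)) (nhds 0) := by
      refine squeeze_zero_norm hclose ?_
      have h2 : Continuous fun p : unitInterval × ℂ => 5 / 4 * (p.1 : ℝ) := by fun_prop
      simpa using h2.tendsto (0, z)
    have h3 := h1.add (continuous_snd.tendsto ((0 : unitInterval), z))
    simpa using h3
  · have h1 : ∀ᶠ p : unitInterval × ℂ in nhds (t, z), (p.1 : ℝ) ≠ 0 := by
      have h2 : IsOpen {p : unitInterval × ℂ | (p.1 : ℝ) ≠ 0} :=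
        isOpen_ne_fun (by fun_prop) continuous_const
      exact h2.mem_nhds ht
    refine ContinuousAt.congr_of_eventuallyEq (f := fun p : unitInterval × ℂ =>
      c + (p.1 : ℝ) * (H (((p.1 : ℝ) : ℂ)⁻¹ * (p.2 - c) + c) - c)) ?_ ?_
    · have h3 : ContinuousAt (fun p : unitInterval × ℂ => (((p.1 : ℝ) : ℂ)⁻¹)) (t, z) := by
        refine ContinuousAt.inv₀ (by fun_prop) ?_
        exact_mod_cast ht
      have h4 : ContinuousAt (fun p : unitInterval × ℂ =>
          H (((p.1 : ℝ) : ℂ)⁻¹ * (p.2 - c) + c)) (t, z) :=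
        ContinuousAt.comp (f := fun p : unitInterval × ℂ => ((p.1 : ℝ) : ℂ)⁻¹ * (p.2 - c) + c)
          H.continuous.continuousAt (by fun_prop)
      fun_prop
    · filter_upwards [h1] with p hp
      exact alexander_apply _ _ hp _

/-- The standard isotopy from the identity to the half twist exchanging `k` and `k + 1`. -/
noncomputable def halfTwistIsotopy (k : ℕ) (t : unitInterval) : ℂ ≃ₜ ℂ :=
  alexander (halfTwist k) (center k) t

theorem halfTwistIsotopy_zero (k : ℕ) : halfTwistIsotopy k 0 = 1 := alexander_zero _ _

theorem halfTwistIsotopy_one (k : ℕ) : halfTwistIsotopy k 1 = halfTwist k := alexander_one _ _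

theorem continuous_halfTwistIsotopy (k : ℕ) :
    Continuous fun p : unitInterval × ℂ => halfTwistIsotopy k p.1 p.2 :=
  continuous_alexander fun _ => halfTwist_of_far

theorem halfTwistIsotopy_of_far {k : ℕ} (t : unitInterval) {z : ℂ}
    (hz : 5 / 8 < ‖z - center k‖) : halfTwistIsotopy k t z = z :=
  alexander_of_far (fun _ => halfTwist_of_far) t hz

theorem halfTwistIsotopy_near {k : ℕ} (t : unitInterval) {z : ℂ}
    (hz : ‖z - center k‖ ≤ 5 / 8) : ‖halfTwistIsotopy k t z - center k‖ ≤ 5 / 8 :=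
  norm_sub_le_of_near (fun _ => halfTwistIsotopy_of_far t) hz

/-- On `|ζ| = x ≥ 1` the twist turns by an angle `φ` between `π` and `2π`, where `sin φ ≤ 0`. The
imaginary part of the image of `±x` is `±(x - x⁻¹) sin φ / 4`. -/
theorem im_halfTwist_foldC (k : ℕ) {x : ℝ} (hx : 1 ≤ x) :
    (halfTwist k (foldC k x)).im ≤ 0 ∧ 0 ≤ (halfTwist k (foldC k (-x))).im := by
  have hx0 : (x : ℂ) ≠ 0 := by
    have : x ≠ 0 := by linarith
    exact_mod_cast this
  rw [halfTwist_foldC hx0, halfTwist_foldC (neg_ne_zero.2 hx0)]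
  obtain ⟨φ, h1, h2, hφ⟩ : ∃ φ : ℝ, Real.pi ≤ φ ∧ φ ≤ 2 * Real.pi ∧ ∀ ζ : ℂ, ‖ζ‖ = x →
      coreTwist ζ = ζ * Complex.exp (φ * Complex.I) := by
    refine ⟨2 * Real.pi * clampHeight (1 / 2) 2 (by norm_num) x, ?_, ?_, ?_⟩
    · have := clampHeight_mono (r := 1 / 2) (s := 2) (by norm_num) (by norm_num) hx
      rw [clampHeight_one] at this
      nlinarith [Real.pi_pos]
    · have := clampHeight_le_one (r := 1 / 2) (s := 2) (by norm_num) (by norm_num) x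
      nlinarith [Real.pi_pos]
    · rintro ζ rfl
      rfl
  have hsin : Real.sin φ ≤ 0 := by
    have := Real.sin_nonneg_of_nonneg_of_le_pi (x := φ - Real.pi) (by linarith) (by linarith)
    rw [Real.sin_sub_pi] at this
    linarith
  have hn : ‖(x : ℂ)‖ = x := by
    rw [Complex.norm_real, Real.norm_eq_abs, abs_of_nonneg (by linarith)]
  have him : ∀ y : ℝ, (foldC k (y * Complex.exp (φ * Complex.I))).im =
      (y - y⁻¹) * Real.sin φ / 4 := by
    intro y
    have h3 : (y * Complex.exp (φ * Complex.I) : ℂ)⁻¹ =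
        ((y⁻¹ : ℝ) : ℂ) * Complex.exp ((-φ : ℝ) * Complex.I) := by
      rw [mul_inv, ← Complex.exp_neg]
      push_cast
      ring_nf
    have h4 : foldC k (y * Complex.exp (φ * Complex.I)) = ((k + 1 / 2 : ℝ) : ℂ) +
        ((1 / 4 : ℝ) : ℂ) * (y * Complex.exp (φ * Complex.I) +
          ((y⁻¹ : ℝ) : ℂ) * Complex.exp ((-φ : ℝ) * Complex.I)) := by
      rw [foldC, h3]
      push_cast
      ring
    rw [h4, Complex.add_im, Complex.ofReal_im, Complex.im_ofReal_mul, Complex.add_im,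
      Complex.im_ofReal_mul, Complex.im_ofReal_mul, Complex.exp_ofReal_mul_I_im,
      Complex.exp_ofReal_mul_I_im, Real.sin_neg]
    ring
  have hinv : x⁻¹ ≤ x := (inv_le_one_of_one_le₀ hx).trans hx
  constructor
  · rw [hφ _ hn, him]
    nlinarith
  · rw [hφ _ (by rw [norm_neg, hn])]
    have := him (-x)
    push_cast at this
    rw [this, inv_neg]
    nlinarith

/-- The witness `2y + √(4y² - 1)` is the larger root of `x + x⁻¹ = 4y`. -/
theorem exists_real_foldC (k : ℕ) {y : ℝ} (hy : 1 / 2 ≤ y) : ∃ x : ℝ, 1 ≤ x ∧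
    foldC k x = y + center k ∧ foldC k (-x) = -y + center k := by
  have h0 : 0 ≤ 4 * y ^ 2 - 1 := by nlinarith
  have h1 := Real.sq_sqrt h0
  have h2 := Real.sqrt_nonneg (4 * y ^ 2 - 1)
  set d := √(4 * y ^ 2 - 1)
  have hx : 1 ≤ 2 * y + d := by linarith
  have hinv : (2 * y + d)⁻¹ = 2 * y - d := by
    apply inv_eq_of_mul_eq_one_right
    linear_combination -h1
  have hinv' : ((2 * y + d : ℝ) : ℂ)⁻¹ = ((2 * y - d : ℝ) : ℂ) := by
    rw [← Complex.ofReal_inv, hinv]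
  refine ⟨2 * y + d, hx, ?_, ?_⟩
  · rw [foldC, hinv', center]
    push_cast
    ring
  · rw [foldC, inv_neg, hinv', center]
    push_cast
    ring

/-- The exchange is clockwise. At time `t > 0` the rescaling places `k` and `k + 1` at distance `1 /
(2t) ≥ 1/2` from the centre on the real axis, where `im_halfTwist_foldC` controls the half twist. -/
theorem im_halfTwistIsotopy (k : ℕ) (t : unitInterval) :
    (halfTwistIsotopy k t ((k : ℂ) + 1)).im ≤ 0 ∧ 0 ≤ (halfTwistIsotopy k t k).im := by
  by_cases ht : (t : ℝ) = 0
  · have : t = 0 := Subtype.ext ht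
    subst this
    rw [halfTwistIsotopy_zero]
    simp
  · have htp : 0 < (t : ℝ) := lt_of_le_of_ne t.2.1 (Ne.symm ht)
    have htc : ((t : ℝ) : ℂ) ≠ 0 := by exact_mod_cast ht
    obtain ⟨x, hx, h1, h2⟩ := exists_real_foldC k (y := (2 * (t : ℝ))⁻¹) (by
      rw [one_div]
      exact (inv_le_inv₀ (by norm_num) (by linarith)).2 (by linarith [t.2.2]))
    have h3 := im_halfTwist_foldC k hx
    rw [h1, h2] at h3
    have hc : (center k).im = 0 := by simp [center]
    rw [halfTwistIsotopy, alexander_apply _ _ ht, alexander_apply _ _ ht]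
    have e1 : ((t : ℝ) : ℂ)⁻¹ * ((k : ℂ) + 1 - center k) = (((2 * (t : ℝ))⁻¹ : ℝ) : ℂ) := by
      rw [center]
      push_cast
      field_simp
      ring
    have e2 : ((t : ℝ) : ℂ)⁻¹ * ((k : ℂ) - center k) = -(((2 * (t : ℝ))⁻¹ : ℝ) : ℂ) := by
      rw [center]
      push_cast
      field_simp
      ring
    rw [e1, e2]
    simp only [Complex.add_im, hc, Complex.im_ofReal_mul, Complex.sub_im, sub_zero, zero_add]
    exact ⟨mul_nonpos_of_nonneg_of_nonpos htp.le h3.1, mul_nonneg htp.le h3.2⟩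

theorem halfTwist_swap (k : ℕ) : halfTwist k k = (k : ℂ) + 1 ∧ halfTwist k ((k : ℂ) + 1) = k := by
  have h1 : ∀ ζ : ℂ, ‖ζ‖ = 1 → coreTwist ζ = -ζ := by
    intro ζ hζ
    rw [coreTwist, planeTwist, rotBy_apply, hζ, ContinuousMap.smul_apply, clampHeight_one]
    have : ((2 * Real.pi) • (1 / 2 : ℝ)) = Real.pi := by
      rw [smul_eq_mul]
      ring
    rw [this, Complex.exp_pi_mul_I]
    ring
  have e1 : foldC k 1 = (k : ℂ) + 1 := by
    rw [foldC, inv_one]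
    ring
  have e2 : foldC k (-1) = (k : ℂ) := by
    rw [foldC, inv_neg, inv_one]
    ring
  constructor
  · rw [← e2, halfTwist_foldC (by norm_num), h1 _ (by simp), neg_neg, e1, e2]
  · rw [← e1, halfTwist_foldC (by norm_num), h1 _ (by simp), e2]

end HalfTwist

/-! ### Conjugacy of end homeomorphisms from a free homotopy of motions -/

section Motion

/-- Two isotopies of the plane whose motions of finitely many points are freely homotopic through
motions with the same end permutation have conjugate ends, up to isotopy. -/
theorem exists_conj_of_motion {n : ℕ} {U B₀ : Set ℂ} (hU : IsOpen U) {r : ℝ}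
    (hUr : ∀ x ∈ U, ‖x‖ < r) (hUB : ∀ b ∈ B₀, b ∉ U)
    {p : unitInterval × unitInterval → Fin n → ℂ} (hp : Continuous p)
    (hinj : ∀ q, Function.Injective (p q)) (hmem : ∀ q j, p q j ∈ U)
    {e : Fin n → Fin n} (he : ∀ s j, p (s, 1) j = p (s, 0) (e j))
    {F R : unitInterval → ℂ ≃ₜ ℂ} (hF : Continuous fun q : unitInterval × ℂ => F q.1 q.2)
    (hR : Continuous fun q : unitInterval × ℂ => (R q.1).symm q.2) (hF0 : F 0 = 1) (hR0 : R 0 = 1)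
    (hFB : ∀ t, ∀ b ∈ B₀, F t b = b) (hRB : ∀ t, ∀ b ∈ B₀, R t b = b)
    (hFp : ∀ t j, F t (p (0, 0) j) = p (0, t) j) (hRp : ∀ t j, R t (p (1, 0) j) = p (1, t) j) :
    ∃ L : ℂ ≃ₜ ℂ, (∀ x ∉ U, L x = x) ∧
      (F 1)⁻¹ * (L⁻¹ * R 1 * L) ∈ isoSub (B₀ ∪ Set.range (p (0, 0))) := by
  obtain ⟨Φ, hΦ, hΦ0, hΦp, hΦU⟩ := exists_ambient hU hp hinj hmem
  have hsymm : Continuous fun q : unitInterval × ℂ => (Φ (q.1, 0)).symm q.2 := by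
    refine continuous_symm_family (fun s => Φ (s, 0)) ?_ r fun s x hx => hΦU _ x fun h => ?_
    · exact hΦ.comp ((continuous_fst.prodMk continuous_const).prodMk continuous_snd)
    · exact absurd (hUr x h) (not_lt.2 hx)
  have hΦs : ∀ s b, b ∈ B₀ → (Φ (s, 0)).symm b = b := by
    intro s b hb
    rw [Homeomorph.symm_apply_eq, hΦU _ b (hUB b hb)]
  have hRs : ∀ t b, b ∈ B₀ → (R t).symm b = b := by
    intro t b hb
    rw [Homeomorph.symm_apply_eq, hRB t b hb]
  -- The path `s ↦ Φ(s,0)⁻¹ Φ(s,1) F₁` always sends the `j`-th starting point to the `e j`-th one,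
  -- since the permutation `e` does not depend on `s`.
  have h1 : (F 1)⁻¹ * ((Φ (1, 0))⁻¹ * Φ (1, 1) * F 1) ∈
      isoSub (B₀ ∪ Set.range (p (0, 0))) := by
    have key := inv_mul_mem_isoSub (B := B₀ ∪ Set.range (p (0, 0)))
      (fun s => (Φ (s, 0))⁻¹ * Φ (s, 1) * F 1) ?_ ?_
    · simpa only [hΦ0, inv_one, one_mul] using key
    · refine hsymm.comp (continuous_fst.prodMk (hΦ.comp
        ((continuous_fst.prodMk continuous_const).prodMk ((F 1).continuous.comp continuous_snd))))
    · have hval : ∀ s j, ((Φ (s, 0))⁻¹ * Φ (s, 1) * F 1) (p (0, 0) j) = p (0, 0) (e j) := by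
        intro s j
        show (Φ (s, 0)).symm (Φ (s, 1) (F 1 (p (0, 0) j))) = _
        rw [hFp, hΦp, he, Homeomorph.symm_apply_eq, hΦp]
      rintro s b (hb | ⟨j, rfl⟩)
      · show (Φ (s, 0)).symm (Φ (s, 1) (F 1 b)) = (Φ (0, 0)).symm (Φ (0, 1) (F 1 b))
        rw [hFB 1 b hb, hΦU _ b (hUB b hb), hΦU _ b (hUB b hb), hΦs s b hb, hΦs 0 b hb]
      · rw [hval, hval]
  -- Along the edge `s = 1`, both `R t` and `Φ(1,t) F t` follow the points `p(1,t)`. Their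
  -- discrepancy `(R t)⁻¹ Φ(1,t) F t` is therefore constant on the marked points.
  have h2 : ((Φ (1, 0))⁻¹ * R 1 * Φ (1, 0))⁻¹ * ((Φ (1, 0))⁻¹ * Φ (1, 1) * F 1) ∈
      isoSub (B₀ ∪ Set.range (p (0, 0))) := by
    have key := inv_mul_mem_isoSub (B := B₀ ∪ Set.range (p (0, 0)))
      (fun t => (Φ (1, 0))⁻¹ * R 1 * ((R t)⁻¹ * (Φ (1, t) * F t))) ?_ ?_
    · simpa only [hF0, hR0, inv_one, one_mul, mul_one, mul_assoc, mul_inv_cancel_left] using key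
    · refine ((Φ (1, 0)).symm.continuous.comp (R 1).continuous).comp
        (hR.comp (continuous_fst.prodMk (hΦ.comp
          ((continuous_const.prodMk continuous_fst).prodMk hF))))
    · have hval : ∀ t j, ((R t)⁻¹ * (Φ (1, t) * F t)) (p (0, 0) j) = p (1, 0) j := by
        intro t j
        show (R t).symm (Φ (1, t) (F t (p (0, 0) j))) = _
        rw [hFp, hΦp, Homeomorph.symm_apply_eq, hRp]
      have hvalB : ∀ t, ∀ b ∈ B₀, ((R t)⁻¹ * (Φ (1, t) * F t)) b = b := by
        intro t b hb
        show (R t).symm (Φ (1, t) (F t b)) = b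
        rw [hFB t b hb, hΦU _ b (hUB b hb), hRs t b hb]
      intro t b hb
      show ((Φ (1, 0))⁻¹ * R 1) (((R t)⁻¹ * (Φ (1, t) * F t)) b) =
        ((Φ (1, 0))⁻¹ * R 1) (((R 0)⁻¹ * (Φ (1, 0) * F 0)) b)
      rcases hb with hb | ⟨j, rfl⟩
      · rw [hvalB t b hb, hvalB 0 b hb]
      · rw [hval, hval]
  refine ⟨Φ (1, 0), fun x hx => hΦU _ x hx, ?_⟩
  have h3 := mul_mem h1 (inv_mem h2)
  convert h3 using 1
  group

end Motion

/-! ## The motion of the branch points -/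

section Tracks

/-- The isotopy `H₁ H₂ ⋯ H_k`, each half twist `H_i` being run up to time `c i`. -/
noncomputable def halfProd (c : ℕ → unitInterval) : ℕ → ℂ ≃ₜ ℂ
  | 0 => 1
  | k + 1 => halfProd c k * halfTwistIsotopy (k + 1) (c (k + 1))

theorem halfProd_succ_apply (c : ℕ → unitInterval) (k : ℕ) (z : ℂ) :
    halfProd c (k + 1) z = halfProd c k (halfTwistIsotopy (k + 1) (c (k + 1)) z) := rfl

theorem halfProd_of_far {c : ℕ → unitInterval} {k : ℕ} {z : ℂ}
    (hz : ∀ i, 1 ≤ i → i ≤ k → 5 / 8 < ‖z - center i‖) : halfProd c k z = z := by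
  induction k with
  | zero => rfl
  | succ k ih =>
    rw [halfProd_succ_apply, halfTwistIsotopy_of_far _ (hz _ (by omega) le_rfl)]
    exact ih fun i h1 h2 => hz i h1 (by omega)

theorem halfProd_eq_one {c : ℕ → unitInterval} {k : ℕ} (hc : ∀ i ≤ k, c i = 0) :
    halfProd c k = 1 := by
  induction k with
  | zero => rfl
  | succ k ih =>
    rw [halfProd, hc _ le_rfl, halfTwistIsotopy_zero, mul_one]
    exact ih fun i h => hc i (by omega)

theorem continuous_halfProd {T : Type*} [TopologicalSpace T] {c : ℕ → T → unitInterval}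
    (hc : ∀ k, Continuous (c k)) (k : ℕ) :
    Continuous fun p : T × ℂ => halfProd (fun i => c i p.1) k p.2 := by
  induction k with
  | zero => exact continuous_snd
  | succ k ih =>
    have h1 : Continuous fun p : T × ℂ => halfTwistIsotopy (k + 1) (c (k + 1) p.1) p.2 :=
      (continuous_halfTwistIsotopy (k + 1)).comp
        (((hc _).comp continuous_fst).prodMk continuous_snd)
    exact ih.comp (continuous_fst.prodMk h1)

theorem natCast_far {i k : ℕ} (h : i ≠ k) (h' : i ≠ k + 1) : 5 / 8 < ‖(i : ℂ) - center k‖ := by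
  have h1 : (i : ℂ) - center k = (((i : ℝ) - k - 1 / 2 : ℝ) : ℂ) := by
    rw [center]
    push_cast
    ring
  rw [h1, Complex.norm_real, Real.norm_eq_abs, lt_abs]
  rcases lt_or_gt_of_ne h with h2 | h2
  · right
    have : (i : ℝ) + 1 ≤ k := by exact_mod_cast h2
    linarith
  · left
    have : (k : ℝ) + 2 ≤ i := by exact_mod_cast (show k + 2 ≤ i by omega)
    linarith

theorem natCast_near (k : ℕ) :
    ‖(k : ℂ) - center k‖ ≤ 5 / 8 ∧ ‖(k : ℂ) + 1 - center k‖ ≤ 5 / 8 := by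
  have h1 : (k : ℂ) - center k = -(1 / 2) := by
    rw [center]
    ring
  have h2 : (k : ℂ) + 1 - center k = 1 / 2 := by
    rw [center]
    ring
  rw [h1, h2]
  norm_num

theorem bounds_of_near {k : ℕ} {z : ℂ} (h : ‖z - center k‖ ≤ 5 / 8) :
    (k : ℝ) - 1 / 8 ≤ z.re ∧ ‖z‖ ≤ (k : ℝ) + 9 / 8 := by
  have hc : center k = (((k : ℝ) + 1 / 2 : ℝ) : ℂ) := by
    rw [center]
    push_cast
    ring
  constructor
  · have h1 := (abs_le.1 ((Complex.abs_re_le_norm _).trans h)).1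
    rw [hc, Complex.sub_re, Complex.ofReal_re] at h1
    linarith
  · have h1 : ‖z‖ ≤ ‖z - center k‖ + ‖center k‖ := by
      simpa using norm_add_le (z - center k) (center k)
    have h2 : ‖center k‖ = (k : ℝ) + 1 / 2 := by
      rw [hc, Complex.norm_real, Real.norm_eq_abs, abs_of_nonneg (by positivity)]
    linarith

variable {c : ℕ → unitInterval}

/-- The hypothesis `hc` says that the half twists run in decreasing order of index, one after
another. The point `i` is moved only by the `i`-th: those run before it have support away from `i`,
and those run after it have support away from `i + 1`. -/
theorem halfProd_natCast (hc : ∀ k, c k ≠ 1 → ∀ i < k, c i = 0) {i k : ℕ} (hi : 1 ≤ i)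
    (hik : i ≤ k) : halfProd c k i = halfTwistIsotopy i (c i) i := by
  induction k, hik using Nat.le_induction with
  | base =>
    obtain ⟨l, rfl⟩ := Nat.exists_eq_add_of_le' hi
    rw [halfProd_succ_apply]
    by_cases h : c (l + 1) = 1
    · rw [h, halfTwistIsotopy_one, (halfTwist_swap _).1]
      refine halfProd_of_far fun j h1 h2 => ?_
      have := natCast_far (i := l + 1 + 1) (k := j) (by omega) (by omega)
      exact_mod_cast this
    · rw [halfProd_eq_one fun j hj => hc _ h j (by omega)]
      rfl
  | succ k hk ih =>
    rw [halfProd_succ_apply, halfTwistIsotopy_of_far _ (natCast_far (by omega) (by omega)), ih]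

/-- The last point is passed down from each half twist to the next, always as the right-hand point
of the exchange, so it stays in the closed lower half plane. -/
theorem halfProd_last (hc : ∀ k, c k ≠ 1 → ∀ i < k, c i = 0) (k : ℕ) :
    (halfProd c k ((k : ℂ) + 1)).im ≤ 0 ∧ 7 / 8 ≤ (halfProd c k ((k : ℂ) + 1)).re ∧
      ‖halfProd c k ((k : ℂ) + 1)‖ ≤ (k : ℝ) + 9 / 8 := by
  induction k with
  | zero =>
    show ((((0 : ℕ) : ℂ) + 1).im ≤ 0 ∧ 7 / 8 ≤ (((0 : ℕ) : ℂ) + 1).re ∧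
      ‖(((0 : ℕ) : ℂ) + 1)‖ ≤ ((0 : ℕ) : ℝ) + 9 / 8)
    simp
    norm_num
  | succ k ih =>
    rw [halfProd_succ_apply]
    by_cases h : c (k + 1) = 1
    · rw [h, halfTwistIsotopy_one, (halfTwist_swap _).2]
      push_cast
      exact ⟨ih.1, ih.2.1, ih.2.2.trans (by linarith)⟩
    · rw [halfProd_eq_one fun j hj => hc _ h j (by omega)]
      have h1 := bounds_of_near (halfTwistIsotopy_near (c (k + 1)) (natCast_near (k + 1)).2)
      refine ⟨(im_halfTwistIsotopy (k + 1) (c (k + 1))).1, ?_, h1.2⟩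
      refine le_trans ?_ h1.1
      push_cast
      have : (0 : ℝ) ≤ k := Nat.cast_nonneg k
      linarith

theorem halfProd_last_of_one {k : ℕ} (hc : ∀ i, 1 ≤ i → c i = 1) :
    halfProd c k ((k : ℂ) + 1) = 1 := by
  induction k with
  | zero =>
    show ((0 : ℕ) : ℂ) + 1 = 1
    simp
  | succ k ih =>
    rw [halfProd_succ_apply, hc _ (by omega), halfTwistIsotopy_one, (halfTwist_swap _).2]
    push_cast
    exact ih

theorem natCast_bounds (i : ℕ) (hi : 1 ≤ i) (t : unitInterval) :
    0 ≤ (halfTwistIsotopy i t i).im ∧ 7 / 8 ≤ (halfTwistIsotopy i t i).re ∧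
      (i : ℝ) - 1 / 8 ≤ ‖halfTwistIsotopy i t i‖ ∧ ‖halfTwistIsotopy i t i‖ ≤ (i : ℝ) + 9 / 8 := by
  have h1 := bounds_of_near (halfTwistIsotopy_near t (natCast_near i).1)
  have h2 : (1 : ℝ) ≤ i := by exact_mod_cast hi
  exact ⟨(im_halfTwistIsotopy i t).2, by linarith, h1.1.trans (Complex.re_le_norm _), h1.2⟩

/-- If the `j`-th half twist is finished, the outer point is at `j + 1`, beyond `i + 9/8`. Otherwise
the inner point has not left `i`, and the outer one has modulus at least `j - 1/8`. -/
theorem norm_track_lt (hc : ∀ k, c k ≠ 1 → ∀ i < k, c i = 0) {i j : ℕ} (hi : 1 ≤ i) (hij : i < j) :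
    ‖halfTwistIsotopy i (c i) i‖ < ‖halfTwistIsotopy j (c j) j‖ := by
  have hij' : (i : ℝ) + 1 ≤ j := by exact_mod_cast hij
  by_cases h : c j = 1
  · have h1 := (natCast_bounds i hi (c i)).2.2.2
    rw [h, halfTwistIsotopy_one, (halfTwist_swap j).1]
    have h2 : ‖(j : ℂ) + 1‖ = (j : ℝ) + 1 := by exact_mod_cast Complex.norm_natCast (j + 1)
    rw [h2]
    linarith
  · have h1 := (natCast_bounds j (by omega) (c j)).2.2.1
    rw [hc j h i hij, halfTwistIsotopy_zero]
    have h2 : ‖(1 : ℂ ≃ₜ ℂ) (i : ℂ)‖ = i := Complex.norm_natCast i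
    rw [h2]
    linarith

end Tracks

/-! ### The homotopy from the motion of the branch points to the rotation of a regular polygon -/

section Tracks

/-- The isotopy turning the points of modulus `9 / 16 ≤ |z| ≤ 5 / 4` clockwise about the origin. -/
noncomputable def innerLoop (t : ℝ) : ℂ ≃ₜ ℂ :=
  rotBy (t • ((2 * Real.pi) • (clampHeight (5 / 4) (9 / 5) (by norm_num) -
    clampHeight (1 / 4) (9 / 16) (by norm_num))))

theorem innerLoop_zero : innerLoop 0 = 1 := by
  rw [innerLoop, zero_smul, rotBy_zero]

theorem innerLoop_one : innerLoop 1 = planeTwist (5 / 4) (9 / 5) (by norm_num) *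
    (planeTwist (1 / 4) (9 / 16) (by norm_num))⁻¹ := by
  rw [innerLoop, one_smul, smul_sub, sub_eq_add_neg, rotBy_add, rotBy_neg]
  rfl

theorem innerLoop_of_far (t : ℝ) {z : ℂ} (hz : ‖z‖ ≤ 1 / 4 ∨ 9 / 5 ≤ ‖z‖) :
    innerLoop t z = z := by
  refine rotBy_eq_self 0 ?_
  simp only [ContinuousMap.smul_apply, ContinuousMap.sub_apply]
  rcases hz with h | h
  · rw [clampHeight_of_le _ (h.trans (by norm_num)), clampHeight_of_le _ h]
    simp
  · rw [clampHeight_of_ge _ (by norm_num) h,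
      clampHeight_of_ge _ (by norm_num) (le_trans (by norm_num) h)]
    simp

theorem innerLoop_one_apply (t : ℝ) :
    innerLoop t 1 = Complex.exp (-(2 * Real.pi * t) * Complex.I) := by
  rw [innerLoop, rotBy_apply, norm_one, one_mul]
  congr 2
  simp only [ContinuousMap.smul_apply, ContinuousMap.sub_apply]
  rw [clampHeight_of_le _ (by norm_num), clampHeight_of_ge _ (by norm_num) (by norm_num)]
  simp only [smul_eq_mul]
  push_cast
  ring

variable {c : ℕ → unitInterval} {m : ℕ}

/-- The logarithm of the position of the `j`-th point under `innerLoop (c 0) * halfProd c m`. -/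
noncomputable def logTrack (c : ℕ → unitInterval) (m : ℕ) (j : Fin (m + 1)) : ℂ :=
  if (j : ℕ) < m then
    Complex.log (halfTwistIsotopy ((j : ℕ) + 1) (c ((j : ℕ) + 1)) (((j : ℕ) + 1 : ℕ) : ℂ))
  else Complex.log (halfProd c m ((m : ℂ) + 1)) + (-(2 * Real.pi * (c 0 : ℝ)) : ℝ) * Complex.I

theorem eq_one_of_zero_ne (hc : ∀ k, c k ≠ 1 → ∀ i < k, c i = 0) (h : c 0 ≠ 0) {k : ℕ}
    (hk : 1 ≤ k) : c k = 1 := by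
  by_contra h1
  exact h (hc k h1 0 hk)

theorem ne_zero_of_re {z : ℂ} (h : 7 / 8 ≤ z.re) : z ≠ 0 := by
  rintro rfl
  norm_num at h

/-- The inner loop starts only after all half twists. By then the first `m` points have modulus at
least `2 > 9/5` and escape it, while the last point is at `1` and acquires the angle `-2π c₀`. -/
theorem exp_logTrack (hc : ∀ k, c k ≠ 1 → ∀ i < k, c i = 0) (j : Fin (m + 1)) :
    Complex.exp (logTrack c m j) = innerLoop (c 0) (halfProd c m ((j : ℕ) + 1 : ℂ)) := by
  rw [logTrack]
  split_ifs with h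
  · have h1 := natCast_bounds ((j : ℕ) + 1) (by omega) (c ((j : ℕ) + 1))
    rw [Complex.exp_log (ne_zero_of_re h1.2.1)]
    have h2 := halfProd_natCast hc (i := (j : ℕ) + 1) (k := m) (by omega) (by omega)
    rw [Nat.cast_add, Nat.cast_one] at h2
    rw [h2]
    by_cases h0 : c 0 = 0
    · rw [h0, Set.Icc.coe_zero, innerLoop_zero, Nat.cast_add, Nat.cast_one]
      rfl
    · rw [eq_one_of_zero_ne hc h0 (by omega), halfTwistIsotopy_one, ← Nat.cast_one (R := ℂ),
        ← Nat.cast_add, (halfTwist_swap _).1, innerLoop_of_far]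
      right
      have h3 : ‖(((j : ℕ) + 1 : ℕ) : ℂ) + 1‖ = (((j : ℕ) + 1 : ℕ) : ℝ) + 1 := by
        exact_mod_cast Complex.norm_natCast ((j : ℕ) + 1 + 1)
      rw [h3]
      push_cast
      have : (0 : ℝ) ≤ (j : ℕ) := Nat.cast_nonneg _
      linarith
  · have hj : (j : ℕ) = m := by omega
    rw [hj, Complex.exp_add, Complex.exp_log (ne_zero_of_re (halfProd_last hc m).2.1)]
    by_cases h0 : c 0 = 0
    · rw [h0, Set.Icc.coe_zero, innerLoop_zero]
      simp
    · rw [halfProd_last_of_one fun i => eq_one_of_zero_ne hc h0, innerLoop_one_apply]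
      simp

theorem re_logTrack (hc : ∀ k, c k ≠ 1 → ∀ i < k, c i = 0) (j : Fin (m + 1)) :
    Real.log (7 / 8) ≤ (logTrack c m j).re ∧ (logTrack c m j).re ≤ Real.log ((m : ℝ) + 9 / 8) := by
  obtain ⟨z, hz1, hz2, hz⟩ : ∃ z : ℂ, 7 / 8 ≤ z.re ∧ ‖z‖ ≤ (m : ℝ) + 9 / 8 ∧
      (logTrack c m j).re = Real.log ‖z‖ := by
    rw [logTrack]
    split_ifs with h
    · have h1 := natCast_bounds ((j : ℕ) + 1) (by omega) (c ((j : ℕ) + 1))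
      have h2 : ((((j : ℕ) + 1 : ℕ)) : ℝ) ≤ m := by exact_mod_cast h
      exact ⟨_, h1.2.1, h1.2.2.2.trans (by linarith), Complex.log_re _⟩
    · refine ⟨_, (halfProd_last hc m).2.1, (halfProd_last hc m).2.2, ?_⟩
      rw [Complex.add_re, Complex.log_re, Complex.re_ofReal_mul, Complex.I_re, mul_zero, add_zero]
  have h1 := hz1.trans (Complex.re_le_norm z)
  rw [hz]
  exact ⟨Real.log_le_log (by norm_num) h1, Real.log_le_log (by linarith) hz2⟩

theorem re_logTrack_lt (hc : ∀ k, c k ≠ 1 → ∀ i < k, c i = 0) {i j : Fin (m + 1)} (hij : i < j)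
    (hj : (j : ℕ) < m) : (logTrack c m i).re < (logTrack c m j).re := by
  have hij' : (i : ℕ) < j := hij
  rw [logTrack, logTrack, if_pos hj, if_pos (hij'.trans hj), Complex.log_re, Complex.log_re]
  refine Real.log_lt_log ?_ (norm_track_lt hc (by omega) (by omega))
  have h1 := natCast_bounds ((i : ℕ) + 1) (by omega) (c ((i : ℕ) + 1))
  linarith [h1.2.1.trans (Complex.re_le_norm _)]

/-- During the half twists the last point has argument in `(-π/2, 0]` and the others in `[0, π/2)`.
During the inner loop the others rest on the positive axis and the last argument runs from `0` to
`-2π`. -/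
theorem im_logTrack (hc : ∀ k, c k ≠ 1 → ∀ i < k, c i = 0) {i j : Fin (m + 1)} (hij : i < j)
    (hj : (j : ℕ) = m) : -(2 * Real.pi) ≤ (logTrack c m j).im - (logTrack c m i).im ∧
      (logTrack c m j).im - (logTrack c m i).im ≤ 0 := by
  have hij' : (i : ℕ) < j := hij
  rw [logTrack, logTrack, if_neg (by omega), if_pos (by omega), Complex.add_im, Complex.log_im,
    Complex.log_im, Complex.im_ofReal_mul, Complex.I_im, mul_one]
  have h1 := natCast_bounds ((i : ℕ) + 1) (by omega) (c ((i : ℕ) + 1))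
  have h2 := halfProd_last hc m
  have hpi := Real.pi_pos
  by_cases h0 : c 0 = 0
  · rw [h0, Set.Icc.coe_zero]
    have h3 := Complex.arg_nonneg_iff.2 h1.1
    have h4 := (abs_lt.1 (Complex.abs_arg_lt_pi_div_two_iff.2
      (Or.inl (lt_of_lt_of_le (by norm_num) h1.2.1)))).2
    have h5 := (abs_lt.1 (Complex.abs_arg_lt_pi_div_two_iff.2
      (Or.inl (lt_of_lt_of_le (by norm_num) h2.2.1)))).1
    have h6 : (halfProd c m ((m : ℂ) + 1)).arg ≤ 0 := by
      rcases h2.1.lt_or_eq with h | h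
      · exact (Complex.arg_neg_iff.2 h).le
      · exact (Complex.arg_eq_zero_iff.2 ⟨by linarith [h2.2.1], h⟩).le
    constructor <;> linarith
  · rw [halfProd_last_of_one fun k => eq_one_of_zero_ne hc h0,
      eq_one_of_zero_ne hc h0 (k := (i : ℕ) + 1) (by omega), halfTwistIsotopy_one,
      (halfTwist_swap _).1, ← Nat.cast_add_one, Complex.natCast_arg, Complex.arg_one]
    have h3 := (c 0).2.1
    have h4 := (c 0).2.2
    constructor <;> nlinarith

theorem logTrack_of_zero (hc : ∀ k ≤ m, c k = 0) (j : Fin (m + 1)) :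
    logTrack c m j = Complex.log (((j : ℕ) : ℂ) + 1) := by
  rw [logTrack]
  split_ifs with h
  · rw [hc _ (by omega), halfTwistIsotopy_zero, ← Nat.cast_add_one]
    rfl
  · have hj : (j : ℕ) = m := by omega
    rw [halfProd_eq_one hc, hc 0 (by omega), hj, Set.Icc.coe_zero]
    simp

theorem logTrack_of_one (hc : ∀ k, c k = 1) (j : Fin (m + 1)) :
    logTrack c m j = if (j : ℕ) < m then Complex.log (((j : ℕ) : ℂ) + 1 + 1)
      else (-(2 * Real.pi) : ℝ) * Complex.I := by
  rw [logTrack]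
  split_ifs with h
  · rw [hc, halfTwistIsotopy_one, (halfTwist_swap _).1, Nat.cast_add_one]
  · rw [halfProd_last_of_one fun i _ => hc i, hc 0, Set.Icc.coe_one, Complex.log_one, zero_add,
      mul_one]

/-- The time to which the `k`-th half twist is run at time `τ`, the half twists being performed in
the order `m, m - 1, …, 1` and followed by the loop about the origin. -/
noncomputable def stage (m k : ℕ) (τ : unitInterval) : unitInterval :=
  Set.projIcc 0 1 zero_le_one (((m : ℝ) + 1) * τ - (m - k))

theorem continuous_stage (m k : ℕ) : Continuous (stage m k) :=
  continuous_projIcc.comp (by fun_prop)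

theorem stage_zero {m k : ℕ} (hk : k ≤ m) : stage m k 0 = 0 := by
  have : (k : ℝ) ≤ m := by exact_mod_cast hk
  exact Set.projIcc_of_le_left _ (by simp [this])

theorem stage_one (m k : ℕ) : stage m k 1 = 1 := by
  have : (0 : ℝ) ≤ k := Nat.cast_nonneg k
  refine Set.projIcc_of_right_le _ ?_
  rw [Set.Icc.coe_one]
  linarith

theorem stage_chain (m : ℕ) (τ : unitInterval) (k : ℕ) (h : stage m k τ ≠ 1) (i : ℕ)
    (hi : i < k) : stage m i τ = 0 := by
  have h1 : ((m : ℝ) + 1) * τ - (m - k) < 1 := by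
    by_contra h2
    exact h (Set.projIcc_of_right_le _ (not_lt.1 h2))
  have h2 : (i : ℝ) + 1 ≤ k := by exact_mod_cast hi
  exact Set.projIcc_of_le_left _ (by linarith)

theorem continuous_logTrack (j : Fin (m + 1)) :
    Continuous fun τ => logTrack (fun k => stage m k τ) m j := by
  unfold logTrack
  split_ifs with h
  · refine Continuous.clog ?_ fun τ => ?_
    · exact (continuous_halfTwistIsotopy _).comp ((continuous_stage m _).prodMk continuous_const)
    · have h1 := natCast_bounds ((j : ℕ) + 1) (by omega) (stage m ((j : ℕ) + 1) τ)
      exact Or.inl (lt_of_lt_of_le (by norm_num) h1.2.1)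
  · have h2 := continuous_stage m 0
    refine Continuous.add (Continuous.clog ?_ fun τ => ?_) (by fun_prop)
    · exact (continuous_halfProd (continuous_stage m) m).comp
        (continuous_id.prodMk continuous_const)
    · exact Or.inl (lt_of_lt_of_le (by norm_num) (halfProd_last (stage_chain m τ) m).2.1)

/-- The motion interpolating between the motion of the points `1, …, m + 1` under
`innerLoop * halfProd` and the rotation of a regular polygon. -/
noncomputable def motion (m : ℕ) (q : unitInterval × unitInterval) (j : Fin (m + 1)) : ℂ :=
  Complex.exp ((1 - (q.1 : ℝ) : ℝ) * logTrack (fun k => stage m k q.2) m j +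
    ((q.1 : ℝ) * -(2 * Real.pi * (((j : ℕ) + (q.2 : ℝ)) / ((m : ℝ) + 1))) : ℝ) * Complex.I)

theorem continuous_motion (m : ℕ) : Continuous (motion m) := by
  refine continuous_pi fun j => ?_
  unfold motion
  have := (continuous_logTrack (m := m) j).comp (continuous_snd (X := unitInterval))
  simp only [Function.comp_def] at this
  fun_prop

theorem norm_motion (q : unitInterval × unitInterval) (j : Fin (m + 1)) :
    9 / 16 < ‖motion m q j‖ ∧ ‖motion m q j‖ < (m : ℝ) + 2 := by
  have h1 := re_logTrack (stage_chain m q.2) j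
  have h2 := q.1.2.1
  have h3 := q.1.2.2
  have hm : (0 : ℝ) ≤ m := Nat.cast_nonneg m
  rw [motion, Complex.norm_exp, Complex.add_re, Complex.re_ofReal_mul, Complex.re_ofReal_mul,
    Complex.I_re, mul_zero, add_zero]
  have h4 : Real.log (7 / 8) < 0 := Real.log_neg (by norm_num) (by norm_num)
  have h5 : 0 ≤ Real.log ((m : ℝ) + 9 / 8) := Real.log_nonneg (by linarith)
  constructor
  · refine lt_of_lt_of_le (by norm_num : (9 / 16 : ℝ) < 7 / 8) ?_
    rw [← Real.log_le_iff_le_exp (by norm_num)]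
    nlinarith
  · refine lt_of_le_of_lt ?_ (by linarith : (m : ℝ) + 9 / 8 < m + 2)
    rw [← Real.le_log_iff_exp_le (by linarith)]
    nlinarith

theorem motion_zero (τ : unitInterval) (j : Fin (m + 1)) : motion m (0, τ) j =
    innerLoop (stage m 0 τ) (halfProd (fun k => stage m k τ) m ((j : ℕ) + 1 : ℂ)) := by
  rw [← exp_logTrack (c := fun k => stage m k τ) (stage_chain m τ), motion]
  simp

/-- At `s = 0` the points are images of distinct points under a homeomorphism. For `s > 0`, a
collision would force equal moduli and an angle difference in `2πℤ`, but equality of moduli confines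
that difference strictly between `-2π` and `0`. -/
theorem motion_ne {q : unitInterval × unitInterval} {i j : Fin (m + 1)} (hij : i < j) :
    motion m q i ≠ motion m q j := by
  have hij' : (i : ℕ) < j := hij
  have hjm : (j : ℕ) ≤ m := by omega
  obtain ⟨s, τ⟩ := q
  rcases eq_or_ne s 0 with rfl | hs
  · rw [motion_zero, motion_zero]
    intro h
    have h1 := (halfProd _ m).injective ((innerLoop _).injective h)
    have h2 : (((i : ℕ) : ℂ)) = (j : ℕ) := add_right_cancel h1
    exact hij.ne (Fin.ext (by exact_mod_cast h2))
  have hs0 : 0 < (s : ℝ) := lt_of_le_of_ne s.2.1 fun h => hs (Subtype.ext h.symm)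
  have hs1 := s.2.2
  intro h
  have hchain := stage_chain m τ
  have hm : (0 : ℝ) < (m : ℝ) + 1 := by positivity
  have hfrac : 0 < (((j : ℕ) : ℝ) - (i : ℕ)) / ((m : ℝ) + 1) ∧
      (((j : ℕ) : ℝ) - (i : ℕ)) / ((m : ℝ) + 1) < 1 := by
    have h1 : ((i : ℕ) : ℝ) + 1 ≤ (j : ℕ) := by exact_mod_cast hij'
    have h2 : ((j : ℕ) : ℝ) ≤ m := by exact_mod_cast hjm
    have h3 : (0 : ℝ) ≤ (i : ℕ) := Nat.cast_nonneg _
    exact ⟨div_pos (by linarith) hm, (div_lt_one hm).2 (by linarith)⟩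
  set u := fun j => logTrack (fun k => stage m k τ) m j with hu
  have hre : (1 - (s : ℝ)) * (u i).re = (1 - (s : ℝ)) * (u j).re := by
    have h1 := congrArg norm h
    rw [motion, motion, Complex.norm_exp, Complex.norm_exp, Real.exp_eq_exp, Complex.add_re,
      Complex.add_re] at h1
    simpa only [Complex.re_ofReal_mul, Complex.I_re, mul_zero, add_zero] using h1
  rw [motion, motion, eq_comm, Complex.exp_eq_exp_iff_exists_int] at h
  obtain ⟨a, ha⟩ := h
  have him : (1 - (s : ℝ)) * ((u j).im - (u i).im) -
      s * (2 * Real.pi * ((((j : ℕ) : ℝ) - (i : ℕ)) / ((m : ℝ) + 1))) = 2 * Real.pi * a := by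
    have h1 := congrArg Complex.im ha
    have h2 : (a : ℂ) * (2 * Real.pi * Complex.I) = ((2 * Real.pi * a : ℝ) : ℂ) * Complex.I := by
      push_cast
      ring
    rw [h2] at h1
    simp only [Complex.add_im, Complex.im_ofReal_mul, Complex.I_im, mul_one] at h1
    have h3 : ((((j : ℕ) : ℝ) - (i : ℕ)) / ((m : ℝ) + 1)) =
        (((j : ℕ) + (τ : ℝ)) / ((m : ℝ) + 1)) - (((i : ℕ) + (τ : ℝ)) / ((m : ℝ) + 1)) := by
      ring
    rw [h3]
    linear_combination h1
  have hpi := Real.pi_pos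
  -- If `j < m`, the real parts of the logarithms differ, so equal moduli force `s = 1` and the term
  -- vanishes. If `j = m`, the bound is `im_logTrack`. The polygon term is strictly between `-2πs`
  -- and `0`, which makes the total strict.
  have hbound : (1 - (s : ℝ)) * ((u j).im - (u i).im) ≤ 0 ∧
      (1 - (s : ℝ)) * -(2 * Real.pi) ≤ (1 - (s : ℝ)) * ((u j).im - (u i).im) := by
    rcases hjm.lt_or_eq with hj | hj
    · have h1 := re_logTrack_lt hchain hij hj
      have h2 : (1 - (s : ℝ)) * ((u j).re - (u i).re) = 0 := by linarith
      rcases mul_eq_zero.1 h2 with h3 | h3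
      · rw [h3]
        simp
      · exact absurd h3 (sub_pos.2 h1).ne'
    · have h1 := im_logTrack hchain hij hj
      exact ⟨mul_nonpos_of_nonneg_of_nonpos (by linarith) h1.2,
        mul_le_mul_of_nonneg_left h1.1 (by linarith)⟩
  have hx : 0 < (s : ℝ) * (2 * Real.pi * ((((j : ℕ) : ℝ) - (i : ℕ)) / ((m : ℝ) + 1))) ∧
      (s : ℝ) * (2 * Real.pi * ((((j : ℕ) : ℝ) - (i : ℕ)) / ((m : ℝ) + 1))) <
        s * (2 * Real.pi) := by
    refine ⟨mul_pos hs0 (mul_pos (by linarith) hfrac.1), mul_lt_mul_of_pos_left ?_ hs0⟩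
    nlinarith [hfrac.2]
  have h1 : 2 * Real.pi * (a : ℝ) < 0 := by linarith
  have h2 : -(2 * Real.pi) < 2 * Real.pi * (a : ℝ) := by linarith
  have h3 : (a : ℝ) < 0 := by nlinarith
  have h4 : (-1 : ℝ) < a := by nlinarith
  have h5 : a < 0 := by exact_mod_cast h3
  have h6 : -1 < a := by exact_mod_cast h4
  omega

theorem motion_injective (q : unitInterval × unitInterval) : Function.Injective (motion m q) := by
  intro i j h
  rcases lt_trichotomy i j with hij | hij | hij
  · exact absurd h (motion_ne hij)
  · exact hij
  · exact absurd h.symm (motion_ne hij)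

/-- The cyclic permutation is the same for all `s`: for the last point both the inner loop and the
polygon contribute exactly `-2πi`, so every weighted mean is `-2πi` as well. -/
theorem motion_end (s : unitInterval) (j : Fin (m + 1)) :
    motion m (s, 1) j = motion m (s, 0) (if h : (j : ℕ) < m then ⟨j + 1, by omega⟩ else 0) := by
  have hm : (m : ℝ) + 1 ≠ 0 := by positivity
  rw [motion, motion, logTrack_of_zero fun k hk => stage_zero hk, logTrack_of_one (stage_one m)]
  split_ifs with h
  · simp
  · have hj : (j : ℕ) = m := by omega
    rw [hj]
    simp only [Set.Icc.coe_one, div_self hm, Fin.val_zero, Nat.cast_zero, Set.Icc.coe_zero,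
      add_zero, zero_div, mul_zero, zero_add, Complex.log_one, neg_zero, Complex.ofReal_zero,
      zero_mul, mul_one, Complex.exp_zero]
    rw [Complex.exp_eq_one_iff]
    refine ⟨-1, ?_⟩
    push_cast
    ring

theorem motion_start (j : Fin (m + 1)) : motion m (0, 0) j = ((j : ℕ) : ℂ) + 1 := by
  rw [motion_zero, stage_zero (Nat.zero_le m), halfProd_eq_one fun k hk => stage_zero hk,
    Set.Icc.coe_zero, innerLoop_zero]
  rfl

end Tracks

/-! ## The relation in the plane -/

section PlaneRelation

/-- The rotation by `-2 π t` of the points of modulus `9 / 16 ≤ |z| ≤ m + 2`. -/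
noncomputable def outerLoop (m : ℕ) (t : ℝ) : ℂ ≃ₜ ℂ :=
  rotBy (t • ((2 * Real.pi) • (clampHeight ((m : ℝ) + 2) (m + 3) (by positivity) -
    clampHeight (1 / 4) (9 / 16) (by norm_num))))

theorem outerLoop_one (m : ℕ) : outerLoop m 1 =
    planeTwist ((m : ℝ) + 2) (m + 3) (by positivity) *
      (planeTwist (1 / 4) (9 / 16) (by norm_num))⁻¹ := by
  rw [outerLoop, one_smul, smul_sub, sub_eq_add_neg, rotBy_add, rotBy_neg]
  rfl

theorem outerLoop_of_far {m : ℕ} (t : ℝ) {z : ℂ} (hz : ‖z‖ ≤ 1 / 4 ∨ (m : ℝ) + 3 ≤ ‖z‖) :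
    outerLoop m t z = z := by
  have hm : (0 : ℝ) ≤ m := Nat.cast_nonneg m
  refine rotBy_eq_self 0 ?_
  simp only [ContinuousMap.smul_apply, ContinuousMap.sub_apply]
  rcases hz with h | h
  · rw [clampHeight_of_le _ (by linarith), clampHeight_of_le _ h]
    simp
  · rw [clampHeight_of_ge _ (by linarith) h,
      clampHeight_of_ge _ (by norm_num) (by linarith)]
    simp

theorem outerLoop_of_mem {m : ℕ} (t : ℝ) {z : ℂ} (h1 : 9 / 16 ≤ ‖z‖) (h2 : ‖z‖ ≤ (m : ℝ) + 2) :
    outerLoop m t z = z * Complex.exp ((-(2 * Real.pi * t) : ℝ) * Complex.I) := by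
  rw [outerLoop, rotBy_apply]
  simp only [ContinuousMap.smul_apply, ContinuousMap.sub_apply]
  rw [clampHeight_of_le _ h2, clampHeight_of_ge _ (by norm_num) h1]
  congr 3
  simp only [smul_eq_mul]
  ring_nf

/-- The complement of the open annulus `1 / 4 < |z| < m + 3`. -/
def ringCompl (m : ℕ) : Set ℂ := {z | ‖z‖ ≤ 1 / 4 ∨ (m : ℝ) + 3 ≤ ‖z‖}

theorem halfTwist_region {m i : ℕ} (hi : 1 ≤ i) (him : i ≤ m) {z : ℂ}
    (hz : ‖z‖ ≤ 9 / 16 ∨ (m : ℝ) + 3 ≤ ‖z‖) : 5 / 8 < ‖z - center i‖ := by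
  by_contra h
  push Not at h
  have h1 := bounds_of_near h
  have h2 := Complex.re_le_norm z
  have h3 : (1 : ℝ) ≤ i := by exact_mod_cast hi
  have h4 : (i : ℝ) ≤ m := by exact_mod_cast him
  rcases hz with h5 | h5 <;> linarith [h1.1, h1.2]

theorem motion_one_left (m : ℕ) (t : unitInterval) (j : Fin (m + 1)) : motion m (1, t) j =
    Complex.exp ((-(2 * Real.pi * (((j : ℕ) + (t : ℝ)) / ((m : ℝ) + 1))) : ℝ) * Complex.I) := by
  simp [motion]

/-- The motion under `F` is homotopic to the polygon rotation `R`, so `F 1` is isotopic to a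
conjugate of `R 1`, and the power of `R 1` is a full turn. -/
theorem pow_mul_inv_mem_isoSub (m : ℕ) :
    ((innerLoop 1 * halfProd (fun _ => 1) m) ^ (m + 1))⁻¹ * outerLoop m 1 ∈
      isoSub (ringCompl m ∪ Set.range fun j : Fin (m + 1) => ((j : ℕ) : ℂ) + 1) := by
  have hm : (0 : ℝ) < (m : ℝ) + 1 := by positivity
  let F : unitInterval → ℂ ≃ₜ ℂ :=
    fun τ => innerLoop (stage m 0 τ) * halfProd (fun k => stage m k τ) m
  let R : unitInterval → ℂ ≃ₜ ℂ := fun t => outerLoop m ((t : ℝ) / ((m : ℝ) + 1))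
  let U : Set ℂ := {z | 9 / 16 < ‖z‖ ∧ ‖z‖ < (m : ℝ) + 2}
  have hU : IsOpen U := (isOpen_lt continuous_const continuous_norm).inter
    (isOpen_lt continuous_norm continuous_const)
  have hFB : ∀ t, ∀ b ∈ ringCompl m, F t b = b := by
    intro t b hb
    have h1 : halfProd (fun k => stage m k t) m b = b :=
      halfProd_of_far fun i h1 h2 => halfTwist_region h1 h2
        (hb.imp_left fun h => h.trans (by norm_num))
    show innerLoop _ (halfProd _ m b) = b
    rw [h1, innerLoop_of_far _ (hb.imp_right fun h => le_trans (by linarith) h)]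
  have hFp : ∀ t (j : Fin (m + 1)), F t (motion m (0, 0) j) = motion m (0, t) j := by
    intro t j
    rw [motion_zero (τ := t), motion_start]
    rfl
  have hF0 : F 0 = 1 := by
    show innerLoop (stage m 0 0) * halfProd (fun k => stage m k 0) m = 1
    rw [stage_zero (Nat.zero_le m), halfProd_eq_one fun k hk => stage_zero hk, Set.Icc.coe_zero,
      innerLoop_zero, mul_one]
  have hF1 : F 1 = innerLoop 1 * halfProd (fun _ => 1) m := by
    show innerLoop (stage m 0 1) * halfProd (fun k => stage m k 1) m = _
    simp only [stage_one, Set.Icc.coe_one]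
  have hFc : Continuous fun q : unitInterval × ℂ => F q.1 q.2 := by
    have h1 : Continuous fun q : unitInterval × ℂ => innerLoop (stage m 0 q.1) q.2 :=
      continuous_rotBy_smul (continuous_subtype_val.comp (continuous_stage m 0)) _
    exact h1.comp (continuous_fst.prodMk (continuous_halfProd (continuous_stage m) m))
  have hRc : Continuous fun q : unitInterval × ℂ => (R q.1).symm q.2 := by
    have h1 : ∀ t, (R t).symm = rotBy ((-((t : ℝ) / ((m : ℝ) + 1))) •
        ((2 * Real.pi) • (clampHeight ((m : ℝ) + 2) (m + 3) (by positivity) -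
          clampHeight (1 / 4) (9 / 16) (by norm_num)))) := by
      intro t
      rw [neg_smul, rotBy_neg]
      rfl
    simp only [h1]
    exact continuous_rotBy_smul (c := fun t : unitInterval => -((t : ℝ) / ((m : ℝ) + 1)))
      (by fun_prop) _
  have hRp : ∀ t (j : Fin (m + 1)), R t (motion m (1, 0) j) = motion m (1, t) j := by
    intro t j
    have hb := norm_motion (1, 0) j
    rw [show R t = outerLoop m ((t : ℝ) / ((m : ℝ) + 1)) from rfl,
      outerLoop_of_mem _ hb.1.le hb.2.le, motion_one_left, motion_one_left, ← Complex.exp_add]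
    congr 1
    simp only [Set.Icc.coe_zero]
    push_cast
    ring
  obtain ⟨L, hLU, hL⟩ := exists_conj_of_motion (B₀ := ringCompl m) (R := R) hU
    (fun x hx => hx.2)
    (by
      rintro b (hb | hb) hbU
      · linarith [hbU.1]
      · linarith [hbU.2])
    (continuous_motion m) motion_injective (fun q j => norm_motion q j) motion_end hFc hRc hF0
    (by
      show outerLoop m (((0 : unitInterval) : ℝ) / _) = 1
      rw [Set.Icc.coe_zero, zero_div, outerLoop, zero_smul, rotBy_zero])
    hFB (fun t b hb => outerLoop_of_far _ hb) hFp hRp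
  have hrange : (Set.range (motion m (0, 0))) =
      Set.range fun j : Fin (m + 1) => ((j : ℕ) : ℂ) + 1 := by
    congr 1
    funext j
    exact motion_start j
  have key := inv_pow_mul_pow_mem_isoSub (f := F 1) ?_ hL (m + 1)
  · rw [hrange, hF1] at key
    convert key using 2
    have h1 : L⁻¹ * R 1 * L = L⁻¹ * R 1 * (L⁻¹)⁻¹ := by rw [inv_inv]
    rw [h1, conj_pow, inv_inv]
    have h2 : R 1 ^ (m + 1) = outerLoop m 1 := by
      show outerLoop m _ ^ (m + 1) = _
      rw [outerLoop, outerLoop, ← rotBy_nsmul, ← Nat.cast_smul_eq_nsmul ℝ, smul_smul,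
        Set.Icc.coe_one]
      congr 2
      push_cast
      field_simp
    -- A full turn is the identity on `U`, and `L` is the identity off `U`, so the conjugation by
    -- `L` is trivial.
    have h3 : Commute (outerLoop m 1) L := by
      refine commute_of_disjoint fun x => ?_
      by_cases hx : x ∈ U
      · left
        rw [outerLoop_of_mem _ hx.1.le hx.2.le]
        have : Complex.exp ((-(2 * Real.pi * 1) : ℝ) * Complex.I) = 1 := by
          rw [Complex.exp_eq_one_iff]
          exact ⟨-1, by push_cast; ring⟩
        rw [this, mul_one]
      · right
        exact hLU x hx
    rw [h2, mul_assoc, h3.eq, inv_mul_cancel_left]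
  · rintro b (hb | ⟨j, rfl⟩)
    · left
      rw [hFB 1 b hb]
      exact hb
    · right
      rw [hFp, motion_end]
      exact ⟨_, rfl⟩

/-- The relation between the twists and half twists of the plane. -/
theorem plane_relation (m : ℕ) :
    ((planeTwist (5 / 4) (9 / 5) (by norm_num) * halfProd (fun _ => 1) m) ^ (m + 1))⁻¹ *
      (planeTwist (1 / 4) (9 / 16) (by norm_num) ^ m *
        planeTwist ((m : ℝ) + 2) (m + 3) (by positivity)) ∈
      isoSub (ringCompl m ∪ Set.range fun j : Fin (m + 1) => ((j : ℕ) : ℂ) + 1) := by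
  have key := pow_mul_inv_mem_isoSub m
  rw [innerLoop_one, outerLoop_one] at key
  set A := planeTwist (5 / 4) (9 / 5) (by norm_num)
  set D := planeTwist (1 / 4) (9 / 16) (by norm_num) with hD
  set E := planeTwist ((m : ℝ) + 2) (m + 3) (by positivity)
  set P := halfProd (fun _ => 1) m
  have hcomm : ∀ {r s : ℝ} (hr : 0 < r), Commute D (planeTwist r s hr) := by
    intro r s hr
    show rotBy _ * rotBy _ = rotBy _ * rotBy _
    rw [← rotBy_add, ← rotBy_add, add_comm]
  have hDA : Commute D A := hcomm _
  have hDE : Commute D E := hcomm _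
  have hDP : Commute D P := by
    refine commute_of_disjoint fun x => ?_
    rcases le_total ‖x‖ (9 / 16) with h | h
    · right
      exact halfProd_of_far fun i h1 h2 => halfTwist_region h1 h2 (Or.inl h)
    · left
      exact planeTwist_of_not_mem _ (by norm_num) fun hx => not_lt.2 h hx.2
  have h1 : A * D⁻¹ * P = A * P * D⁻¹ := by
    rw [mul_assoc, mul_assoc, (hDP.inv_left).eq]
  have h2 : Commute (A * P) D⁻¹ := (hDA.mul_right hDP).symm.inv_right
  -- Collecting the central factors gives `D^-(m+1)` on the left and `D⁻¹` on the right; their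
  -- difference is the factor `D^m`.
  rw [h1, h2.mul_pow] at key
  convert key using 1
  have h3 : Commute ((A * P) ^ (m + 1)) (D⁻¹ ^ (m + 1)) := h2.pow_pow _ _
  rw [h3.eq, mul_inv_rev, mul_assoc]
  congr 1
  rw [inv_pow, inv_inv, (hDE.inv_left.symm).eq, ← mul_assoc, pow_succ, mul_inv_cancel_right]

end PlaneRelation

/-! ## The Dehn twists cover twists and half twists of the plane -/

section Cover

variable {g : ℕ}

theorem AnnularCurve.twistHomeo_embedding (A : AnnularCurve g) (ζ : annulus A.inner A.outer) :
    A.twistHomeo (A.embedding ζ) = A.embedding (twistSelf A.inner A.outer 1 ζ) :=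
  A.embedding_injective.extend_apply _ _ _

theorem AnnularCurve.twistHomeo_of_not_mem (A : AnnularCurve g) {x : Surface g}
    (hx : ∀ ζ, A.embedding ζ ≠ x) : A.twistHomeo x = x :=
  Function.extend_apply' _ _ _ fun ⟨ζ, h⟩ => hx ζ h

/-- A mapping class of the surface is represented by a lift of the homeomorphism `f`. -/
def IsCoverOf (x : Mod g) (f : ℂ ≃ₜ ℂ) : Prop :=
  ∃ k : homeoRel (Surface g) (surfaceBoundary g), QuotientGroup.mk k = x ∧
    ∀ y, ((k : Surface g ≃ₜ Surface g) y).1.1 = f y.1.1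

theorem IsCoverOf.one : IsCoverOf (1 : Mod g) 1 := ⟨1, rfl, fun _ => rfl⟩

theorem IsCoverOf.mul {x y : Mod g} {f h : ℂ ≃ₜ ℂ} (hx : IsCoverOf x f) (hy : IsCoverOf y h) :
    IsCoverOf (x * y) (f * h) := by
  obtain ⟨k, rfl, hk⟩ := hx
  obtain ⟨l, rfl, hl⟩ := hy
  refine ⟨k * l, rfl, fun z => ?_⟩
  show ((k : Surface g ≃ₜ Surface g) ((l : Surface g ≃ₜ Surface g) z)).1.1 = f (h z.1.1)
  rw [hk, hl]

theorem IsCoverOf.pow {x : Mod g} {f : ℂ ≃ₜ ℂ} (hx : IsCoverOf x f) (n : ℕ) :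
    IsCoverOf (x ^ n) (f ^ n) := by
  induction n with
  | zero =>
    rw [pow_zero, pow_zero]
    exact IsCoverOf.one
  | succ n ih =>
    rw [pow_succ, pow_succ]
    exact ih.mul hx

/-- This transfers relations from the plane to the surface, by `isotopicToId_of_cover` applied to
the quotient of two representatives. -/
theorem IsCoverOf.eq {x y : Mod g} {f h : ℂ ≃ₜ ℂ} (hx : IsCoverOf x f) (hy : IsCoverOf y h)
    (hfh : f⁻¹ * h ∈ isoSub (branchSet g)) : x = y := by
  obtain ⟨k, rfl, hk⟩ := hx
  obtain ⟨l, rfl, hl⟩ := hy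
  refine QuotientGroup.eq.2 (isotopicToId_of_cover _ hfh fun z => ?_)
  show ((k : Surface g ≃ₜ Surface g).symm ((l : Surface g ≃ₜ Surface g) z)).1.1 =
    f.symm (h z.1.1)
  rw [Homeomorph.eq_symm_apply, ← hk, ← hl]
  exact congrArg (fun x : Surface g => x.1.1) (Homeomorph.apply_symm_apply _ _)

theorem AnnularCurve.isCoverOf (A : AnnularCurve g) {f : ℂ ≃ₜ ℂ}
    (h : ∀ x, (A.twistHomeo x).1.1 = f x.1.1) : IsCoverOf A.dehnTwist f :=
  ⟨⟨A.twistHomeo, A.twistHomeo_mem⟩, rfl, h⟩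

theorem eq_or_eq_neg_of_root {x : Surface g} {v : ℂ} (hv : v ^ 2 = branchPoly g x.1.1) :
    v = x.1.2 ∨ -v = x.1.2 := by
  rcases sq_eq_sq_iff_eq_or_eq_neg.1 (hv.trans x.2.2.2.symm) with h | h
  · exact Or.inl h
  · exact Or.inr (by rw [h, neg_neg])

/-- The product of the twists about the two lifts of a circle covers the twist about the circle. -/
theorem isCoverOf_graphCurve {r s : ℝ} {hr : 1 / 4 ≤ r} {hrs : r < s} {hs : s ≤ 2 * (g : ℝ) + 3}
    {f : ℂ → ℂ} {hf : DifferentiableOn ℂ f (annulus r s)}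
    {hsq : ∀ z ∈ annulus r s, f z ^ 2 = branchPoly g z} {hne : ∀ z ∈ annulus r s, f z ≠ 0}
    {hf' : DifferentiableOn ℂ (fun z => -f z) (annulus r s)}
    {hsq' : ∀ z ∈ annulus r s, (-f z) ^ 2 = branchPoly g z}
    {hne' : ∀ z ∈ annulus r s, -f z ≠ 0} (hr0 : 0 < r) :
    IsCoverOf ((graphCurve g r s hr hrs hs f hf hsq hne).dehnTwist *
      (graphCurve g r s hr hrs hs (fun z => -f z) hf' hsq' hne').dehnTwist)
      (planeTwist r s hr0) := by
  set A := graphCurve g r s hr hrs hs f hf hsq hne with hA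
  set B := graphCurve g r s hr hrs hs (fun z => -f z) hf' hsq' hne' with hB
  refine ⟨⟨A.twistHomeo, A.twistHomeo_mem⟩ * ⟨B.twistHomeo, B.twistHomeo_mem⟩, rfl, fun x => ?_⟩
  show (A.twistHomeo (B.twistHomeo x)).1.1 = planeTwist r s hr0 x.1.1
  have hdisj : ∀ (a : annulus A.inner A.outer) (b : annulus B.inner B.outer),
      A.embedding a ≠ B.embedding b := by
    intro a b h
    have h1 : (a : ℂ) = b := congrArg (fun x : Surface g => x.1.1) h
    have h2 : f a = -f b := congrArg (fun x : Surface g => x.1.2) h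
    rw [← h1] at h2
    exact hne a a.2 (by linear_combination h2 / 2)
  by_cases hx : x.1.1 ∈ annulus r s
  · rw [planeTwist_of_mem hr0 hx]
    rcases eq_or_eq_neg_of_root (hsq _ hx) with h | h
    · have h1 : x = A.embedding ⟨x.1.1, hx⟩ := Subtype.ext (Prod.ext rfl h.symm)
      have h2 : B.twistHomeo x = x := B.twistHomeo_of_not_mem fun b hb => by
        rw [h1] at hb
        exact hdisj _ _ hb.symm
      rw [h2, h1, A.twistHomeo_embedding]
      rfl
    · have h1 : x = B.embedding ⟨x.1.1, hx⟩ := Subtype.ext (Prod.ext rfl h.symm)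
      rw [h1, B.twistHomeo_embedding, A.twistHomeo_of_not_mem fun a => hdisj a _]
      rfl
  · rw [planeTwist_of_not_mem hr0 hrs fun h => hx ⟨h.1.le, h.2.le⟩,
      B.twistHomeo_of_not_mem, A.twistHomeo_of_not_mem]
    · rintro ζ rfl
      exact hx ζ.2
    · rintro ζ rfl
      exact hx ζ.2

/-- In the annular coordinate `ζ` the projection is `foldC k`, and the half twist was defined as the
map covered by this very twist. Off the annulus, the points `ζ` and `ζ⁻¹` account for both sheets.
-/
theorem isCoverOf_curveC {k : ℕ} (hk : 1 ≤ k) (hkg : k ≤ 2 * g) :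
    IsCoverOf (curveC g k hk hkg).dehnTwist (halfTwist k) := by
  refine AnnularCurve.isCoverOf _ fun x => ?_
  by_cases hx : ∃ ζ, (curveC g k hk hkg).embedding ζ = x
  · obtain ⟨ζ, rfl⟩ := hx
    rw [AnnularCurve.twistHomeo_embedding]
    have hζ : (ζ : ℂ) ∈ annulus (1 / 2) 2 := ζ.2
    show foldC k (annulusTwist (1 / 2) 2 1 ζ) = halfTwist k (foldC k ζ)
    rw [halfTwist_foldC (ne_zero_of_mem_annulus (by norm_num) hζ), coreTwist,
      planeTwist_of_mem _ hζ]
  · push Not at hx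
    rw [AnnularCurve.twistHomeo_of_not_mem _ hx]
    obtain ⟨ζ, h0, hζ⟩ := exists_foldC_eq k x.1.1
    rw [← hζ, halfTwist_foldC h0, coreTwist, planeTwist_of_not_mem _ (by norm_num)]
    intro hmem
    have hmem' : ζ ∈ annulus (1 / 2) 2 := ⟨hmem.1.le, hmem.2.le⟩
    have hsq : ((ζ - ζ⁻¹) / 4 * branchC g k (foldC k ζ)) ^ 2 = branchPoly g x.1.1 := by
      rw [mul_pow, ← foldC_sub_mul k h0, branchC_sq hk hkg, hζ]
    have hinv : foldC k ζ⁻¹ = foldC k ζ := by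
      rw [foldC, foldC, inv_inv, add_comm ζ⁻¹]
    have hinvmem : ζ⁻¹ ∈ annulus (1 / 2) 2 := by
      have hp := norm_pos_iff.2 h0
      refine ⟨?_, ?_⟩
      · rw [norm_inv, one_div]
        exact (inv_le_inv₀ (by norm_num) hp).2 hmem'.2
      · rw [norm_inv, inv_le_comm₀ hp (by norm_num), ← one_div]
        exact hmem'.1
    rcases eq_or_eq_neg_of_root hsq with h | h
    · exact hx ⟨ζ, hmem'⟩ (Subtype.ext (Prod.ext hζ h))
    · refine hx ⟨ζ⁻¹, hinvmem⟩ (Subtype.ext (Prod.ext (hinv.trans hζ) ?_))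
      show (ζ⁻¹ - ζ⁻¹⁻¹) / 4 * branchC g k (foldC k ζ⁻¹) = x.1.2
      rw [← h, hinv, inv_inv]
      ring

theorem height_sq {ζ : ℂ} (hζ : ζ ∈ annulus (1 / 2) (3 / 4)) :
    height (1 / 4) (9 / 16) (ζ ^ 2) = height (1 / 2) (3 / 4) ζ := by
  have h1 : 0 < ‖ζ‖ := lt_of_lt_of_le (by norm_num) hζ.1
  have h2 : ‖ζ ^ 2‖ / (1 / 4) = (‖ζ‖ / (1 / 2)) ^ 2 := by
    rw [norm_pow]
    ring
  have h3 : (9 / 16 / (1 / 4) : ℝ) = ((3 / 4) / (1 / 2)) ^ 2 := by norm_num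
  rw [height, height, h2, h3, Real.log_pow, Real.log_pow]
  exact mul_div_mul_left _ _ (by norm_num)

/-- The projection `ζ ↦ ζ²` keeps the normalised logarithmic height and doubles angles, so one twist
upstairs covers two downstairs. -/
theorem isCoverOf_curveD₁ :
    IsCoverOf (curveD₁ g).dehnTwist (planeTwist (1 / 4) (9 / 16) (by norm_num) ^ 2) := by
  refine AnnularCurve.isCoverOf _ fun x => ?_
  have hpow : ∀ z, (planeTwist (1 / 4) (9 / 16) (by norm_num) ^ 2) z =
      planeTwist (1 / 4) (9 / 16) (by norm_num)
        (planeTwist (1 / 4) (9 / 16) (by norm_num) z) := fun z => rfl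
  rw [hpow]
  by_cases hx : ∃ ζ, (curveD₁ g).embedding ζ = x
  · obtain ⟨ζ, rfl⟩ := hx
    rw [AnnularCurve.twistHomeo_embedding]
    have hζ : (ζ : ℂ) ∈ annulus (1 / 2) (3 / 4) := ζ.2
    have hmem : (ζ : ℂ) ^ 2 ∈ annulus (1 / 4) (9 / 16) := by
      rw [annulus, Set.mem_ofPred_eq, norm_pow]
      constructor <;> nlinarith [hζ.1, hζ.2]
    have hmem' : planeTwist (1 / 4) (9 / 16) (by norm_num) ((ζ : ℂ) ^ 2) ∈
        annulus (1 / 4) (9 / 16) := by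
      rw [annulus, Set.mem_ofPred_eq, planeTwist, norm_rotBy]
      exact hmem
    show (annulusTwist (1 / 2) (3 / 4) 1 ζ) ^ 2 = planeTwist (1 / 4) (9 / 16) _
      (planeTwist (1 / 4) (9 / 16) _ ((ζ : ℂ) ^ 2))
    rw [planeTwist_of_mem _ hmem', planeTwist_of_mem _ hmem, annulusTwist_annulusTwist,
      annulusTwist, annulusTwist, height_sq hζ, mul_pow, ← Complex.exp_nat_mul]
    congr 2
    push_cast
    ring
  · push Not at hx
    rw [AnnularCurve.twistHomeo_of_not_mem _ hx]
    have hout : x.1.1 ∉ openAnnulus (1 / 4) (9 / 16) := by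
      intro hmem
      obtain ⟨ζ, hζ⟩ : ∃ ζ : ℂ, ζ ^ 2 = x.1.1 := ⟨_, sqrt_sq _⟩
      have hn : ‖ζ‖ ^ 2 = ‖x.1.1‖ := by rw [← norm_pow, hζ]
      have h2 := norm_nonneg ζ
      have hζm : ζ ∈ annulus (1 / 2) (3 / 4) := by
        constructor <;> nlinarith [hmem.1, hmem.2]
      have hζm' : -ζ ∈ annulus (1 / 2) (3 / 4) := by
        simpa only [annulus, Set.mem_ofPred_eq, norm_neg] using hζm
      have hsq : branchD₁ g ζ ^ 2 = branchPoly g x.1.1 := by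
        rw [← hζ]
        exact ((curveD₁ g).mapsTo hζm).2.2
      rcases eq_or_eq_neg_of_root hsq with h | h
      · exact hx ⟨ζ, hζm⟩ (Subtype.ext (Prod.ext hζ h))
      · refine hx ⟨-ζ, hζm'⟩ (Subtype.ext (Prod.ext (by rw [← hζ]; exact neg_sq ζ) ?_))
        rw [← h]
        show branchD₁ g (-ζ) = -branchD₁ g ζ
        simp [branchD₁]
    rw [planeTwist_of_not_mem _ (by norm_num) hout, planeTwist_of_not_mem _ (by norm_num) hout]

theorem isCoverOf_prod (p : ℕ) (hp : p ≤ 2 * g) :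
    IsCoverOf (List.ofFn fun i : Fin p => (curveC g ((i : ℕ) + 1) (Nat.succ_pos i)
      ((Nat.succ_le_of_lt i.isLt).trans hp)).dehnTwist).prod (halfProd (fun _ => 1) p) := by
  induction p with
  | zero => exact IsCoverOf.one
  | succ p ih =>
    rw [List.ofFn_succ', List.concat_eq_append, List.prod_append, List.prod_singleton, halfProd,
      halfTwistIsotopy_one]
    exact (ih (by omega)).mul (isCoverOf_curveC _ _)

theorem branchSet_eq_union : branchSet g =
    ringCompl (2 * g) ∪ Set.range fun j : Fin (2 * g + 1) => ((j : ℕ) : ℂ) + 1 := by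
  ext z
  simp only [branchSet, ringCompl, Set.mem_union, Set.mem_ofPred_eq, Set.mem_range, or_assoc]
  push_cast
  refine or_congr_right (or_congr_right ⟨?_, ?_⟩)
  · rintro ⟨j, hj, rfl⟩
    rw [Finset.mem_Icc] at hj
    refine ⟨⟨j - 1, by omega⟩, ?_⟩
    show ((j - 1 : ℕ) : ℂ) + 1 = j
    exact_mod_cast congrArg (Nat.cast (R := ℂ)) (show j - 1 + 1 = j by omega)
  · rintro ⟨j, rfl⟩
    exact ⟨(j : ℕ) + 1, Finset.mem_Icc.2 (by omega), by push_cast; rfl⟩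

end Cover

end StarRelation

open StarRelation in
/-- The genus-`g` star relation
`(T_{a₁} T_{a₂} T_{c₁} ⋯ T_{c_{2g}}) ^ (2 g + 1) = T_{d₁} ^ g T_{d₂} T_{d₃}` in `Mod(Σ_{g,3})`. -/
theorem mainTheorem3 (g : ℕ) :
    ((curveA₁ g).dehnTwist * (curveA₂ g).dehnTwist *
        (List.ofFn fun i : Fin (2 * g) =>
          (curveC g ((i : ℕ) + 1) (Nat.succ_pos i) (Nat.succ_le_of_lt i.isLt)).dehnTwist).prod) ^
        (2 * g + 1) =
      (curveD₁ g).dehnTwist ^ g * (curveD₂ g).dehnTwist * (curveD₃ g).dehnTwist := by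
  have hA : IsCoverOf ((curveA₁ g).dehnTwist * (curveA₂ g).dehnTwist)
      (planeTwist (5 / 4) (9 / 5) (by norm_num)) := isCoverOf_graphCurve _
  have hD : IsCoverOf ((curveD₂ g).dehnTwist * (curveD₃ g).dehnTwist)
      (planeTwist (2 * (g : ℝ) + 2) (2 * (g : ℝ) + 3) (by positivity)) := isCoverOf_graphCurve _
  have h := plane_relation (2 * g)
  rw [← branchSet_eq_union] at h
  rw [mul_assoc ((curveD₁ g).dehnTwist ^ g)]
  refine ((hA.mul (isCoverOf_prod (2 * g) le_rfl)).pow (2 * g + 1)).eq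
    ((isCoverOf_curveD₁.pow g).mul hD) ?_
  -- The `g`-th power of the square of `D` is `D^(2g)`, which is the `D^m` of `plane_relation` for
  -- `m = 2g`.
  rw [← pow_mul]
  simpa only [Nat.cast_mul, Nat.cast_ofNat] using h
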